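/- Let $h_1\ge 0$ be an integer, let $r'_j\ge 1$ ($j=1,2,\dots$) be integers with $r'_j\to\infty$, put $r_j=2r'_j$ and $$(s_j(1),\dots,s_j(r_j))=(0,1,\dots,r'_j-1,\,0,1,\dots,r'_j-1),\qquad h_{j+1}+1=(h_j+1)r_j+\sum_{i=1}^{r_j}s_j(i),$$ and assume Adams' condition $r_j^2/h_j\to 0$. Let $T$ be an invertible measure-preserving transformation of a probability space $(X,\mu)$ that is a *double staircase transformation* with these parameters. That is, there are measurable sets $E_j$ such that for every $j$: - the levels $E_j,TE_j,\dots,T^{h_j}E_j$ are pairwise disjoint; - $E_j$ is a disjoint union of measurable pieces $E_j^1,\dots,E_j^{r_j}$ of equal measure, with $T^{h_j+1+s_j(i)}E_j^i=E_j^{i+1}$ for $1\le i<r_j$ and $E_{j+1}=E_j^1$; and, for every measurable set $A$ and every $\varepsilon>0$, for all sufficiently large $j$ there is a union of levels of the $j$-th tower whose symmetric difference with $A$ has measure less than $\varepsilon$. Write $T$ also for the unitary operator $f\mapsto f\circ T$ on $L_2(X,\mu)$ (real or complex), and let $\Theta$ be the orthogonal projection onto the constants. Then the set of weak operator limits of sequences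 $T^{n_i}$ with $n_i\to+\infty$ is exactly $$\{\Theta\}\cup\{2^{-m}T^n+(1-2^{-m})\Theta:\ m\ge 1,\ n\in\mathbb Z\},$$ and the set of weak limits of sequences $T^{n_i}$ with $n_i\in\mathbb Z$, $|n_i|\to\infty$, is the same. If the sequence $n_i\in\mathbb Z$ is arbitrary (so that the powers $T^n$ themselves are included), the set of weak limits is exactly $$\{\Theta\}\cup\{2^{-m}T^n+(1-2^{-m})\Theta:\ m\ge 0,\ n\in\mathbb Z\}.$$ These sets are countable semigroups under composition, and $T$ is not mixing. -/

import Mathlib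

open MeasureTheory Filter Topology

/-! ## Rank-one (cutting and stacking) constructions -/

/-- The number of levels of the stage-`j` tower (stages are numbered from `0`). With `h j` denoting
the index of the top level `T ^ (h j) E_j`, the tower has `h j + 1` levels; each of the `r j`
columns carries `h j + 1` levels and `s j i` spacers, so that
`h (j+1) + 1 = (h j + 1) * r j + ∑ i, s j i`. Columns are numbered `i = 0, …, r j - 1`. -/
def towerLevels (h₁ : ℕ) (r : ℕ → ℕ) (s : ℕ → ℕ → ℕ) : ℕ → ℕ
  | 0 => h₁ + 1
  | j + 1 => towerLevels h₁ r s j * r j + ∑ i ∈ Finset.range (r j), s j i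

/-- `h_j`, the index of the top level of the stage-`j` tower, as a real number. -/
noncomputable def towerHeight (h₁ : ℕ) (r : ℕ → ℕ) (s : ℕ → ℕ → ℕ) (j : ℕ) : ℝ :=
  (towerLevels h₁ r s j : ℝ) - 1

/-- `E j` is the base of the stage-`j` tower of a cutting-and-stacking construction of `T` with
initial height `h₁`, cutting numbers `r j` and spacer vectors `s j`; `C j i` (`i < r j`) are the
pieces into which `E j` is cut. -/
structure IsRankOneTowers {X : Type*} [MeasurableSpace X] (μ : Measure X) (T : X ≃ᵐ X)
    (h₁ : ℕ) (r : ℕ → ℕ) (s : ℕ → ℕ → ℕ) (E : ℕ → Set X) (C : ℕ → ℕ → Set X) : Prop where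
  /-- The bases and their pieces are measurable. -/
  measurableSet_base : ∀ j, MeasurableSet (E j)
  measurableSet_piece : ∀ j, ∀ i < r j, MeasurableSet (C j i)
  /-- The levels `E_j, T E_j, …, T ^ (h_j) E_j` are pairwise disjoint. -/
  levels_disjoint : ∀ j, ∀ k < towerLevels h₁ r s j, ∀ l < towerLevels h₁ r s j, k ≠ l →
    Disjoint (T^[k] '' E j) (T^[l] '' E j)
  /-- `E_j` is the disjoint union of `r_j` pieces of the same measure. -/
  base_eq : ∀ j, E j = ⋃ i ∈ Finset.range (r j), C j i
  pieces_disjoint : ∀ j, ∀ i < r j, ∀ i' < r j, i ≠ i' → Disjoint (C j i) (C j i')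
  measure_piece : ∀ j, ∀ i < r j, ∀ i' < r j, μ (C j i) = μ (C j i')
  /-- After the `h_j + 1` levels of the `i`-th column and its `s j i` spacers, `T` goes to the
  bottom of the next column. -/
  stack : ∀ j, ∀ i, i + 1 < r j →
    T^[towerLevels h₁ r s j + s j i] '' C j i = C j (i + 1)
  /-- The bottom of the first column is the base of the next tower. -/
  base_succ : ∀ j, E (j + 1) = C j 0
  /-- The towers exhaust the space and their levels generate its measurable sets modulo `μ`: every
  measurable set is approximated by unions of levels. -/
  approx : ∀ A, MeasurableSet A → ∀ ε > 0, ∀ᶠ j in atTop,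
    ∃ K ⊆ Finset.range (towerLevels h₁ r s j), μ (symmDiff A (⋃ k ∈ K, T^[k] '' E j)) < ε

/-- `T` is obtained by a rank-one construction with parameters `h₁`, `r`, `s`. -/
def IsRankOneTransformation {X : Type*} [MeasurableSpace X] (μ : Measure X) (T : X ≃ᵐ X)
    (h₁ : ℕ) (r : ℕ → ℕ) (s : ℕ → ℕ → ℕ) : Prop :=
  ∃ (E : ℕ → Set X) (C : ℕ → ℕ → Set X), IsRankOneTowers μ T h₁ r s E C

/-- The cutting numbers `r_j = 2 r'_j` of the double staircase. -/
def doubleCuts (r' : ℕ → ℕ) (j : ℕ) : ℕ := 2 * r' j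

/-- The spacer vectors `(0, 1, …, r'_j - 1, 0, 1, …, r'_j - 1)` of the double staircase, with
entries indexed by `i = 0, …, 2 r'_j - 1`. -/
def doubleStaircaseSpacers (r' : ℕ → ℕ) (j i : ℕ) : ℕ := i % r' j

/-- `T` is a double staircase transformation with initial height `h₁` and steps `r'_j`. -/
def IsDoubleStaircase {X : Type*} [MeasurableSpace X] (μ : Measure X) (T : X ≃ᵐ X)
    (h₁ : ℕ) (r' : ℕ → ℕ) : Prop :=
  IsRankOneTransformation μ T h₁ (doubleCuts r') (doubleStaircaseSpacers r')

/-! ## Operators on `L²` and weak limits of powers -/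

section Operators

variable {X : Type*} [MeasurableSpace X] {μ : Measure X}

/-- The unitary operator `f ↦ f ∘ T` on `L²(X, μ)` induced by an invertible measure-preserving
transformation `T`. Its integer powers are taken in the group of unitary operators. -/
noncomputable def koopman (𝕜 : Type*) [RCLike 𝕜] (T : X ≃ᵐ X) (hT : MeasurePreserving T μ μ) :
    Lp 𝕜 2 μ ≃ₗᵢ[𝕜] Lp 𝕜 2 μ :=
  LinearIsometryEquiv.ofSurjective (Lp.compMeasurePreservingₗᵢ 𝕜 T hT) fun f =>
    ⟨Lp.compMeasurePreserving T.symm (hT.symm T) f, by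
      change Lp.compMeasurePreserving T hT (Lp.compMeasurePreserving T.symm (hT.symm T) f) = f
      rw [← Lp.compMeasurePreserving_comp_apply]
      simp⟩

/-- The `n`-th power (`n ∈ ℤ`) of the operator induced by `T`, as a bounded operator. -/
noncomputable def koopmanPow (𝕜 : Type*) [RCLike 𝕜] (T : X ≃ᵐ X) (hT : MeasurePreserving T μ μ)
    (n : ℤ) : Lp 𝕜 2 μ →L[𝕜] Lp 𝕜 2 μ :=
  ((koopman 𝕜 T hT ^ n : Lp 𝕜 2 μ ≃ₗᵢ[𝕜] Lp 𝕜 2 μ) : Lp 𝕜 2 μ →L[𝕜] Lp 𝕜 2 μ)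

/-- `Θ`, the orthogonal projection of `L²(X, μ)` onto the subspace of constant functions. -/
noncomputable def constProj (𝕜 : Type*) [RCLike 𝕜] (μ : Measure X) [IsFiniteMeasure μ] :
    Lp 𝕜 2 μ →L[𝕜] Lp 𝕜 2 μ :=
  (LinearMap.range (Lp.constₗ 2 μ 𝕜 : 𝕜 →ₗ[𝕜] Lp 𝕜 2 μ)).starProjection

/-- The limits, in the weak operator topology, of the sequences `T ^ (n i)` of powers of `T` whose
exponents `n i` tend to the filter `l` on `ℤ`: `n i → +∞` for `l = atTop`, `|n i| → ∞` for
`l = cofinite`, and no restriction on `n` for `l = ⊤`. -/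
def weakLimitsOfPowers (𝕜 : Type*) [RCLike 𝕜] (T : X ≃ᵐ X) (hT : MeasurePreserving T μ μ)
    (l : Filter ℤ) : Set (Lp 𝕜 2 μ →L[𝕜] Lp 𝕜 2 μ) :=
  {Q | ∃ n : ℕ → ℤ, Tendsto n atTop l ∧
    Tendsto (fun i => ContinuousLinearMapWOT.ofCLM (koopmanPow 𝕜 T hT (n i))) atTop
      (𝓝 (ContinuousLinearMapWOT.ofCLM Q))}

/-- The set `{Θ} ∪ {2^{-m} T^n + (1 - 2^{-m}) Θ : m ≥ m₀, n ∈ ℤ}`. -/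
def dyadicLimits (𝕜 : Type*) [RCLike 𝕜] [IsFiniteMeasure μ] (T : X ≃ᵐ X)
    (hT : MeasurePreserving T μ μ) (m₀ : ℕ) : Set (Lp 𝕜 2 μ →L[𝕜] Lp 𝕜 2 μ) :=
  {constProj 𝕜 μ} ∪
    {Q | ∃ (m : ℕ) (n : ℤ), m₀ ≤ m ∧
      Q = ((2 : 𝕜) ^ m)⁻¹ • koopmanPow 𝕜 T hT n + (1 - ((2 : 𝕜) ^ m)⁻¹) • constProj 𝕜 μ}

/-- (Strong) mixing: `μ (T^{-n} A ∩ B) → μ A * μ B` for all measurable `A`, `B`. -/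
def IsMixing (μ : Measure X) (T : X ≃ᵐ X) : Prop :=
  ∀ A B, MeasurableSet A → MeasurableSet B →
    Tendsto (fun n : ℕ => μ (T^[n] ⁻¹' A ∩ B)) atTop (𝓝 (μ A * μ B))

end Operators

/-!
The argument is elementary, and takes place in the towers. For measurable sets `A`, `Y` let
`dev n A Y` be the deviation `μ (A ∩ T ^ n Y) - μ A * μ Y`. If `T ^ n` carries a column of the
stage-`j` tower to another column, up to a vertical shift by `d`, the contribution of the column
to `dev n A Y` is the `r_j`-th part of `dev d A Y`, up to negligible errors
(`eventually_abs_sum_transfer_le`). In the double staircase, if the columns `x` of one half go to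
the columns `x + c`, of the same or of the other half, these shifts are affine in `x` with slope
`c` (`sum_range_sub_sum_range`); so the total contribution is bounded by an ergodic average of the
centred indicator of `A` along a progression of step `c` (`eventually_abs_sum_half_columns_le`).

This yields one fact after another.
* Since `T` is ergodic, like all rank-one transformations, `dev` tends to zero along the exponents
  `H_j + b` with bounded `b`, where `H_j` is the number of levels. Each non-zero `c` divides such
  exponents, so a vector fixed by `T ^ c` is constant, and all non-zero powers of `T` are
  ergodic (`constProj_eq_of_koopmanPow_eq`).
* Therefore `dev` tends to zero along the exponents between `H_j` and `M * H_j`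
  (`eventually_abs_dev_le_of_le_mul`). With Adams' condition, the sums with at most `r_j`
  terms along progressions of step `c` are `o(r_j)` in norm, uniformly in `0 < |c| ≤ r_j`
  (`exists_forall_norm_sum_le`).
* Now let `H_j ≤ n ≤ H_{j+1}`. The columns that `T ^ n` carries, with a slope `c ≠ 0`, to the same
  or to the other half, and those that it carries over the top of the next tower, contribute
  nothing in the limit. The only other possibility is slope `c = 0` between the two halves, which
  requires that `n` differs from the half time `m_j = H_{j+1} / 2` by less than `H_j`. Hence
  `T ^ n` is weakly close to `Θ` if `n` is far from `m_j` (`eventually_abs_dev_le_of_far`). On the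
  other hand `T ^ m_j` carries the columns of the first half exactly onto those of the second
  half, and those of the second half over the top; so `T ^ (m_j + n)` is weakly close to
  `(T ^ n + Θ) / 2` for `|n| ≤ H_j` (`eventually_abs_dev_halfTime_add_sub_le`).

So a weak limit `Q` along `n i → +∞` is `Θ`, or `Q = (Q' + Θ) / 2` where `Q'` is a limit of powers
with exponents `n i - m_j` (`eq_constProj_or_exists_weakTendsto`). These take some value
infinitely often, in which case `Q'` is a power of `T`, or they tend to infinity in absolute value
along a subsequence, and the step may be repeated for `Q'` or its adjoint. As
`Q - Θ = (Q' - Θ) / 2`, and the norm of `Q' - Θ` is at most `2`, `Q` is of the form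
`2^{-m} T^n + (1 - 2^{-m}) Θ`, or it is `Θ` (`mem_dyadicLimits_of_mem`). Conversely
`Q ↦ (Q + Θ) / 2` maps the set of limits to itself (`WeakTendsto.half_mem`), which gives all these
operators.
-/

/-! ### Integer powers of a transformation acting on sets -/

section Shift

variable {X : Type*} [MeasurableSpace X] {μ : Measure X} {T : X ≃ᵐ X}

/-- The image `T ^ n '' S` of a set under an integer power of an invertible transformation. -/
def shift (T : X ≃ᵐ X) (n : ℤ) (S : Set X) : Set X :=
  (T.toEquiv ^ n : Equiv.Perm X) '' S

lemma shift_zero (S : Set X) : shift T 0 S = S := by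
  simp [shift]

lemma shift_shift (m n : ℤ) (S : Set X) : shift T m (shift T n S) = shift T (m + n) S := by
  simp only [shift, zpow_add, Equiv.Perm.coe_mul, Set.image_comp]

lemma shift_natCast (n : ℕ) (S : Set X) : shift T n S = T^[n] '' S := by
  have : ((T.toEquiv ^ (n : ℤ) : Equiv.Perm X) : X → X) = T^[n] := by
    rw [zpow_natCast, Equiv.Perm.coe_pow]; rfl
  rw [shift, this]

lemma shift_one (S : Set X) : shift T 1 S = T '' S := by
  simpa using shift_natCast (T := T) 1 S

lemma shift_neg_one (S : Set X) : shift T (-1) S = T ⁻¹' S := by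
  have h : shift T 1 (T ⁻¹' S) = S := by
    rw [shift_one]; exact Set.image_preimage_eq _ T.surjective
  conv_lhs => rw [← h, shift_shift]
  simp [shift_zero]

lemma measurableSet_shift (n : ℤ) {S : Set X} (hS : MeasurableSet S) :
    MeasurableSet (shift T n S) := by
  induction n with
  | zero => simpa [shift_zero] using hS
  | succ n ih =>
    rw [add_comm, ← shift_shift, shift_one]; exact T.measurableSet_image.2 ih
  | pred n ih =>
    rw [sub_eq_neg_add, ← shift_shift, shift_neg_one]; exact T.measurable ih

lemma measure_shift (hT : MeasurePreserving T μ μ) (n : ℤ) (S : Set X) :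
    μ (shift T n S) = μ S := by
  have h1 : ∀ S, μ (shift T (-1) S) = μ S := fun S => by
    rw [shift_neg_one]; exact hT.measure_preimage_equiv S
  induction n with
  | zero => simp [shift_zero]
  | succ n ih =>
    rw [← ih, ← h1 (shift T (n + 1) S), shift_shift]; simp
  | pred n ih =>
    rw [sub_eq_neg_add, ← shift_shift, h1, ih]

lemma measureReal_shift (hT : MeasurePreserving T μ μ) (n : ℤ) (S : Set X) :
    μ.real (shift T n S) = μ.real S := by
  simp [Measure.real, measure_shift hT]

lemma shift_inter (n : ℤ) (S S' : Set X) : shift T n (S ∩ S') = shift T n S ∩ shift T n S' :=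
  Set.image_inter (Equiv.injective _)

lemma shift_iUnion₂ {ι : Type*} (n : ℤ) (s : Finset ι) (Y : ι → Set X) :
    shift T n (⋃ i ∈ s, Y i) = ⋃ i ∈ s, shift T n (Y i) :=
  Set.image_iUnion₂ _ _

lemma shift_mono (n : ℤ) {S S' : Set X} (h : S ⊆ S') : shift T n S ⊆ shift T n S' :=
  Set.image_mono h

lemma disjoint_shift {n : ℤ} {S S' : Set X} : Disjoint (shift T n S) (shift T n S') ↔ Disjoint S S' :=
  Set.disjoint_image_iff (Equiv.injective _)

end Shift

/-! ### Deviation from independence -/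

section Deviation

variable {X : Type*} [MeasurableSpace X] {μ : Measure X} {T : X ≃ᵐ X}

/-- The deviation from independence `μ (A ∩ T ^ n Y) - μ A * μ Y`. The transformation is mixing
along a sequence of exponents `n` if it tends to zero along it for all measurable `A`, `Y`. -/
noncomputable def dev (μ : Measure X) (T : X ≃ᵐ X) (n : ℤ) (A Y : Set X) : ℝ :=
  μ.real (A ∩ shift T n Y) - μ.real A * μ.real Y

lemma dev_shift (hT : MeasurePreserving T μ μ) (n k : ℤ) (A Y : Set X) :
    dev μ T n A (shift T k Y) = dev μ T (n + k) A Y := by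
  simp [dev, shift_shift, measureReal_shift hT]

lemma dev_neg (hT : MeasurePreserving T μ μ) (n : ℤ) (A Y : Set X) :
    dev μ T (-n) A Y = dev μ T n Y A := by
  have : shift T n (A ∩ shift T (-n) Y) = Y ∩ shift T n A := by
    rw [shift_inter, shift_shift, add_neg_cancel, shift_zero, Set.inter_comm]
  simp only [dev]
  rw [← this, measureReal_shift hT, mul_comm]

lemma dev_eq_dev_zero_of_invariant (hT : MeasurePreserving T μ μ) {A : Set X} {n : ℤ}
    (h : shift T n A = A) (Y : Set X) : dev μ T n A Y = dev μ T 0 A Y := by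
  simp only [dev, shift_zero]
  conv_lhs => rw [← h]
  rw [← shift_inter, measureReal_shift hT, h]

variable [IsProbabilityMeasure μ]

lemma abs_dev_le (hT : MeasurePreserving T μ μ) (n : ℤ) (A Y : Set X) :
    |dev μ T n A Y| ≤ μ.real Y := by
  have h1 : μ.real (A ∩ shift T n Y) ≤ μ.real Y :=
    (measureReal_mono Set.inter_subset_right).trans_eq (measureReal_shift hT n Y)
  have h2 : μ.real A * μ.real Y ≤ 1 * μ.real Y := by gcongr; exact measureReal_le_one
  have h3 : 0 ≤ μ.real A * μ.real Y := by positivity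
  have h4 : 0 ≤ μ.real (A ∩ shift T n Y) := by positivity
  rw [dev, abs_le]; constructor <;> linarith

lemma dev_biUnion {ι : Type*} (n : ℤ) (A : Set X) (s : Finset ι)
    (Y : ι → Set X) (hA : MeasurableSet A) (hY : ∀ i ∈ s, MeasurableSet (Y i))
    (hd : (s : Set ι).PairwiseDisjoint Y) :
    dev μ T n A (⋃ i ∈ s, Y i) = ∑ i ∈ s, dev μ T n A (Y i) := by
  have h1 : A ∩ shift T n (⋃ i ∈ s, Y i) = ⋃ i ∈ s, A ∩ shift T n (Y i) := by
    rw [shift_iUnion₂, Set.inter_iUnion₂]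
  simp only [dev, Finset.sum_sub_distrib, ← Finset.mul_sum]
  rw [h1, measureReal_biUnion_finset, measureReal_biUnion_finset hd hY]
  · intro i hi j hj hij
    exact ((disjoint_shift (T := T) (n := n)).2 (hd hi hj hij)).mono Set.inter_subset_right
      Set.inter_subset_right
  · exact fun i hi => hA.inter (measurableSet_shift n (hY i hi))

lemma abs_measureReal_inter_sub_le {A A' Z : Set X} (hA : MeasurableSet A) (hA' : MeasurableSet A')
    (hZ : MeasurableSet Z) :
    |μ.real (A ∩ Z) - μ.real (A' ∩ Z)| ≤ μ.real (symmDiff A A') := by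
  refine (abs_measureReal_sub_le_measureReal_symmDiff (hA.inter hZ).nullMeasurableSet
    (hA'.inter hZ).nullMeasurableSet).trans ?_
  refine measureReal_mono ?_
  rw [Set.inter_comm A, Set.inter_comm A', ← Set.inter_symmDiff_distrib_left]
  exact Set.inter_subset_right

lemma abs_dev_sub_left_le (n : ℤ) {A A' Y : Set X}
    (hA : MeasurableSet A) (hA' : MeasurableSet A') (hY : MeasurableSet Y) :
    |dev μ T n A Y - dev μ T n A' Y| ≤ 2 * μ.real (symmDiff A A') := by
  have h1 := abs_measureReal_inter_sub_le (μ := μ) hA hA' (measurableSet_shift (T := T) n hY)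
  have h2 : |μ.real A - μ.real A'| ≤ μ.real (symmDiff A A') := by
    simpa using abs_measureReal_inter_sub_le (μ := μ) hA hA' MeasurableSet.univ
  have h3 : |(μ.real A - μ.real A') * μ.real Y| ≤ μ.real (symmDiff A A') := by
    rw [abs_mul, abs_of_nonneg (measureReal_nonneg (s := Y))]
    exact (mul_le_of_le_one_right (abs_nonneg _) measureReal_le_one).trans h2
  have : dev μ T n A Y - dev μ T n A' Y = (μ.real (A ∩ shift T n Y) - μ.real (A' ∩ shift T n Y))
    - (μ.real A - μ.real A') * μ.real Y := by simp only [dev]; ring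
  rw [this]
  exact (abs_sub _ _).trans (by linarith)

lemma abs_dev_sub_right_le (hT : MeasurePreserving T μ μ) (n : ℤ) {A Y Y' : Set X}
    (hA : MeasurableSet A) (hY : MeasurableSet Y) (hY' : MeasurableSet Y') :
    |dev μ T n A Y - dev μ T n A Y'| ≤ 2 * μ.real (symmDiff Y Y') := by
  rw [← neg_neg n, dev_neg hT (-n) A Y, dev_neg hT (-n) A Y']
  exact abs_dev_sub_left_le _ hY hY' hA

end Deviation

/-! ### Towers of a rank-one construction -/

section Towers

/-- The index, in the tower of stage `j + 1`, of the bottom level of the `i`-th column into which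
the tower of stage `j` is cut. -/
def colPos (h₁ : ℕ) (r : ℕ → ℕ) (s : ℕ → ℕ → ℕ) (j i : ℕ) : ℕ :=
  towerLevels h₁ r s j * i + ∑ t ∈ Finset.range i, s j t

/-- The union of the levels of the stage-`j` tower with indices in `K`. -/
def levelUnion {X : Type*} [MeasurableSpace X] (T : X ≃ᵐ X) (E : ℕ → Set X) (j : ℕ)
    (K : Finset ℕ) : Set X :=
  ⋃ k ∈ K, shift T k (E j)

variable {X : Type*} [MeasurableSpace X] {μ : Measure X} {T : X ≃ᵐ X}
  {h₁ : ℕ} {r : ℕ → ℕ} {s : ℕ → ℕ → ℕ} {E : ℕ → Set X} {C : ℕ → ℕ → Set X}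

lemma towerLevels_succ (h₁ : ℕ) (r : ℕ → ℕ) (s : ℕ → ℕ → ℕ) (j : ℕ) :
    towerLevels h₁ r s (j + 1) = colPos h₁ r s j (r j) := rfl

lemma towerLevels_pos (hr : ∀ j, 0 < r j) (j : ℕ) : 0 < towerLevels h₁ r s j := by
  induction j with
  | zero => simp [towerLevels]
  | succ j ih => have := Nat.mul_pos ih (hr j); simp only [towerLevels]; omega

namespace IsRankOneTowers

variable (ht : IsRankOneTowers μ T h₁ r s E C)
include ht

lemma disjoint_level {j k l : ℕ} (hk : k < towerLevels h₁ r s j) (hl : l < towerLevels h₁ r s j)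
    (hkl : k ≠ l) : Disjoint (shift T k (E j)) (shift T l (E j)) := by
  simpa only [shift_natCast] using ht.levels_disjoint j k hk l hl hkl

lemma piece_subset {j i : ℕ} (hi : i < r j) : C j i ⊆ E j := by
  rw [ht.base_eq j]
  exact Set.subset_biUnion_of_mem (u := fun i => C j i) (Finset.mem_coe.2 (Finset.mem_range.2 hi))

lemma piece_eq_shift {j i : ℕ} (hi : i < r j) :
    C j i = shift T (colPos h₁ r s j i) (E (j + 1)) := by
  induction i with
  | zero => simp [colPos, shift_zero, ht.base_succ]
  | succ i ih =>
    rw [← ht.stack j i hi, ← shift_natCast, ih (by omega), shift_shift]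
    congr 1
    simp only [colPos, Finset.sum_range_succ]
    push_cast
    ring

lemma piece_shift_eq {j i i' : ℕ} (hi : i < r j) (hi' : i' < r j) (k : ℤ) :
    shift T k (C j i) =
      shift T (k + colPos h₁ r s j i - colPos h₁ r s j i') (C j i') := by
  rw [ht.piece_eq_shift hi, ht.piece_eq_shift hi', shift_shift, shift_shift]
  congr 1
  ring

lemma measurableSet_levelUnion (j : ℕ) (K : Finset ℕ) : MeasurableSet (levelUnion T E j K) :=
  Finset.measurableSet_biUnion _ fun _ _ => measurableSet_shift _ (ht.measurableSet_base j)

lemma pairwiseDisjoint_level {j : ℕ} {K : Finset ℕ}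
    (hK : K ⊆ Finset.range (towerLevels h₁ r s j)) :
    (K : Set ℕ).PairwiseDisjoint fun k : ℕ => shift T k (E j) :=
  fun _ hk _ hl hkl => ht.disjoint_level (Finset.mem_range.1 (hK hk)) (Finset.mem_range.1 (hK hl)) hkl

/-- The intersection of a union of levels with a level of a subset of the base. -/
lemma measureReal_levelUnion_inter (hT : MeasurePreserving T μ μ) {j : ℕ} {K : Finset ℕ}
    (hK : K ⊆ Finset.range (towerLevels h₁ r s j)) {S : Set X} (hS : S ⊆ E j) {l : ℕ}
    (hl : l < towerLevels h₁ r s j) :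
    μ.real (levelUnion T E j K ∩ shift T l S) = if l ∈ K then μ.real S else 0 := by
  split_ifs with h
  · rw [Set.inter_eq_right.2, measureReal_shift hT]
    exact (shift_mono _ hS).trans (Set.subset_biUnion_of_mem (u := fun k : ℕ => shift T k (E j)) h)
  · rw [Set.disjoint_iff_inter_eq_empty.1, measureReal_empty]
    refine Disjoint.mono_right (shift_mono _ hS) ?_
    rw [levelUnion, Set.disjoint_iUnion₂_left]
    intro k hk
    exact ht.disjoint_level (Finset.mem_range.1 (hK hk)) hl (fun e => h (e ▸ hk))

lemma pairwiseDisjoint_piece {j : ℕ} {I L : Finset ℕ} (hI : I ⊆ Finset.range (r j))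
    (hL : L ⊆ Finset.range (towerLevels h₁ r s j)) :
    ((I ×ˢ L : Finset (ℕ × ℕ)) : Set (ℕ × ℕ)).PairwiseDisjoint
      fun p : ℕ × ℕ => shift T p.2 (C j p.1) := by
  rintro ⟨i, k⟩ hp ⟨i', k'⟩ hp' hne
  simp only [Finset.coe_product, Set.mem_prod, Finset.mem_coe] at hp hp'
  have hi := Finset.mem_range.1 (hI hp.1)
  have hi' := Finset.mem_range.1 (hI hp'.1)
  by_cases hk : k = k'
  · subst hk
    refine disjoint_shift.2 (ht.pieces_disjoint j i hi i' hi' ?_)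
    rintro rfl
    exact hne rfl
  · exact (ht.disjoint_level (Finset.mem_range.1 (hL hp.2)) (Finset.mem_range.1 (hL hp'.2)) hk).mono
      (shift_mono _ (ht.piece_subset hi)) (shift_mono _ (ht.piece_subset hi'))

lemma eventually_measureReal_symmDiff_le {A : Set X} (hA : MeasurableSet A) {ε : ℝ}
    (hε : 0 < ε) :
    ∀ᶠ j in atTop, ∃ K ⊆ Finset.range (towerLevels h₁ r s j),
      μ.real (symmDiff A (levelUnion T E j K)) ≤ ε := by
  filter_upwards [ht.approx A hA (ENNReal.ofReal ε) (by simpa using hε)] with j ⟨K, hK, hKA⟩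
  refine ⟨K, hK, ENNReal.toReal_le_of_le_ofReal hε.le ?_⟩
  simpa only [levelUnion, shift_natCast] using hKA.le

variable [IsProbabilityMeasure μ]

lemma measureReal_piece {j i : ℕ} (hi : i < r j) :
    μ.real (C j i) = μ.real (E j) / r j := by
  have h : μ.real (E j) = ∑ i' ∈ Finset.range (r j), μ.real (C j i') := by
    rw [ht.base_eq j, measureReal_biUnion_finset]
    · intro a ha b hb hab
      exact ht.pieces_disjoint j a (by simpa using ha) b (by simpa using hb) hab
    · exact fun a ha => ht.measurableSet_piece j a (by simpa using ha)
  have h2 : ∑ i' ∈ Finset.range (r j), μ.real (C j i') = r j * μ.real (C j i) := by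
    rw [Finset.sum_congr rfl (g := fun _ => μ.real (C j i))]
    · simp
    · intro a ha
      simp [Measure.real, ht.measure_piece j a (by simpa using ha) i hi]
  have h0 : 0 < r j := by omega
  have h3 : (r j : ℝ) ≠ 0 := by positivity
  rw [h, h2]
  field_simp

lemma measureReal_levelUnion (hT : MeasurePreserving T μ μ) {j : ℕ} {K : Finset ℕ}
    (hK : K ⊆ Finset.range (towerLevels h₁ r s j)) :
    μ.real (levelUnion T E j K) = K.card * μ.real (E j) := by
  rw [levelUnion, measureReal_biUnion_finset (ht.pairwiseDisjoint_level hK)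
    (fun _ _ => measurableSet_shift _ (ht.measurableSet_base j))]
  simp [measureReal_shift hT]

lemma towerLevels_mul_le (hT : MeasurePreserving T μ μ) (j : ℕ) :
    towerLevels h₁ r s j * μ.real (E j) ≤ 1 := by
  have h := ht.measureReal_levelUnion hT (j := j) (Finset.Subset.refl _)
  rw [Finset.card_range] at h
  rw [← h]
  exact measureReal_le_one

lemma dev_levelUnion (n : ℤ) {j : ℕ} {A : Set X} (hA : MeasurableSet A) {K : Finset ℕ}
    (hK : K ⊆ Finset.range (towerLevels h₁ r s j)) :
    dev μ T n A (levelUnion T E j K) = ∑ k ∈ K, dev μ T n A (shift T k (E j)) :=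
  dev_biUnion _ _ _ _ hA (fun _ _ => measurableSet_shift _ (ht.measurableSet_base j))
    (ht.pairwiseDisjoint_level hK)

lemma abs_dev_levelUnion_le (hT : MeasurePreserving T μ μ) (n : ℤ) {j : ℕ} (A : Set X)
    {K : Finset ℕ} (hK : K ⊆ Finset.range (towerLevels h₁ r s j)) :
    |dev μ T n A (levelUnion T E j K)| ≤ K.card * μ.real (E j) :=
  (abs_dev_le hT _ _ _).trans_eq (ht.measureReal_levelUnion hT hK)

/-- Moving a level of the column `i` to a level of the column `i'`: in the tower, the deviation
from independence of a union of levels does not depend on the column. -/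
lemma dev_levelUnion_piece (hT : MeasurePreserving T μ μ) {j i i' : ℕ} (hi : i < r j)
    (hi' : i' < r j) {K : Finset ℕ} (hK : K ⊆ Finset.range (towerLevels h₁ r s j)) (n : ℤ) (k : ℕ)
    (h0 : 0 ≤ k + (n + colPos h₁ r s j i - colPos h₁ r s j i'))
    (h1 : k + (n + colPos h₁ r s j i - colPos h₁ r s j i') < towerLevels h₁ r s j) :
    dev μ T n (levelUnion T E j K) (shift T k (C j i)) = dev μ T
      (n + colPos h₁ r s j i - colPos h₁ r s j i') (levelUnion T E j K) (shift T k (E j)) / r j := by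
  obtain ⟨l, hl⟩ := Int.eq_ofNat_of_zero_le h0
  have h2 : shift T n (shift T k (C j i)) = shift T l (C j i') := by
    rw [shift_shift, ht.piece_shift_eq hi hi', ← hl]
    congr 1
    ring
  have h3 : shift T (n + colPos h₁ r s j i - colPos h₁ r s j i') (shift T k (E j))
      = shift T l (E j) := by
    rw [shift_shift, ← hl]
    congr 1
    ring
  have hl' : l < towerLevels h₁ r s j := by omega
  simp only [dev]
  rw [h2, h3, ht.measureReal_levelUnion_inter hT hK (ht.piece_subset hi') hl',
    ht.measureReal_levelUnion_inter hT hK subset_rfl hl', measureReal_shift hT, measureReal_shift hT,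
    ht.measureReal_piece hi, ht.measureReal_piece hi']
  split_ifs <;> ring

/-- The part of the levels in `L` that lies in the columns in `I`. -/
lemma dev_columns {j : ℕ} {I L : Finset ℕ} (hI : I ⊆ Finset.range (r j))
    (hL : L ⊆ Finset.range (towerLevels h₁ r s j)) (n : ℤ) {A : Set X} (hA : MeasurableSet A) :
    dev μ T n A (⋃ p ∈ I ×ˢ L, shift T (p.2 : ℕ) (C j p.1)) =
      ∑ i ∈ I, ∑ k ∈ L, dev μ T n A (shift T k (C j i)) := by
  rw [dev_biUnion _ _ _ _ hA _ (ht.pairwiseDisjoint_piece hI hL), Finset.sum_product]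
  rintro ⟨i, k⟩ hp
  exact measurableSet_shift _ (ht.measurableSet_piece j i
    (Finset.mem_range.1 (hI (Finset.mem_product.1 hp).1)))

lemma dev_level_eq_sum (n : ℤ) {j : ℕ} {A : Set X} (hA : MeasurableSet A) (k : ℤ) :
    dev μ T n A (shift T k (E j)) = ∑ i ∈ Finset.range (r j), dev μ T n A (shift T k (C j i)) := by
  have h := dev_biUnion (μ := μ) (T := T) n A (Finset.range (r j)) (fun i => shift T k (C j i)) hA
    (fun i hi => measurableSet_shift _ (ht.measurableSet_piece j i (Finset.mem_range.1 hi)))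
    (fun i hi i' hi' hne => disjoint_shift.2 (ht.pieces_disjoint j i (by simpa using hi) i'
      (by simpa using hi') hne))
  rw [← h, ← shift_iUnion₂, ← ht.base_eq]

lemma dev_levelUnion_eq_sum (n : ℤ) {j : ℕ} {A : Set X} (hA : MeasurableSet A) {L : Finset ℕ}
    (hL : L ⊆ Finset.range (towerLevels h₁ r s j)) :
    dev μ T n A (levelUnion T E j L) =
      ∑ i ∈ Finset.range (r j), ∑ k ∈ L, dev μ T n A (shift T k (C j i)) := by
  rw [ht.dev_levelUnion n hA hL, Finset.sum_comm]
  exact Finset.sum_congr rfl fun k _ => ht.dev_level_eq_sum n hA k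

lemma abs_dev_piece_le (hT : MeasurePreserving T μ μ) (n : ℤ) {j i : ℕ} (hi : i < r j)
    (A : Set X) (k : ℤ) :
    |dev μ T n A (shift T k (C j i))| ≤ μ.real (E j) / r j := by
  rw [← ht.measureReal_piece hi, ← measureReal_shift hT k]
  exact abs_dev_le hT _ _ _

/-- The contribution of one column is negligible. -/
lemma abs_sum_dev_column_le (hT : MeasurePreserving T μ μ) (n : ℤ) {j i : ℕ} (hi : i < r j)
    (A : Set X) {L : Finset ℕ} (hL : L ⊆ Finset.range (towerLevels h₁ r s j)) :
    |∑ k ∈ L, dev μ T n A (shift T k (C j i))| ≤ 1 / r j := by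
  calc |∑ k ∈ L, dev μ T n A (shift T k (C j i))|
      ≤ ∑ k ∈ L, |dev μ T n A (shift T k (C j i))| := Finset.abs_sum_le_sum_abs _ _
    _ ≤ ∑ k ∈ L, μ.real (E j) / r j := Finset.sum_le_sum fun k _ => ht.abs_dev_piece_le hT n hi A k
    _ = (L.card * μ.real (E j)) / r j := by rw [Finset.sum_const, nsmul_eq_mul]; ring
    _ ≤ (towerLevels h₁ r s j * μ.real (E j)) / r j := by
        gcongr
        simpa using Finset.card_le_card hL
    _ ≤ 1 / r j := by gcongr; exact ht.towerLevels_mul_le hT j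

lemma abs_sum_transfer_le (hT : MeasurePreserving T μ μ) {j : ℕ} {I L K : Finset ℕ}
    (hI : I ⊆ Finset.range (r j)) (hL : L ⊆ Finset.range (towerLevels h₁ r s j))
    (hK : K ⊆ Finset.range (towerLevels h₁ r s j)) (n : ℤ) (t : ℕ → ℕ) (ht' : ∀ i ∈ I, t i < r j)
    (M : ℝ) (hM0 : 0 ≤ M)
    (hM : ∀ i ∈ I, ((L.filter fun k : ℕ => ¬ (0 ≤ k + (n + colPos h₁ r s j i - colPos h₁ r s j (t i)) ∧
      k + (n + colPos h₁ r s j i - colPos h₁ r s j (t i)) < towerLevels h₁ r s j)).card : ℝ) ≤ M) :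
    |∑ i ∈ I, ∑ k ∈ L, dev μ T n (levelUnion T E j K) (shift T k (C j i)) -
      (∑ i ∈ I, dev μ T (n + colPos h₁ r s j i - colPos h₁ r s j (t i)) (levelUnion T E j K)
        (levelUnion T E j L)) / r j| ≤ 2 * M * μ.real (E j) := by
  set w := μ.real (E j) with hw
  have hw0 : 0 ≤ w := measureReal_nonneg
  set F : ℕ → ℕ → ℝ := fun i k => dev μ T n (levelUnion T E j K) (shift T k (C j i)) -
    dev μ T (n + colPos h₁ r s j i - colPos h₁ r s j (t i)) (levelUnion T E j K)
      (shift T k (E j)) / r j with hF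
  have h1 : ∑ i ∈ I, ∑ k ∈ L, dev μ T n (levelUnion T E j K) (shift T k (C j i)) -
      (∑ i ∈ I, dev μ T (n + colPos h₁ r s j i - colPos h₁ r s j (t i)) (levelUnion T E j K)
        (levelUnion T E j L)) / r j = ∑ i ∈ I, ∑ k ∈ L, F i k := by
    simp only [hF, Finset.sum_sub_distrib, Finset.sum_div]
    congr 1
    refine Finset.sum_congr rfl fun i _ => ?_
    rw [ht.dev_levelUnion _ (ht.measurableSet_levelUnion j K) hL, Finset.sum_div]
  have h2 : ∀ i ∈ I, |∑ k ∈ L, F i k| ≤ 2 * M * w / r j := by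
    intro i hi
    have hir := Finset.mem_range.1 (hI hi)
    rw [← Finset.sum_filter_add_sum_filter_not L (fun k : ℕ =>
      0 ≤ k + (n + colPos h₁ r s j i - colPos h₁ r s j (t i)) ∧
      k + (n + colPos h₁ r s j i - colPos h₁ r s j (t i)) < towerLevels h₁ r s j)]
    rw [Finset.sum_eq_zero, zero_add]
    · refine (Finset.abs_sum_le_sum_abs _ _).trans ?_
      have h3 : ∀ k : ℕ, |F i k| ≤ 2 * w / r j := by
        intro k
        have e1 := ht.abs_dev_piece_le hT n hir (levelUnion T E j K) k
        have e2 : |dev μ T (n + colPos h₁ r s j i - colPos h₁ r s j (t i)) (levelUnion T E j K)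
            (shift T k (E j)) / r j| ≤ w / r j := by
          rw [abs_div, abs_of_nonneg (Nat.cast_nonneg (r j) : (0:ℝ) ≤ r j)]
          gcongr
          exact (abs_dev_le hT _ _ _).trans_eq (measureReal_shift hT _ _)
        refine (abs_sub _ _).trans ((add_le_add e1 e2).trans_eq ?_)
        rw [← hw]; ring
      refine (Finset.sum_le_sum fun k _ => h3 k).trans ?_
      rw [Finset.sum_const, nsmul_eq_mul]
      calc _ ≤ M * (2 * w / r j) := by gcongr; exact hM i hi
        _ = _ := by ring
    · intro k hk
      obtain ⟨_, hk1, hk2⟩ := Finset.mem_filter.1 hk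
      rw [hF]
      simp only
      rw [ht.dev_levelUnion_piece hT hir (ht' i hi) hK n k hk1 hk2, sub_self]
  rw [h1]
  have hMw : 0 ≤ 2 * M * w := by positivity
  calc _ ≤ ∑ i ∈ I, |∑ k ∈ L, F i k| := Finset.abs_sum_le_sum_abs _ _
    _ ≤ ∑ i ∈ I, 2 * M * w / r j := Finset.sum_le_sum h2
    _ = (I.card : ℝ) / r j * (2 * M * w) := by rw [Finset.sum_const, nsmul_eq_mul]; ring
    _ ≤ 1 * (2 * M * w) := by
        gcongr
        refine div_le_one_of_le₀ ?_ (by positivity)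
        exact_mod_cast (Finset.card_le_card hI).trans_eq (Finset.card_range _)
    _ = _ := one_mul _

/-- Uniformly in all parameters, the columns in `I` of the levels in `L` may be followed along `T`
to other columns, at the price of changing the exponent by the displacement of the column. The
exceptional levels, which leave the tower, have to be negligible in number. -/
lemma eventually_abs_sum_transfer_le (hT : MeasurePreserving T μ μ) {A : Set X}
    (hA : MeasurableSet A) (M : ℕ → ℝ) (hM0 : ∀ j, 0 ≤ M j)
    (hM : Tendsto (fun j => M j / towerLevels h₁ r s j) atTop (𝓝 0))
    (hr : ∀ j, 0 < r j) {ε : ℝ} (hε : 0 < ε) :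
    ∀ᶠ j in atTop, ∀ I ⊆ Finset.range (r j), ∀ L ⊆ Finset.range (towerLevels h₁ r s j), ∀ n : ℤ,
      ∀ t : ℕ → ℕ, (∀ i ∈ I, t i < r j) →
      (∀ i ∈ I, ((L.filter fun k : ℕ => ¬ (0 ≤ k + (n + colPos h₁ r s j i - colPos h₁ r s j (t i)) ∧
        k + (n + colPos h₁ r s j i - colPos h₁ r s j (t i)) < towerLevels h₁ r s j)).card : ℝ)
          ≤ M j) →
      |∑ i ∈ I, ∑ k ∈ L, dev μ T n A (shift T k (C j i)) -
        (∑ i ∈ I, dev μ T (n + colPos h₁ r s j i - colPos h₁ r s j (t i)) A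
          (levelUnion T E j L)) / r j| ≤ ε := by
  filter_upwards [ht.eventually_measureReal_symmDiff_le hA (show 0 < ε / 8 by positivity),
    hM.eventually (gt_mem_nhds (show (0 : ℝ) < ε / 4 by positivity))] with j hj hMj I hI L hL n t ht'
    hcard
  obtain ⟨K, hK, hδ⟩ := hj
  set A' := levelUnion T E j K
  have hA'm : MeasurableSet A' := ht.measurableSet_levelUnion j K
  have hrj : (0 : ℝ) < r j := by exact_mod_cast hr j
  have hHj : (0 : ℝ) < towerLevels h₁ r s j := by exact_mod_cast towerLevels_pos hr j
  have h1 := ht.abs_sum_transfer_le hT hI hL hK n t ht' (M j) (hM0 j) hcard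
  have h2 : 2 * M j * μ.real (E j) ≤ ε / 2 := by
    have e1 := ht.towerLevels_mul_le hT j
    rw [div_lt_iff₀ hHj] at hMj
    have : 0 ≤ μ.real (E j) := measureReal_nonneg
    calc 2 * M j * μ.real (E j) ≤ 2 * (ε / 4 * towerLevels h₁ r s j) * μ.real (E j) := by
          gcongr
      _ = ε / 2 * (towerLevels h₁ r s j * μ.real (E j)) := by ring
      _ ≤ ε / 2 * 1 := by gcongr
      _ = _ := by ring
  have h3 : |∑ i ∈ I, ∑ k ∈ L, dev μ T n A (shift T k (C j i)) -
      ∑ i ∈ I, ∑ k ∈ L, dev μ T n A' (shift T k (C j i))| ≤ ε / 4 := by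
    rw [← ht.dev_columns hI hL n hA, ← ht.dev_columns hI hL n hA'm]
    refine (abs_dev_sub_left_le n hA hA'm ?_).trans (by linarith)
    refine Finset.measurableSet_biUnion _ fun p hp => measurableSet_shift _ ?_
    exact ht.measurableSet_piece j _ (Finset.mem_range.1 (hI (Finset.mem_product.1 hp).1))
  have h4 : |(∑ i ∈ I, dev μ T (n + colPos h₁ r s j i - colPos h₁ r s j (t i)) A'
      (levelUnion T E j L)) / r j - (∑ i ∈ I, dev μ T (n + colPos h₁ r s j i -
        colPos h₁ r s j (t i)) A (levelUnion T E j L)) / r j| ≤ ε / 4 := by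
    rw [← sub_div, ← Finset.sum_sub_distrib, abs_div, abs_of_pos hrj, div_le_iff₀ hrj]
    calc _ ≤ ∑ i ∈ I, ε / 4 := by
          refine (Finset.abs_sum_le_sum_abs _ _).trans (Finset.sum_le_sum fun i _ => ?_)
          rw [abs_sub_comm]
          exact (abs_dev_sub_left_le _ hA hA'm (ht.measurableSet_levelUnion j L)).trans (by linarith)
      _ = I.card * (ε / 4) := by simp
      _ ≤ r j * (ε / 4) := by
          gcongr
          exact_mod_cast (Finset.card_le_card hI).trans_eq (Finset.card_range _)
      _ = _ := by ring
  rw [abs_le] at *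
  constructor <;> linarith [h1.1, h1.2, h3.1, h3.2, h4.1, h4.2]

end IsRankOneTowers

end Towers

/-! ### The operators on `L²` -/

section Operators

open scoped InnerProductSpace

variable {𝕜 : Type*} [RCLike 𝕜] {X : Type*} [MeasurableSpace X] {μ : Measure X} {T : X ≃ᵐ X}

section Powers

variable (hT : MeasurePreserving T μ μ)

lemma koopmanPow_zero : koopmanPow 𝕜 T hT 0 = 1 := by
  ext1 f; simp [koopmanPow]

lemma koopmanPow_add (m n : ℤ) :
    koopmanPow 𝕜 T hT (m + n) = koopmanPow 𝕜 T hT m * koopmanPow 𝕜 T hT n := by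
  ext1 f; simp [koopmanPow, zpow_add]

lemma koopmanPow_add_apply (m n : ℤ) (f : Lp 𝕜 2 μ) :
    koopmanPow 𝕜 T hT (m + n) f = koopmanPow 𝕜 T hT m (koopmanPow 𝕜 T hT n f) := by
  rw [koopmanPow_add]; rfl

lemma norm_koopmanPow_apply (n : ℤ) (f : Lp 𝕜 2 μ) : ‖koopmanPow 𝕜 T hT n f‖ = ‖f‖ :=
  (koopman 𝕜 T hT ^ n).norm_map f

lemma inner_koopmanPow_koopmanPow (n : ℤ) (f g : Lp 𝕜 2 μ) :
    ⟪koopmanPow 𝕜 T hT n f, koopmanPow 𝕜 T hT n g⟫_𝕜 = ⟪f, g⟫_𝕜 :=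
  (koopman 𝕜 T hT ^ n).inner_map_map f g

lemma inner_koopmanPow_left (n : ℤ) (f g : Lp 𝕜 2 μ) :
    ⟪koopmanPow 𝕜 T hT n f, g⟫_𝕜 = ⟪f, koopmanPow 𝕜 T hT (-n) g⟫_𝕜 := by
  rw [← inner_koopmanPow_koopmanPow hT (-n), ← koopmanPow_add_apply, neg_add_cancel,
    koopmanPow_zero]
  rfl

lemma norm_koopmanPow_le (n : ℤ) : ‖koopmanPow 𝕜 T hT n‖ ≤ 1 :=
  ContinuousLinearMap.opNorm_le_bound _ zero_le_one fun f => by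
    rw [norm_koopmanPow_apply, one_mul]

lemma koopmanPow_mul_eq_iterate (c : ℤ) (n : ℕ) (f : Lp 𝕜 2 μ) :
    koopmanPow 𝕜 T hT (c * n) f = (koopmanPow 𝕜 T hT c)^[n] f := by
  induction n with
  | zero => simp [koopmanPow_zero]
  | succ n ih =>
    rw [Function.iterate_succ_apply', ← ih, ← koopmanPow_add_apply]
    congr 2; push_cast; ring

end Powers

variable [IsProbabilityMeasure μ]

variable (𝕜 μ) in
/-- The indicator function of a measurable set as an element of `L²`. -/
noncomputable def ind {A : Set X} (hA : MeasurableSet A) : Lp 𝕜 2 μ :=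
  indicatorConstLp 2 hA (measure_ne_top μ A) (1 : 𝕜)

lemma ind_congr {A B : Set X} (hA : MeasurableSet A) (hB : MeasurableSet B) (h : A = B) :
    ind 𝕜 μ hA = ind 𝕜 μ hB := by
  subst h; rfl

lemma inner_ind {A B : Set X} (hA : MeasurableSet A) (hB : MeasurableSet B) :
    ⟪ind 𝕜 μ hA, ind 𝕜 μ hB⟫_𝕜 = (μ.real (A ∩ B) : 𝕜) :=
  L2.inner_indicatorConstLp_one_indicatorConstLp_one hA hB _ _

lemma norm_ind_le {A : Set X} (hA : MeasurableSet A) : ‖ind 𝕜 μ hA‖ ≤ 1 := by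
  have h : ‖ind 𝕜 μ hA‖ ^ 2 = μ.real A := by
    have := inner_self_eq_norm_sq_to_K (𝕜 := 𝕜) (ind 𝕜 μ hA)
    rw [inner_ind, Set.inter_self] at this
    exact_mod_cast this.symm
  have h1 : μ.real A ≤ 1 := measureReal_le_one
  nlinarith [norm_nonneg (ind 𝕜 μ hA)]

variable (hT : MeasurePreserving T μ μ)

lemma koopmanPow_one_ind {A : Set X} (hA : MeasurableSet A) :
    koopmanPow 𝕜 T hT 1 (ind 𝕜 μ hA) = ind 𝕜 μ (measurableSet_shift (T := T) (-1) hA) := by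
  rw [ind_congr _ (T.measurable hA) (shift_neg_one A)]
  simp only [koopmanPow, zpow_one]
  exact Lp.indicatorConstLp_compMeasurePreserving hA _ _ hT

lemma koopmanPow_ind (n : ℤ) {A : Set X} (hA : MeasurableSet A) :
    koopmanPow 𝕜 T hT n (ind 𝕜 μ hA) = ind 𝕜 μ (measurableSet_shift (T := T) (-n) hA) := by
  have h1 : ∀ {B : Set X} (hB : MeasurableSet B), koopmanPow 𝕜 T hT (-1) (ind 𝕜 μ hB) =
      ind 𝕜 μ (measurableSet_shift (T := T) 1 hB) := by
    intro B hB
    have h : koopmanPow 𝕜 T hT 1 (ind 𝕜 μ (measurableSet_shift (T := T) 1 hB)) = ind 𝕜 μ hB :=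
      (koopmanPow_one_ind hT _).trans
        (ind_congr _ _ (by rw [shift_shift, neg_add_cancel, shift_zero]))
    rw [← h, ← koopmanPow_add_apply, neg_add_cancel, koopmanPow_zero]
    rfl
  induction n with
  | zero =>
    rw [koopmanPow_zero]
    exact ind_congr hA _ (by simp [shift_zero])
  | succ n ih =>
    rw [add_comm, koopmanPow_add_apply, ih, koopmanPow_one_ind]
    exact ind_congr _ _ (by rw [shift_shift]; congr 1; ring)
  | pred n ih =>
    rw [sub_eq_add_neg, add_comm, koopmanPow_add_apply, ih, h1]
    exact ind_congr _ _ (by rw [shift_shift]; congr 1; ring)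

lemma inner_ind_koopmanPow_ind (n : ℤ) {A B : Set X} (hA : MeasurableSet A)
    (hB : MeasurableSet B) :
    ⟪ind 𝕜 μ hB, koopmanPow 𝕜 T hT n (ind 𝕜 μ hA)⟫_𝕜 = (μ.real (A ∩ shift T n B) : 𝕜) := by
  have : shift T n (B ∩ shift T (-n) A) = A ∩ shift T n B := by
    rw [shift_inter, shift_shift, add_neg_cancel, shift_zero, Set.inter_comm]
  rw [koopmanPow_ind, inner_ind, ← this, measureReal_shift hT]

variable (𝕜 μ) in
/-- The constant function `1` as an element of `L²`. -/
noncomputable def oneL2 : Lp 𝕜 2 μ := ind 𝕜 μ MeasurableSet.univ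

lemma inner_oneL2_ind {A : Set X} (hA : MeasurableSet A) :
    ⟪oneL2 𝕜 μ, ind 𝕜 μ hA⟫_𝕜 = (μ.real A : 𝕜) := by
  rw [oneL2, inner_ind, Set.univ_inter]

lemma inner_oneL2_oneL2 : ⟪oneL2 𝕜 μ, oneL2 𝕜 μ⟫_𝕜 = 1 :=
  (inner_oneL2_ind MeasurableSet.univ).trans (by simp)

lemma const_eq_smul_oneL2 (c : 𝕜) : Lp.const 2 μ c = c • oneL2 𝕜 μ := by
  rw [oneL2, ind, indicatorConstLp_univ]
  have := (Lp.constₗ (E := 𝕜) 2 μ 𝕜).map_smul c (1 : 𝕜)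
  simpa using this

lemma constProj_apply (f : Lp 𝕜 2 μ) : constProj 𝕜 μ f = ⟪oneL2 𝕜 μ, f⟫_𝕜 • oneL2 𝕜 μ := by
  have hmem : ∀ c : 𝕜, c • oneL2 𝕜 μ ∈ LinearMap.range (Lp.constₗ 2 μ 𝕜 : 𝕜 →ₗ[𝕜] Lp 𝕜 2 μ) :=
    fun c => ⟨c, const_eq_smul_oneL2 c⟩
  refine Submodule.eq_starProjection_of_mem_of_inner_eq_zero (hmem _) ?_
  rintro _ ⟨c, rfl⟩
  have e : (Lp.constₗ 2 μ 𝕜 : 𝕜 →ₗ[𝕜] Lp 𝕜 2 μ) c = c • oneL2 𝕜 μ := const_eq_smul_oneL2 c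
  rw [e, inner_sub_left, inner_smul_right, inner_smul_left, inner_smul_right, inner_oneL2_oneL2,
    inner_conj_symm]
  ring

lemma koopmanPow_oneL2 (n : ℤ) : koopmanPow 𝕜 T hT n (oneL2 𝕜 μ) = oneL2 𝕜 μ := by
  rw [oneL2, koopmanPow_ind]
  exact ind_congr _ _ (by rw [shift]; exact Set.image_univ_of_surjective (Equiv.surjective _))

lemma koopmanPow_mul_constProj (n : ℤ) :
    koopmanPow 𝕜 T hT n * constProj 𝕜 μ = constProj 𝕜 μ := by
  ext1 f
  simp [constProj_apply, koopmanPow_oneL2]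

lemma constProj_mul_koopmanPow (n : ℤ) :
    constProj 𝕜 μ * koopmanPow 𝕜 T hT n = constProj 𝕜 μ := by
  ext1 f
  have : ⟪oneL2 𝕜 μ, koopmanPow 𝕜 T hT n f⟫_𝕜 = ⟪oneL2 𝕜 μ, f⟫_𝕜 := by
    rw [← inner_koopmanPow_koopmanPow hT n (oneL2 𝕜 μ) f, koopmanPow_oneL2]
  simp [constProj_apply, this]

lemma constProj_mul_constProj : constProj 𝕜 μ * constProj 𝕜 μ = constProj 𝕜 μ := by
  ext1 f
  simp only [mul_apply_eq_comp, constProj_apply, inner_smul_right, inner_oneL2_oneL2,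
    mul_one]

lemma inner_constProj_left (f g : Lp 𝕜 2 μ) :
    ⟪constProj 𝕜 μ f, g⟫_𝕜 = ⟪f, constProj 𝕜 μ g⟫_𝕜 := by
  rw [constProj_apply, constProj_apply, inner_smul_left, inner_smul_right, inner_conj_symm]
  ring

lemma norm_constProj_le : ‖constProj 𝕜 μ‖ ≤ 1 :=
  Submodule.starProjection_norm_le _

lemma inner_ind_constProj_ind {A B : Set X} (hA : MeasurableSet A) (hB : MeasurableSet B) :
    ⟪ind 𝕜 μ hB, constProj 𝕜 μ (ind 𝕜 μ hA)⟫_𝕜 = (μ.real A * μ.real B : ℝ) := by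
  rw [constProj_apply, inner_smul_right, inner_oneL2_ind, ← inner_conj_symm, inner_oneL2_ind]
  simp

variable (𝕜 μ) in
/-- The centred indicator function `1_A - μ A`. -/
noncomputable def centred {A : Set X} (hA : MeasurableSet A) : Lp 𝕜 2 μ :=
  ind 𝕜 μ hA - constProj 𝕜 μ (ind 𝕜 μ hA)

lemma constProj_centred {A : Set X} (hA : MeasurableSet A) :
    constProj 𝕜 μ (centred 𝕜 μ hA) = 0 := by
  have : constProj 𝕜 μ (constProj 𝕜 μ (ind 𝕜 μ hA)) = constProj 𝕜 μ (ind 𝕜 μ hA) := by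
    conv_rhs => rw [← constProj_mul_constProj]
    rfl
  rw [centred, map_sub, this, sub_self]

lemma norm_centred_le {A : Set X} (hA : MeasurableSet A) : ‖centred 𝕜 μ hA‖ ≤ 1 := by
  have h2 : ⟪centred 𝕜 μ hA, centred 𝕜 μ hA⟫_𝕜 = ⟪ind 𝕜 μ hA, centred 𝕜 μ hA⟫_𝕜 := by
    nth_rw 1 [centred]
    rw [inner_sub_left, inner_constProj_left, constProj_centred, inner_zero_right, sub_zero]
  have h1 : ‖centred 𝕜 μ hA‖ ^ 2 ≤ ‖ind 𝕜 μ hA‖ * ‖centred 𝕜 μ hA‖ := by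
    refine le_trans (le_of_eq ?_) (norm_inner_le_norm (𝕜 := 𝕜) _ _)
    rw [← h2, inner_self_eq_norm_sq_to_K, norm_pow, RCLike.norm_ofReal, abs_norm]
  have h3 := norm_ind_le (𝕜 := 𝕜) (μ := μ) hA
  nlinarith [norm_nonneg (centred 𝕜 μ hA)]

lemma koopmanPow_centred (n : ℤ) {A : Set X} (hA : MeasurableSet A) :
    koopmanPow 𝕜 T hT n (centred 𝕜 μ hA) =
      koopmanPow 𝕜 T hT n (ind 𝕜 μ hA) - constProj 𝕜 μ (ind 𝕜 μ hA) := by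
  rw [centred, map_sub]
  congr 1
  conv_rhs => rw [← koopmanPow_mul_constProj hT n]
  rfl

lemma inner_ind_koopmanPow_centred (n : ℤ) {A B : Set X} (hA : MeasurableSet A)
    (hB : MeasurableSet B) :
    ⟪ind 𝕜 μ hB, koopmanPow 𝕜 T hT n (centred 𝕜 μ hA)⟫_𝕜 = (dev μ T n A B : 𝕜) := by
  rw [koopmanPow_centred, inner_sub_right, inner_ind_koopmanPow_ind, inner_ind_constProj_ind, dev]
  push_cast
  rfl

/-- The sum of the deviations along a finite family of exponents is bounded by the norm of the
corresponding sum of powers of the operator. -/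
lemma abs_sum_dev_le {ι : Type*} (I : Finset ι) (z : ι → ℤ) {A B : Set X} (hA : MeasurableSet A)
    (hB : MeasurableSet B) :
    |∑ i ∈ I, dev μ T (z i) A B| ≤
      ‖∑ i ∈ I, koopmanPow 𝕜 T hT (z i) (centred 𝕜 μ hA)‖ := by
  have h : ((∑ i ∈ I, dev μ T (z i) A B : ℝ) : 𝕜) =
      ⟪ind 𝕜 μ hB, ∑ i ∈ I, koopmanPow 𝕜 T hT (z i) (centred 𝕜 μ hA)⟫_𝕜 := by
    rw [inner_sum]
    simp only [inner_ind_koopmanPow_centred]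
    push_cast
    rfl
  have h2 : |∑ i ∈ I, dev μ T (z i) A B| = ‖((∑ i ∈ I, dev μ T (z i) A B : ℝ) : 𝕜)‖ := by
    rw [RCLike.norm_ofReal]
  rw [h2, h]
  refine (norm_inner_le_norm _ _).trans (mul_le_of_le_one_left (norm_nonneg _) (norm_ind_le hB))

lemma isClosed_setOf_tendsto_zero {ι V : Type*} [NormedAddCommGroup V] {l : Filter ι}
    (φ : ι → V → 𝕜) (c : ℝ) (hφ : ∀ i f g, ‖φ i f - φ i g‖ ≤ c * ‖f - g‖) :
    IsClosed {f : V | Tendsto (fun i => φ i f) l (𝓝 0)} := by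
  refine isClosed_of_closure_subset fun f hf => ?_
  rw [Set.mem_ofPred_eq, tendsto_zero_iff_norm_tendsto_zero, Metric.tendsto_nhds]
  intro ε hε
  obtain ⟨g, hg, hfg⟩ := Metric.mem_closure_iff.1 hf (ε / (2 * (|c| + 1))) (by positivity)
  rw [Set.mem_ofPred_eq, tendsto_zero_iff_norm_tendsto_zero] at hg
  filter_upwards [hg.eventually (gt_mem_nhds (show 0 < ε / 2 by positivity))] with i hi
  have h1 := hφ i f g
  have h2 : c * ‖f - g‖ ≤ ε / 2 := by
    rw [dist_eq_norm, lt_div_iff₀ (by positivity)] at hfg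
    nlinarith [norm_nonneg (f - g), le_abs_self c]
  rw [Real.dist_eq, sub_zero, abs_norm]
  have h3 := norm_add_le (φ i f - φ i g) (φ i g)
  rw [sub_add_cancel] at h3
  linarith

lemma indicatorConstLp_eq_smul_ind (a : 𝕜) {S : Set X} (hS : MeasurableSet S) (hμ : μ S ≠ ⊤) :
    indicatorConstLp 2 hS hμ a = a • ind 𝕜 μ hS := by
  rw [ind, indicatorConstLp, indicatorConstLp, ← MemLp.toLp_const_smul]
  refine MemLp.toLp_congr _ _ (ae_of_all _ fun x => ?_)
  by_cases hx : x ∈ S <;> simp [hx]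

/-- A closed additive condition on `L²` holds everywhere if it holds for the multiples of indicator
functions. -/
lemma induction_ind {P : Lp 𝕜 2 μ → Prop}
    (hind : ∀ (a : 𝕜) {A : Set X} (hA : MeasurableSet A), P (a • ind 𝕜 μ hA))
    (hadd : ∀ f g, P f → P g → P (f + g)) (hP : IsClosed {f | P f}) (f : Lp 𝕜 2 μ) : P f := by
  refine Lp.induction (by simp) (motive := P) ?_ (fun f g hf hg _ => hadd _ _) hP f
  intro a S hS hμ
  rw [Lp.simpleFunc.coe_indicatorConst, indicatorConstLp_eq_smul_ind]
  exact hind a hS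

/-- A family of uniformly bounded operators tends to zero weakly if it does so on indicator
functions. -/
lemma tendsto_inner_of_ind {ι : Type*} {l : Filter ι} (V : ι → Lp 𝕜 2 μ →L[𝕜] Lp 𝕜 2 μ) (c : ℝ)
    (hV : ∀ i, ‖V i‖ ≤ c)
    (h : ∀ {A B : Set X} (hA : MeasurableSet A) (hB : MeasurableSet B),
      Tendsto (fun i => ⟪ind 𝕜 μ hB, V i (ind 𝕜 μ hA)⟫_𝕜) l (𝓝 0)) (f g : Lp 𝕜 2 μ) :
    Tendsto (fun i => ⟪g, V i f⟫_𝕜) l (𝓝 0) := by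
  induction g using induction_ind with
  | hind a hB =>
    have : Tendsto (fun i => ⟪ind 𝕜 μ hB, V i f⟫_𝕜) l (𝓝 0) := by
      induction f using induction_ind with
      | hind b hA => simpa [inner_smul_right] using (h hA hB).const_mul b
      | hadd f f' hf hf' => simpa [inner_add_right] using hf.add hf'
      | hP =>
        refine isClosed_setOf_tendsto_zero _ c fun i f f' => ?_
        rw [← inner_sub_right, ← map_sub]
        refine (norm_inner_le_norm _ _).trans ?_
        refine (mul_le_of_le_one_left (norm_nonneg _) (norm_ind_le hB)).trans ?_
        exact (V i).le_of_opNorm_le (hV i) _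
    simpa [inner_smul_left] using this.const_mul (starRingEnd 𝕜 a)
  | hadd g g' hg hg' => simpa [inner_add_left] using hg.add hg'
  | hP =>
    refine isClosed_setOf_tendsto_zero _ (c * ‖f‖) fun i g g' => ?_
    rw [← inner_sub_left, mul_comm]
    exact (norm_inner_le_norm _ _).trans (by gcongr; exact (V i).le_of_opNorm_le (hV i) _)

end Operators

/-! ### Averages along arithmetic progressions -/

section Averages

open scoped InnerProductSpace

variable {𝕜 : Type*} [RCLike 𝕜] {X : Type*} [MeasurableSpace X] {μ : Measure X}
  {T : X ≃ᵐ X} (hT : MeasurePreserving T μ μ)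

lemma norm_sum_koopmanPow_neg (c : ℤ) (N : ℕ) (f : Lp 𝕜 2 μ) :
    ‖∑ x ∈ Finset.range N, koopmanPow 𝕜 T hT (-c * x) f‖ =
      ‖∑ x ∈ Finset.range N, koopmanPow 𝕜 T hT (c * x) f‖ := by
  rw [← norm_koopmanPow_apply hT (c * (N - 1)), map_sum, ← Finset.sum_range_reflect]
  congr 1
  refine Finset.sum_congr rfl fun x hx => ?_
  rw [← koopmanPow_add_apply]
  congr 2
  have : x + 1 ≤ N := Finset.mem_range.1 hx
  rw [Nat.sub_sub, Nat.cast_sub (by omega)]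
  push_cast
  ring

lemma norm_sum_koopmanPow_add (a c : ℤ) (N : ℕ) (f : Lp 𝕜 2 μ) :
    ‖∑ x ∈ Finset.range N, koopmanPow 𝕜 T hT (a + c * x) f‖ =
      ‖∑ x ∈ Finset.range N, koopmanPow 𝕜 T hT (c * x) f‖ := by
  simp only [koopmanPow_add_apply]
  rw [← map_sum, norm_koopmanPow_apply]

lemma norm_sum_koopmanPow_le (z : ℕ → ℤ) (N : ℕ) {f : Lp 𝕜 2 μ} (hf : ‖f‖ ≤ 1) :
    ‖∑ x ∈ Finset.range N, koopmanPow 𝕜 T hT (z x) f‖ ≤ N := by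
  refine (norm_sum_le _ _).trans ?_
  refine (Finset.sum_le_sum (g := fun _ => (1 : ℝ)) fun x _ => ?_).trans (by simp)
  rwa [norm_koopmanPow_apply]

lemma norm_sum_range_sub_le {V : Type*} [NormedAddCommGroup V] (g : ℕ → V) (hg : ∀ x, ‖g x‖ ≤ 1)
    (N e : ℕ) :
    ‖∑ x ∈ Finset.range N, g x - ∑ x ∈ Finset.range N, g (e + x)‖ ≤ 2 * e := by
  have h1 : ∑ x ∈ Finset.range N, g x - ∑ x ∈ Finset.range N, g (e + x) =
      ∑ x ∈ Finset.range e, g x - ∑ x ∈ Finset.range e, g (N + x) := by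
    have e1 := Finset.sum_range_add g N e
    have e2 := Finset.sum_range_add g e N
    rw [add_comm e N, e1] at e2
    rw [sub_eq_sub_iff_add_eq_add, e2]
  have h2 : ∀ a : ℕ → ℕ, ‖∑ x ∈ Finset.range e, g (a x)‖ ≤ e := fun a =>
    (norm_sum_le _ _).trans ((Finset.sum_le_sum fun x _ => hg (a x)).trans (by simp))
  rw [h1]
  exact (norm_sub_le _ _).trans (by linarith [h2 id, h2 (fun x => N + x), h2 fun x => x])

/-- An average along a progression may be split into averages along progressions whose step is
`k` times longer. -/
lemma norm_sum_koopmanPow_le_of_block (c : ℤ) (k M N : ℕ) (hM : 0 < M) {f : Lp 𝕜 2 μ}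
    (hf : ‖f‖ ≤ 1) {δ : ℝ}
    (hδ : ‖∑ d ∈ Finset.range M, koopmanPow 𝕜 T hT (c * k * d) f‖ ≤ M * δ) :
    ‖∑ x ∈ Finset.range N, koopmanPow 𝕜 T hT (c * x) f‖ ≤ N * δ + 2 * (k * M) := by
  set g : ℕ → Lp 𝕜 2 μ := fun x => koopmanPow 𝕜 T hT (c * x) f with hg
  have hM' : (0 : ℝ) < M := by exact_mod_cast hM
  have h1 : ‖∑ d ∈ Finset.range M, ∑ x ∈ Finset.range N, g (k * d + x)‖ ≤ N * (M * δ) := by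
    rw [Finset.sum_comm]
    refine (norm_sum_le _ _).trans ((Finset.sum_le_sum (g := fun _ => (M * δ : ℝ))
      fun x _ => ?_).trans_eq (by simp))
    refine le_trans (le_of_eq ?_) hδ
    rw [← norm_sum_koopmanPow_add hT (c * x)]
    congr 1
    refine Finset.sum_congr rfl fun d _ => ?_
    simp only [hg]
    congr 2
    push_cast
    ring
  have h2 : ‖∑ d ∈ Finset.range M, (∑ x ∈ Finset.range N, g x -
      ∑ x ∈ Finset.range N, g (k * d + x))‖ ≤ M * (2 * (k * M)) := by
    refine (norm_sum_le _ _).trans ((Finset.sum_le_sum (g := fun _ => (2 * (k * M) : ℝ))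
      fun d hd => ?_).trans_eq (by simp))
    refine (norm_sum_range_sub_le g (fun x => ?_) N (k * d)).trans ?_
    · rw [hg]; simpa only [norm_koopmanPow_apply] using hf
    · have : (d : ℝ) ≤ M := by exact_mod_cast (Finset.mem_range.1 hd).le
      push_cast
      gcongr
  have h3 : (M : ℝ) * ‖∑ x ∈ Finset.range N, g x‖ ≤ N * (M * δ) + M * (2 * (k * M)) := by
    have e : (M : ℝ) * ‖∑ x ∈ Finset.range N, g x‖ =
        ‖∑ d ∈ Finset.range M, ∑ x ∈ Finset.range N, g x‖ := by
      rw [Finset.sum_const, Finset.card_range, ← Nat.cast_smul_eq_nsmul 𝕜, norm_smul,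
        RCLike.norm_natCast]
    rw [e]
    rw [Finset.sum_sub_distrib] at h2
    have := norm_add_le (∑ d ∈ Finset.range M, ∑ x ∈ Finset.range N, g x -
      ∑ d ∈ Finset.range M, ∑ x ∈ Finset.range N, g (k * d + x))
      (∑ d ∈ Finset.range M, ∑ x ∈ Finset.range N, g (k * d + x))
    rw [sub_add_cancel] at this
    linarith
  refine le_of_mul_le_mul_left (h3.trans_eq ?_) hM'
  ring

variable [IsProbabilityMeasure μ]

/-- The averages over `c`-th powers of the centred indicator tend to zero if `T ^ c` is ergodic. -/
lemma exists_forall_norm_sum_le_of_ergodic (c : ℤ)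
    (herg : ∀ f : Lp 𝕜 2 μ, koopmanPow 𝕜 T hT c f = f → constProj 𝕜 μ f = f)
    {A : Set X} (hA : MeasurableSet A) {ε : ℝ} (hε : 0 < ε) :
    ∃ r₀ : ℕ, ∀ r ≥ r₀, ∀ N ≤ r,
      ‖∑ x ∈ Finset.range N, koopmanPow 𝕜 T hT (c * x) (centred 𝕜 μ hA)‖ ≤ ε * r := by
  set U := koopmanPow 𝕜 T hT c
  set f := centred 𝕜 μ hA
  have h1 := U.tendsto_birkhoffAverage_orthogonalProjection (norm_koopmanPow_le hT c) f
  have h2 : ((U.eqLocus (1 : Lp 𝕜 2 μ →L[𝕜] Lp 𝕜 2 μ)).orthogonalProjectionOnto f : Lp 𝕜 2 μ)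
      = 0 := by
    rw [ZeroMemClass.coe_eq_zero, Submodule.orthogonalProjectionOnto_eq_zero_iff,
      Submodule.mem_orthogonal]
    intro g hg
    have hg' : constProj 𝕜 μ g = g := herg g hg
    rw [← hg', inner_constProj_left, constProj_centred, inner_zero_right]
  rw [h2] at h1
  have h3 := (tendsto_zero_iff_norm_tendsto_zero.1 h1).eventually (gt_mem_nhds hε)
  obtain ⟨N₀, hN₀⟩ := eventually_atTop.1 h3
  obtain ⟨r₁, hr₁⟩ := exists_nat_gt (N₀ / ε)
  refine ⟨r₁, fun r hr N hN => ?_⟩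
  have hr' : (r₁ : ℝ) ≤ r := by exact_mod_cast hr
  have hN' : (N : ℝ) ≤ r := by exact_mod_cast hN
  rcases le_total N N₀ with h | h
  · refine (norm_sum_koopmanPow_le hT _ N (norm_centred_le hA)).trans ?_
    have : (N : ℝ) ≤ N₀ := by exact_mod_cast h
    rw [div_lt_iff₀ hε] at hr₁
    nlinarith
  · have h4 := hN₀ N h
    rcases Nat.eq_zero_or_pos N with rfl | hpos
    · simpa using by positivity
    · have hNr : (0 : ℝ) < N := by exact_mod_cast hpos
      rw [birkhoffAverage, birkhoffSum, norm_smul, norm_inv, RCLike.norm_natCast,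
        inv_mul_lt_iff₀ hNr] at h4
      have h5 : ∑ x ∈ Finset.range N, koopmanPow 𝕜 T hT (c * x) f =
          ∑ x ∈ Finset.range N, id (U^[x] f) :=
        Finset.sum_congr rfl fun x _ => koopmanPow_mul_eq_iterate hT c x f
      rw [h5]
      nlinarith

lemma inner_centred_koopmanPow_centred (n : ℤ) {A : Set X} (hA : MeasurableSet A) :
    ⟪centred 𝕜 μ hA, koopmanPow 𝕜 T hT n (centred 𝕜 μ hA)⟫_𝕜 = (dev μ T n A A : 𝕜) := by
  have h : constProj 𝕜 μ (koopmanPow 𝕜 T hT n (centred 𝕜 μ hA)) = 0 := by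
    rw [← mul_apply_eq_comp, constProj_mul_koopmanPow, constProj_centred]
  rw [← inner_ind_koopmanPow_centred hT n hA hA]
  nth_rw 1 [centred]
  rw [inner_sub_left, inner_constProj_left, h, inner_zero_right, sub_zero]

/-- Averages are small in norm if the correlations of their terms are small. -/
lemma sq_norm_sum_koopmanPow_le (e : ℤ) (M : ℕ) {A : Set X} (hA : MeasurableSet A) {η : ℝ}
    (hη0 : 0 ≤ η) (hη : ∀ d : ℕ, 1 ≤ d → d < M → |dev μ T (e * d) A A| ≤ η) :
    ‖∑ d ∈ Finset.range M, koopmanPow 𝕜 T hT (e * d) (centred 𝕜 μ hA)‖ ^ 2 ≤ M + M ^ 2 * η := by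
  set f := centred 𝕜 μ hA
  have hin : ∀ d d' : ℕ, ⟪koopmanPow 𝕜 T hT (e * d) f, koopmanPow 𝕜 T hT (e * d') f⟫_𝕜 =
      (dev μ T (e * d' - e * d) A A : 𝕜) := by
    intro d d'
    rw [inner_koopmanPow_left, ← koopmanPow_add_apply, inner_centred_koopmanPow_centred]
    congr 2
    ring
  have hbd : ∀ d < M, ∀ d' < M, |dev μ T (e * d' - e * d) A A| ≤ (if d = d' then 1 else 0) + η := by
    intro d hd d' hd'
    rcases lt_trichotomy d d' with h | h | h
    · rw [if_neg h.ne, zero_add]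
      have := hη (d' - d) (by omega) (by omega)
      rwa [Nat.cast_sub h.le, mul_sub] at this
    · rw [if_pos h]
      exact (abs_dev_le hT _ _ _).trans (measureReal_le_one.trans (by linarith))
    · rw [if_neg h.ne', zero_add]
      have := hη (d - d') (by omega) (by omega)
      rwa [Nat.cast_sub h.le, mul_sub, ← neg_sub, dev_neg hT] at this
  have h1 : ‖∑ d ∈ Finset.range M, koopmanPow 𝕜 T hT (e * d) f‖ ^ 2 =
      ∑ d ∈ Finset.range M, ∑ d' ∈ Finset.range M, dev μ T (e * d' - e * d) A A := by
    have := inner_self_eq_norm_sq_to_K (𝕜 := 𝕜) (∑ d ∈ Finset.range M, koopmanPow 𝕜 T hT (e * d) f)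
    rw [sum_inner] at this
    simp only [inner_sum, hin] at this
    exact_mod_cast this.symm
  rw [h1]
  calc _ ≤ ∑ d ∈ Finset.range M, ∑ d' ∈ Finset.range M, ((if d = d' then (1 : ℝ) else 0) + η) := by
        refine Finset.sum_le_sum fun d hd => Finset.sum_le_sum fun d' hd' => ?_
        exact (le_abs_self _).trans (hbd d (Finset.mem_range.1 hd) d' (Finset.mem_range.1 hd'))
    _ = _ := by
        simp only [Finset.sum_add_distrib, Finset.sum_ite_eq, Finset.sum_const, Finset.card_range,
          nsmul_eq_mul]
        rw [Finset.sum_ite_mem]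
        simp
        ring

end Averages

/-! ### The geometry of the double staircase -/

local notation "ℌ[" h "," r "]" => towerLevels h (doubleCuts r) (doubleStaircaseSpacers r)
local notation "pos[" h "," r "]" => colPos h (doubleCuts r) (doubleStaircaseSpacers r)

section Geometry

variable {h₁ : ℕ} {r' : ℕ → ℕ}

/-- The time in which `T` carries the `i`-th column of stage `j` exactly onto the column
`i + r'_j`, for all `i < r'_j`: half the number of levels of the next tower. -/
def halfTime (h₁ : ℕ) (r' : ℕ → ℕ) (j : ℕ) : ℕ :=
  towerLevels h₁ (doubleCuts r') (doubleStaircaseSpacers r') j * r' j + ∑ i ∈ Finset.range (r' j), i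

lemma sum_spacers_fst (j : ℕ) {x : ℕ} (hx : x ≤ r' j) :
    ∑ t ∈ Finset.range x, doubleStaircaseSpacers r' j t = ∑ t ∈ Finset.range x, t :=
  Finset.sum_congr rfl fun _ ht => Nat.mod_eq_of_lt ((Finset.mem_range.1 ht).trans_le hx)

lemma sum_spacers_snd (j : ℕ) {x : ℕ} (hx : x ≤ r' j) :
    ∑ t ∈ Finset.range (r' j + x), doubleStaircaseSpacers r' j t =
      ∑ t ∈ Finset.range (r' j), t + ∑ t ∈ Finset.range x, t := by
  rw [Finset.sum_range_add, sum_spacers_fst j le_rfl]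
  congr 1
  refine Finset.sum_congr rfl fun t ht => ?_
  rw [doubleStaircaseSpacers, Nat.add_mod_left]
  exact Nat.mod_eq_of_lt ((Finset.mem_range.1 ht).trans_le hx)

/-- The position of column `x` of the half `α` of the columns. -/
lemma colPos_half (j : ℕ) {α x : ℕ} (hα : α ≤ 1) (hx : x ≤ r' j) :
    pos[h₁,r'] j (α * r' j + x) = α * halfTime h₁ r' j + ℌ[h₁,r'] j * x + ∑ t ∈ Finset.range x, t := by
  rw [colPos, halfTime]
  interval_cases α
  · simp [sum_spacers_fst j hx]
  · rw [one_mul, sum_spacers_snd j hx]; ring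

lemma towerLevels_succ_eq (j : ℕ) : ℌ[h₁,r'] (j + 1) = 2 * halfTime h₁ r' j := by
  rw [towerLevels_succ, doubleCuts, two_mul]
  have := colPos_half (h₁ := h₁) (r' := r') j (α := 1) le_rfl (le_refl (r' j))
  rw [one_mul] at this
  rw [this, halfTime]
  ring

lemma two_mul_sum_range (x : ℕ) : 2 * ((∑ t ∈ Finset.range x, t : ℕ) : ℤ) = x * (x - 1) := by
  have := Finset.sum_range_id_mul_two x
  rcases Nat.eq_zero_or_pos x with rfl | hx
  · simp
  · zify [hx] at this; push_cast; linarith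

/-- The displacement of the staircase spacers between the columns `x` and `x + c` is affine in `x`,
with slope `c`. -/
lemma sum_range_sub_sum_range (c : ℤ) :
    ∃ κ : ℤ, ∀ x y : ℕ, (y : ℤ) = x + c →
      ((∑ t ∈ Finset.range y, t : ℕ) : ℤ) - (∑ t ∈ Finset.range x, t : ℕ) = c * x + κ := by
  obtain ⟨κ, hκ⟩ := Int.even_mul_pred_self c
  refine ⟨κ, fun x y hy => ?_⟩
  have h1 := two_mul_sum_range x
  have h2 := two_mul_sum_range y
  rw [hy] at h2
  nlinarith

lemma sum_range_le_sq {x R : ℕ} (hx : x ≤ R) : ∑ t ∈ Finset.range x, t ≤ R ^ 2 := by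
  have h := two_mul_sum_range x
  zify
  zify at hx
  push_cast at h
  nlinarith

lemma card_filter_not_mem_le {L : Finset ℕ} {b e : ℤ} {H : ℕ}
    (hL : ∀ k ∈ L, 0 ≤ k + b ∧ k + b < H) :
    ((L.filter fun k : ℕ => ¬ (0 ≤ k + (b - e) ∧ k + (b - e) < H)).card : ℤ) ≤ |e| := by
  have h1 : (L.filter fun k : ℕ => ¬ (0 ≤ k + (b - e) ∧ k + (b - e) < H)).card ≤
      (Finset.Ico 0 e ∪ Finset.Ico (H + e) H).card := by
    refine Finset.card_le_card_of_injOn (fun k : ℕ => (k : ℤ) + b) ?_ ?_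
    · intro k hk
      simp only [Finset.coe_filter, Set.mem_ofPred_eq] at hk
      have := hL k hk.1
      simp only [Finset.coe_union, Finset.coe_Ico, Set.mem_union, Set.mem_Ico]
      omega
    · intro k _ k' _ h
      simpa using h
  have h2 := Finset.card_union_le (Finset.Ico 0 e) (Finset.Ico (H + e) H)
  simp only [Int.card_Ico] at h2
  rcases abs_cases e with h | h <;> omega

variable {𝕜 : Type*} [RCLike 𝕜] {X : Type*} [MeasurableSpace X] {μ : Measure X} {T : X ≃ᵐ X}
  {E : ℕ → Set X} {C : ℕ → ℕ → Set X}

lemma filter_shift_eq_image (R : ℕ) (c : ℤ) :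
    ((Finset.range R).filter fun x : ℕ => 0 ≤ x + c ∧ x + c < R) =
      (Finset.range (R - c.natAbs)).image fun u => (-c).toNat + u := by
  ext x
  simp only [Finset.mem_filter, Finset.mem_range, Finset.mem_image]
  constructor
  · rintro ⟨h1, h2, h3⟩
    exact ⟨x - (-c).toNat, by omega, by omega⟩
  · rintro ⟨u, hu, rfl⟩
    omega

variable [IsProbabilityMeasure μ] (hT : MeasurePreserving T μ μ)
  (ht : IsRankOneTowers μ T h₁ (doubleCuts r') (doubleStaircaseSpacers r') E C)
  (hr' : ∀ j, 1 ≤ r' j) (hAd : Tendsto (fun j => (r' j : ℝ) ^ 2 / ℌ[h₁,r'] j) atTop (𝓝 0))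

include ht hr' hAd in
/-- The columns `x` of the half `α` which `T ^ n` carries, up to a shift by less than a column,
to the columns `x + c` of the half `α'`: since the shift is affine in `x` with slope `c`, their
deviation from independence is controlled by an ergodic average of step `c`. -/
lemma eventually_abs_sum_half_columns_le {A : Set X} (hA : MeasurableSet A) {ε : ℝ} (hε : 0 < ε) :
    ∀ᶠ j in atTop, ∀ α : ℕ, α ≤ 1 → ∀ α' : ℕ, α' ≤ 1 → ∀ c n : ℤ, ∀ L ⊆ Finset.range (ℌ[h₁,r'] j),
      (∀ k ∈ L, 0 ≤ (k : ℤ) + (n - (α' - α) * halfTime h₁ r' j - c * ℌ[h₁,r'] j) ∧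
        (k : ℤ) + (n - (α' - α) * halfTime h₁ r' j - c * ℌ[h₁,r'] j) < ℌ[h₁,r'] j) →
      |∑ x ∈ (Finset.range (r' j)).filter (fun x : ℕ => 0 ≤ x + c ∧ x + c < r' j),
        ∑ k ∈ L, dev μ T n A (shift T k (C j (α * r' j + x)))| ≤
      ε + ‖∑ u ∈ Finset.range (r' j - c.natAbs),
        koopmanPow 𝕜 T hT (c * u) (centred 𝕜 μ hA)‖ / doubleCuts r' j := by
  have hr : ∀ j, 0 < doubleCuts r' j := fun j => by have := hr' j; simp only [doubleCuts]; omega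
  filter_upwards [ht.eventually_abs_sum_transfer_le hT hA (fun j => (r' j : ℝ) ^ 2)
    (fun j => by positivity) hAd hr hε] with j hj α hα α' hα' c n L hL hLn
  set R := r' j with hR
  set F := (Finset.range R).filter (fun x : ℕ => 0 ≤ (x : ℤ) + c ∧ (x : ℤ) + c < R) with hF
  set I := F.image (fun x => α * R + x) with hI
  set t : ℕ → ℕ := fun i => ((i : ℤ) + (α' - α) * R + c).toNat with htdef
  obtain ⟨κ, hκ⟩ := sum_range_sub_sum_range c
  have hαR : α * R ≤ R := by nlinarith
  have hα'R : α' * R ≤ R := by nlinarith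
  have hFm : ∀ x ∈ F, x < R ∧ 0 ≤ (x : ℤ) + c ∧ (x : ℤ) + c < R := fun x hx => by
    simpa [hF] using hx
  have hIr : I ⊆ Finset.range (doubleCuts r' j) := by
    intro i hi
    obtain ⟨x, hx, rfl⟩ := Finset.mem_image.1 hi
    have := hFm x hx
    rw [Finset.mem_range, doubleCuts]
    omega
  have htx : ∀ x ∈ F, t (α * R + x) = α' * R + ((x : ℤ) + c).toNat := by
    intro x hx
    have := hFm x hx
    simp only [htdef]
    zify
    rw [Int.toNat_of_nonneg this.2.1, Int.toNat_of_nonneg]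
    · ring
    · have : (0 : ℤ) ≤ α' * R := by positivity
      nlinarith
  have hz : ∀ x ∈ F, n + pos[h₁,r'] j (α * R + x) - pos[h₁,r'] j (t (α * R + x)) =
      (n - (α' - α) * halfTime h₁ r' j - c * ℌ[h₁,r'] j) - (c * x + κ) := by
    intro x hx
    have h := hFm x hx
    have hy : ((((x : ℤ) + c).toNat : ℕ) : ℤ) = x + c := Int.toNat_of_nonneg h.2.1
    rw [htx x hx, colPos_half j hα h.1.le, colPos_half j hα' (by omega)]
    have := hκ x _ hy
    rw [← this]
    push_cast [hy]
    push_cast at this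
    ring
  have hκbd : ∀ x ∈ F, |c * (x : ℤ) + κ| ≤ (R : ℤ) ^ 2 := by
    intro x hx
    have h := hFm x hx
    have hy : ((((x : ℤ) + c).toNat : ℕ) : ℤ) = x + c := Int.toNat_of_nonneg h.2.1
    rw [← hκ x _ hy]
    have h1 : ∑ t ∈ Finset.range x, t ≤ R ^ 2 := sum_range_le_sq h.1.le
    have h2 : ∑ t ∈ Finset.range ((x : ℤ) + c).toNat, t ≤ R ^ 2 := sum_range_le_sq (by omega)
    have aux : ∀ a b q : ℕ, a ≤ q → b ≤ q → |(b : ℤ) - a| ≤ q := fun a b q ha hb => by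
      rw [abs_le]; omega
    exact_mod_cast aux _ _ _ h1 h2
  have key := hj I hIr L hL n t ?_ ?_
  · have hinj : Set.InjOn (fun x => α * R + x) F := fun a _ b _ h => by simpa using h
    rw [hI, Finset.sum_image hinj, Finset.sum_image hinj] at key
    set B := levelUnion T E j L with hB
    set b : ℤ := n - (α' - α) * halfTime h₁ r' j - c * ℌ[h₁,r'] j with hb
    have hzs : ∑ x ∈ F, dev μ T (n + pos[h₁,r'] j (α * R + x) - pos[h₁,r'] j (t (α * R + x))) A B =
        ∑ x ∈ F, dev μ T (b - (c * x + κ)) A B :=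
      Finset.sum_congr rfl fun x hx => by rw [hz x hx]
    rw [hzs] at key
    have h5 : |(∑ x ∈ F, dev μ T (b - (c * x + κ)) A B) / doubleCuts r' j| ≤
        ‖∑ u ∈ Finset.range (R - c.natAbs),
          koopmanPow 𝕜 T hT (c * u) (centred 𝕜 μ hA)‖ / doubleCuts r' j := by
      rw [abs_div, abs_of_nonneg (Nat.cast_nonneg _ : (0 : ℝ) ≤ doubleCuts r' j)]
      gcongr
      refine (abs_sum_dev_le (𝕜 := 𝕜) hT F _ hA (ht.measurableSet_levelUnion j L)).trans_eq ?_
      rw [hF, filter_shift_eq_image, Finset.sum_image fun a _ b _ h => by simpa using h,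
        ← norm_sum_koopmanPow_neg, ← norm_sum_koopmanPow_add hT (b - (c * (-c).toNat + κ))]
      congr 1
      refine Finset.sum_congr rfl fun u _ => ?_
      congr 2
      push_cast
      ring
    have h6 := abs_add_le (∑ x ∈ F, ∑ k ∈ L, dev μ T n A (shift T k (C j (α * R + x))) -
      (∑ x ∈ F, dev μ T (b - (c * x + κ)) A B) / doubleCuts r' j)
      ((∑ x ∈ F, dev μ T (b - (c * x + κ)) A B) / doubleCuts r' j)
    rw [sub_add_cancel] at h6
    linarith
  · intro i hi
    obtain ⟨x, hx, rfl⟩ := Finset.mem_image.1 hi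
    have := hFm x hx
    rw [htx x hx, doubleCuts]
    omega
  · intro i hi
    obtain ⟨x, hx, rfl⟩ := Finset.mem_image.1 hi
    rw [hz x hx]
    have h1 := card_filter_not_mem_le (e := c * x + κ) hLn
    have h2 := h1.trans (hκbd x hx)
    exact_mod_cast h2

end Geometry

/-! ### Ergodicity -/

section Ergodicity

open scoped InnerProductSpace

variable {X : Type*} [MeasurableSpace X] {μ : Measure X} [IsProbabilityMeasure μ] {T : X ≃ᵐ X}
  {E : ℕ → Set X} {C : ℕ → ℕ → Set X}

lemma shift_eq_of_preimage_eq {A : Set X} (h : T ⁻¹' A = A) (n : ℤ) : shift T n A = A := by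
  have h1 : shift T (-1) A = A := by rw [shift_neg_one, h]
  induction n with
  | zero => exact shift_zero A
  | succ n ih =>
    conv_lhs => rw [← h1, shift_shift]
    rwa [add_neg_cancel_right]
  | pred n ih => rw [sub_eq_add_neg, ← shift_shift, h1, ih]

/-- Rank-one transformations are ergodic: an invariant set has the same density in all levels of a
tower, and it is almost a union of levels. -/
lemma IsRankOneTowers.ergodic {h₁ : ℕ} {r : ℕ → ℕ} {s : ℕ → ℕ → ℕ}
    (ht : IsRankOneTowers μ T h₁ r s E C) (hT : MeasurePreserving T μ μ) : Ergodic T μ := by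
  refine ⟨hT, ⟨fun A hA hinv => ?_⟩⟩
  have hsh := fun n => shift_eq_of_preimage_eq hinv n
  have hlev : ∀ j, ∀ K ⊆ Finset.range (towerLevels h₁ r s j),
      dev μ T 0 A (levelUnion T E j K) = K.card * dev μ T 0 A (E j) := by
    intro j K hK
    rw [ht.dev_levelUnion 0 hA hK]
    simp only [dev_shift hT, dev_eq_dev_zero_of_invariant hT (hsh _)]
    simp
  have key : ∀ ε > 0, ε ≤ 1 / 2 → |dev μ T 0 A A| ≤ 6 * ε := by
    intro ε hε hε2
    obtain ⟨j, ⟨K, hK, hKA⟩, K', hK', hKA'⟩ :=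
      ((ht.eventually_measureReal_symmDiff_le hA hε).and
        (ht.eventually_measureReal_symmDiff_le MeasurableSet.univ hε)).exists
    have h1 := abs_dev_sub_right_le hT 0 hA hA (ht.measurableSet_levelUnion j K)
    have h2 := abs_dev_sub_right_le hT 0 hA MeasurableSet.univ (ht.measurableSet_levelUnion j K')
    have h3 : dev μ T 0 A Set.univ = 0 := by simp [dev, shift_zero]
    rw [hlev j K hK] at h1
    rw [hlev j K' hK', h3, zero_sub, abs_neg, abs_mul, Nat.abs_cast] at h2
    have h4 : 1 - ε ≤ K'.card * μ.real (E j) := by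
      have := abs_measureReal_inter_sub_le (μ := μ) MeasurableSet.univ
        (ht.measurableSet_levelUnion j K') MeasurableSet.univ
      rw [Set.inter_univ, Set.inter_univ, probReal_univ, ht.measureReal_levelUnion hT hK'] at this
      linarith [le_abs_self (1 - K'.card * μ.real (E j))]
    have h5 : K.card * μ.real (E j) ≤ 1 :=
      (ht.measureReal_levelUnion hT hK).symm.trans_le measureReal_le_one
    have hw : 0 < μ.real (E j) := by
      refine lt_of_le_of_ne measureReal_nonneg fun h => ?_
      rw [← h, mul_zero] at h4
      linarith
    have h6 : (K.card : ℝ) ≤ 2 * K'.card := by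
      refine le_of_mul_le_mul_right ?_ hw
      linarith
    have h7 : K.card * |dev μ T 0 A (E j)| ≤ 2 * (K'.card * |dev μ T 0 A (E j)|) := by
      nlinarith [abs_nonneg (dev μ T 0 A (E j))]
    have h8 := abs_sub_abs_le_abs_sub (dev μ T 0 A A) (K.card * dev μ T 0 A (E j))
    rw [abs_mul, Nat.abs_cast] at h8
    linarith
  have h0 : dev μ T 0 A A = 0 := by
    refine abs_eq_zero.1 (le_antisymm (le_of_forall_pos_le_add fun δ hδ => ?_) (abs_nonneg _))
    have := key (min (1 / 2) (δ / 6)) (by positivity) (min_le_left _ _)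
    linarith [min_le_right (1 / 2) (δ / 6)]
  have h9 : μ.real A * (1 - μ.real A) = 0 := by
    rw [← h0, dev, shift_zero, Set.inter_self]; ring
  rw [Filter.eventuallyConst_set']
  rcases mul_eq_zero.1 h9 with h | h
  · left
    rw [measureReal_eq_zero_iff] at h
    exact ae_eq_empty.2 h
  · right
    have h' : μ.real A = 1 := by linarith
    rw [ae_eq_univ, ← measureReal_eq_zero_iff, probReal_compl_eq_one_sub hA, h', sub_self]

variable {𝕜 : Type*} [RCLike 𝕜]

/-- A fixed vector of the operator of an ergodic transformation is constant. -/
lemma constProj_eq_of_koopmanPow_one_eq (hT : MeasurePreserving T μ μ) (herg : Ergodic T μ)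
    (f : Lp 𝕜 2 μ) (hf : koopmanPow 𝕜 T hT 1 f = f) : constProj 𝕜 μ f = f := by
  have h1 : Lp.compMeasurePreserving T hT f = f := by
    rw [koopmanPow, zpow_one] at hf
    exact hf
  have h2 : f ∘ T =ᵐ[μ] f := by
    have := Lp.coeFn_compMeasurePreserving f hT
    rw [h1] at this
    exact this.symm
  obtain ⟨c, hc⟩ := herg.ae_eq_const_of_ae_eq_comp_ae (Lp.aestronglyMeasurable f) h2
  have h3 : f = c • oneL2 𝕜 μ := by
    rw [← const_eq_smul_oneL2]
    exact Lp.ext (hc.trans (Lp.coeFn_const 2 μ c).symm)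
  rw [h3, constProj_apply, inner_smul_right, inner_oneL2_oneL2, mul_one]

/-- Weak convergence of powers to the projection onto the constants, in terms of sets. -/
lemma tendsto_inner_koopmanPow_sub (hT : MeasurePreserving T μ μ) {ι : Type*} {l : Filter ι}
    (n : ι → ℤ) (h : ∀ A B, MeasurableSet A → MeasurableSet B →
      Tendsto (fun i => dev μ T (n i) A B) l (𝓝 0)) (f g : Lp 𝕜 2 μ) :
    Tendsto (fun i => ⟪g, (koopmanPow 𝕜 T hT (n i) - constProj 𝕜 μ) f⟫_𝕜) l (𝓝 0) := by
  refine tendsto_inner_of_ind _ 2 (fun i => ?_) (fun {A B} hA hB => ?_) f g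
  · have h1 := norm_koopmanPow_le (𝕜 := 𝕜) hT (n i)
    have h2 := norm_constProj_le (𝕜 := 𝕜) (μ := μ)
    exact (norm_sub_le _ _).trans (by linarith)
  · have := (RCLike.continuous_ofReal (K := 𝕜)).tendsto 0 |>.comp (h A B hA hB)
    rw [RCLike.ofReal_zero] at this
    refine this.congr fun i => ?_
    rw [sub_apply, inner_sub_right, inner_ind_koopmanPow_ind,
      inner_ind_constProj_ind, Function.comp_apply, dev]
    push_cast
    rfl

variable {h₁ : ℕ} {r' : ℕ → ℕ}

lemma two_mul_towerLevels_le (hr' : ∀ j, 1 ≤ r' j) (j : ℕ) : 2 * ℌ[h₁,r'] j ≤ ℌ[h₁,r'] (j + 1) := by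
  have := Nat.mul_le_mul_left (ℌ[h₁,r'] j) (hr' j)
  rw [towerLevels_succ_eq, halfTime]
  omega

lemma strictMono_towerLevels (hr' : ∀ j, 1 ≤ r' j) : StrictMono ℌ[h₁,r'] := by
  refine strictMono_nat_of_lt_succ fun j => ?_
  have h1 := two_mul_towerLevels_le (h₁ := h₁) hr' j
  have h2 := towerLevels_pos (h₁ := h₁) (s := doubleStaircaseSpacers r') (r := doubleCuts r')
    (fun j => by have := hr' j; simp only [doubleCuts]; omega) j
  omega

lemma tendsto_towerLevels (hr' : ∀ j, 1 ≤ r' j) : Tendsto ℌ[h₁,r'] atTop atTop :=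
  (strictMono_towerLevels hr').tendsto_atTop

variable (hT : MeasurePreserving T μ μ)
  (ht : IsRankOneTowers μ T h₁ (doubleCuts r') (doubleStaircaseSpacers r') E C)
  (hr' : ∀ j, 1 ≤ r' j) (hlim : Tendsto r' atTop atTop)
  (hAd : Tendsto (fun j => (r' j : ℝ) ^ 2 / ℌ[h₁,r'] j) atTop (𝓝 0))

/-- The part of the columns with `x + c` outside of the half is negligible if `c` is. -/
lemma abs_sum_range_le_of_half {R : ℕ} {G : ℕ → ℝ} {δ : ℝ} (hδ : 0 ≤ δ)
    (hG : ∀ x < R, |G x| ≤ δ) (c : ℤ) :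
    |∑ x ∈ Finset.range R, G x| ≤
      |∑ x ∈ (Finset.range R).filter (fun x : ℕ => 0 ≤ x + c ∧ x + c < R), G x| +
        c.natAbs * δ := by
  rw [← Finset.sum_filter_add_sum_filter_not (Finset.range R)
    (fun x : ℕ => 0 ≤ (x : ℤ) + c ∧ (x : ℤ) + c < R)]
  refine (abs_add_le _ _).trans (add_le_add le_rfl ?_)
  refine (Finset.abs_sum_le_sum_abs _ _).trans ((Finset.sum_le_sum (g := fun _ => δ)
    fun x hx => hG x (Finset.mem_range.1 (Finset.mem_filter.1 hx).1)).trans ?_)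
  rw [Finset.sum_const, nsmul_eq_mul]
  gcongr
  have h := card_filter_not_mem_le (L := Finset.range R) (b := 0) (e := -c) (H := R)
    (fun k hk => by have := Finset.mem_range.1 hk; omega)
  simp only [zero_sub, neg_neg, abs_neg] at h
  rw [Int.abs_eq_natAbs] at h
  exact_mod_cast h

include ht in
lemma dev_levelUnion_eq_halves {A : Set X} (hA : MeasurableSet A) (n : ℤ) {j : ℕ} {L : Finset ℕ}
    (hL : L ⊆ Finset.range (ℌ[h₁,r'] j)) :
    dev μ T n A (levelUnion T E j L) =
      ∑ x ∈ Finset.range (r' j), ∑ k ∈ L, dev μ T n A (shift T k (C j (0 * r' j + x))) +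
      ∑ x ∈ Finset.range (r' j), ∑ k ∈ L, dev μ T n A (shift T k (C j (1 * r' j + x))) := by
  rw [ht.dev_levelUnion_eq_sum n hA hL, doubleCuts, two_mul, Finset.sum_range_add]
  simp

include ht hT in
lemma abs_sum_dev_half_column_le (n : ℤ) {j α x : ℕ} (hα : α ≤ 1) (hx : x < r' j)
    (A : Set X) {L : Finset ℕ} (hL : L ⊆ Finset.range (ℌ[h₁,r'] j)) :
    |∑ k ∈ L, dev μ T n A (shift T k (C j (α * r' j + x)))| ≤ 1 / doubleCuts r' j := by
  refine ht.abs_sum_dev_column_le hT n ?_ A hL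
  rw [doubleCuts]
  interval_cases α <;> omega

include hlim in
lemma tendsto_doubleCuts : Tendsto (doubleCuts r') atTop atTop :=
  tendsto_atTop_mono (fun j => by simp only [doubleCuts]; omega) hlim

variable (𝕜) in
include ht hr' hlim hAd in
/-- The levels which `T ^ n` moves by exactly `c` columns become independent of a given set, if
`T ^ c` is ergodic: the lengths of the displacements form progressions of step `c`. -/
lemma eventually_abs_dev_levelUnion_le (c : ℤ)
    (herg : ∀ f : Lp 𝕜 2 μ, koopmanPow 𝕜 T hT c f = f → constProj 𝕜 μ f = f)
    {A : Set X} (hA : MeasurableSet A) {ε : ℝ} (hε : 0 < ε) :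
    ∀ᶠ j in atTop, ∀ n : ℤ, ∀ L ⊆ Finset.range (ℌ[h₁,r'] j),
      (∀ k ∈ L, 0 ≤ (k : ℤ) + (n - c * ℌ[h₁,r'] j) ∧
        (k : ℤ) + (n - c * ℌ[h₁,r'] j) < ℌ[h₁,r'] j) →
      |dev μ T n A (levelUnion T E j L)| ≤ ε := by
  obtain ⟨r₀, hr₀⟩ := exists_forall_norm_sum_le_of_ergodic (𝕜 := 𝕜) hT c herg hA
    (show 0 < ε / 6 by positivity)
  have hc : Tendsto (fun j => (c.natAbs : ℝ) / doubleCuts r' j) atTop (𝓝 0) :=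
    tendsto_const_nhds.div_atTop (tendsto_natCast_atTop_atTop.comp (tendsto_doubleCuts hlim))
  filter_upwards [eventually_abs_sum_half_columns_le (𝕜 := 𝕜) hT ht hr' hAd hA
    (show 0 < ε / 6 by positivity), (tendsto_doubleCuts hlim).eventually_ge_atTop r₀,
    hc.eventually (gt_mem_nhds (show (0 : ℝ) < ε / 6 by positivity))] with j hj hrj hcj n L hL hLn
  have hr0 : (0 : ℝ) < doubleCuts r' j := by
    have := hr' j
    simp only [doubleCuts]; push_cast; positivity
  have hhalf : ∀ α : ℕ, α ≤ 1 → |∑ x ∈ Finset.range (r' j), ∑ k ∈ L,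
      dev μ T n A (shift T k (C j (α * r' j + x)))| ≤ ε / 2 := by
    intro α hα
    refine (abs_sum_range_le_of_half (by positivity) (fun x hx =>
      abs_sum_dev_half_column_le hT ht n hα hx A hL) c).trans ?_
    have h1 := hj α hα α hα c n L hL (by simpa using hLn)
    have h2 := hr₀ _ hrj (r' j - c.natAbs) (by simp only [doubleCuts]; omega)
    rw [← div_le_iff₀ hr0] at h2
    rw [mul_one_div]
    linarith
  rw [dev_levelUnion_eq_halves ht hA n hL]
  refine (abs_add_le _ _).trans ?_
  linarith [hhalf 0 (by simp), hhalf 1 le_rfl]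

include hT ht in
/-- It suffices to estimate deviations on unions of levels. -/
lemma eventually_abs_dev_le_of_levelUnion {A B : Set X} (hA : MeasurableSet A)
    (hB : MeasurableSet B) {P : ℕ → ℤ → Prop}
    (h : ∀ ε > 0, ∀ᶠ j in atTop, ∀ n, P j n → ∀ K ⊆ Finset.range (ℌ[h₁,r'] j),
      |dev μ T n A (levelUnion T E j K)| ≤ ε) {ε : ℝ} (hε : 0 < ε) :
    ∀ᶠ j in atTop, ∀ n, P j n → |dev μ T n A B| ≤ ε := by
  filter_upwards [h (ε / 2) (by positivity),
    ht.eventually_measureReal_symmDiff_le hB (show 0 < ε / 4 by positivity)]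
    with j hj ⟨K, hK, hKB⟩ n hn
  have h1 := abs_dev_sub_right_le hT n hA hB (ht.measurableSet_levelUnion j K)
  have h2 := abs_sub_abs_le_abs_sub (dev μ T n A B) (dev μ T n A (levelUnion T E j K))
  linarith [hj n hn K hK]

include ht hr' hlim hAd in
/-- All non-zero powers of a double staircase are ergodic: along the multiples `H_j + b` of `c`,
with `b` bounded, the powers of `T` tend to the projection onto the constants. -/
lemma constProj_eq_of_koopmanPow_eq {c : ℤ} (hc : c ≠ 0) (f : Lp 𝕜 2 μ)
    (hf : koopmanPow 𝕜 T hT c f = f) : constProj 𝕜 μ f = f := by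
  set b : ℕ → ℤ := fun j => (-(ℌ[h₁,r'] j : ℤ)) % c with hb
  have hb0 : ∀ j, 0 ≤ b j := fun j => Int.emod_nonneg _ hc
  have hbc : ∀ j, b j < |c| := fun j => Int.emod_lt_abs _ hc
  have hdvd : ∀ j, c ∣ ℌ[h₁,r'] j + b j := fun j => by
    have := Int.dvd_sub_self_of_emod_eq (show (-(ℌ[h₁,r'] j : ℤ)) % c = b j from rfl)
    rwa [sub_neg_eq_add, add_comm] at this
  have hmul : ∀ q : ℤ, koopmanPow 𝕜 T hT (c * q) f = f := by
    have hneg : koopmanPow 𝕜 T hT (-c) f = f := by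
      conv_lhs => rw [← hf]
      rw [← koopmanPow_add_apply, neg_add_cancel, koopmanPow_zero]; rfl
    intro q
    obtain ⟨m, rfl | rfl⟩ := q.eq_nat_or_neg
    · rw [koopmanPow_mul_eq_iterate]; exact Function.iterate_fixed hf m
    · rw [mul_neg, ← neg_mul, koopmanPow_mul_eq_iterate]; exact Function.iterate_fixed hneg m
  have hdev : ∀ A B, MeasurableSet A → MeasurableSet B →
      Tendsto (fun j => dev μ T (ℌ[h₁,r'] j + b j) A B) atTop (𝓝 0) := by
    intro A B hA hB
    rw [tendsto_zero_iff_abs_tendsto_zero, Metric.tendsto_nhds]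
    intro ε hε
    have := eventually_abs_dev_le_of_levelUnion hT ht hA hB
      (P := fun j n => n = ℌ[h₁,r'] j + b j) (fun ε hε => ?_) (show 0 < ε / 2 by positivity)
    · filter_upwards [this] with j hj
      have := hj _ rfl
      simp only [Function.comp_apply, Real.dist_eq, sub_zero, abs_abs]
      linarith
    · have hcH : Tendsto (fun j => (c.natAbs : ℝ) / ℌ[h₁,r'] j) atTop (𝓝 0) :=
        tendsto_const_nhds.div_atTop
          (tendsto_natCast_atTop_atTop.comp (tendsto_towerLevels hr'))
      filter_upwards [eventually_abs_dev_levelUnion_le 𝕜 hT ht hr' hlim hAd 1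
        (constProj_eq_of_koopmanPow_one_eq hT (ht.ergodic hT)) hA (show 0 < ε / 2 by positivity),
        hcH.eventually (gt_mem_nhds (show (0 : ℝ) < ε / 2 by positivity))] with j hj hcj n hn K hK
      have hH0 : (0 : ℝ) < ℌ[h₁,r'] j := by
        exact_mod_cast towerLevels_pos (fun j => by have := hr' j; simp only [doubleCuts]; omega) j
      set L := K.filter fun k : ℕ => 0 ≤ (k : ℤ) + b j ∧ (k : ℤ) + b j < ℌ[h₁,r'] j with hLdef
      set L' := K.filter fun k : ℕ => ¬ (0 ≤ (k : ℤ) + b j ∧ (k : ℤ) + b j < ℌ[h₁,r'] j) with hLdef'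
      have hL'c : (L'.card : ℝ) ≤ c.natAbs := by
        have h := card_filter_not_mem_le (L := K) (b := 0) (e := - b j) (H := ℌ[h₁,r'] j)
          (fun k hk => by have := Finset.mem_range.1 (hK hk); omega)
        simp only [zero_sub, neg_neg, abs_neg, abs_of_nonneg (hb0 j)] at h
        have h2 := h.trans (hbc j).le
        rw [Int.abs_eq_natAbs] at h2
        exact_mod_cast h2
      have h1 := hj n L ((Finset.filter_subset _ _).trans hK) (fun k hk => by
        have := (Finset.mem_filter.1 hk).2
        rw [hn]
        omega)
      have hL'K : L' ⊆ Finset.range (ℌ[h₁,r'] j) := (Finset.filter_subset _ _).trans hK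
      have h2 : |dev μ T n A (levelUnion T E j L')| ≤ ε / 2 := by
        refine (ht.abs_dev_levelUnion_le hT n A hL'K).trans (le_trans ?_ hcj.le)
        rw [le_div_iff₀ hH0]
        have := ht.towerLevels_mul_le hT j
        have hw : 0 ≤ μ.real (E j) := measureReal_nonneg
        calc L'.card * μ.real (E j) * ℌ[h₁,r'] j
            = L'.card * (ℌ[h₁,r'] j * μ.real (E j)) := by ring
          _ ≤ c.natAbs * 1 := by gcongr
          _ = _ := mul_one _
      have h3 : dev μ T n A (levelUnion T E j K) = dev μ T n A (levelUnion T E j L) +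
          dev μ T n A (levelUnion T E j L') := by
        rw [ht.dev_levelUnion n hA hK, ht.dev_levelUnion n hA ((Finset.filter_subset _ _).trans hK),
          ht.dev_levelUnion n hA hL'K, Finset.sum_filter_add_sum_filter_not]
      rw [h3]
      exact (abs_add_le _ _).trans (by linarith)
  have h0 : constProj 𝕜 μ f - f = 0 := by
    refine ext_inner_left 𝕜 fun g => ?_
    have h1 := tendsto_inner_koopmanPow_sub (𝕜 := 𝕜) hT _ hdev f g
    have h2 : ∀ j, (koopmanPow 𝕜 T hT (ℌ[h₁,r'] j + b j) - constProj 𝕜 μ) f =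
        f - constProj 𝕜 μ f := fun j => by
      obtain ⟨q, hq⟩ := hdvd j
      rw [hq, sub_apply, hmul]
    simp only [h2] at h1
    have h3 := tendsto_nhds_unique h1 tendsto_const_nhds
    rw [inner_zero_right, ← neg_sub, inner_neg_right, ← h3, neg_zero]
  exact sub_eq_zero.1 h0

end Ergodicity

/-! ### Uniform convergence of ergodic averages -/

section UniformAverages

open scoped InnerProductSpace

variable {X : Type*} [MeasurableSpace X] {μ : Measure X} [IsProbabilityMeasure μ] {T : X ≃ᵐ X}
  {E : ℕ → Set X} {C : ℕ → ℕ → Set X} {h₁ : ℕ} {r' : ℕ → ℕ} {𝕜 : Type*} [RCLike 𝕜]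
  (hT : MeasurePreserving T μ μ)
  (ht : IsRankOneTowers μ T h₁ (doubleCuts r') (doubleStaircaseSpacers r') E C)
  (hr' : ∀ j, 1 ≤ r' j) (hlim : Tendsto r' atTop atTop)
  (hAd : Tendsto (fun j => (r' j : ℝ) ^ 2 / ℌ[h₁,r'] j) atTop (𝓝 0))

include hr' in
lemma doubleStaircase_towerLevels_pos (j : ℕ) : 0 < ℌ[h₁,r'] j :=
  towerLevels_pos (fun j => by have := hr' j; simp only [doubleCuts]; omega) j

/-- Levels sorted by the number of columns by which `T ^ n` moves them. -/
lemma IsRankOneTowers.dev_levelUnion_eq_sum_fiber {r : ℕ → ℕ} {s : ℕ → ℕ → ℕ}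
    (ht : IsRankOneTowers μ T h₁ r s E C) (n : ℤ) {j : ℕ} {A : Set X} (hA : MeasurableSet A)
    {K : Finset ℕ} (hK : K ⊆ Finset.range (towerLevels h₁ r s j)) {ι : Type*} [DecidableEq ι]
    (q : ℕ → ι) (Q : Finset ι) (hq : ∀ k ∈ K, q k ∈ Q) :
    dev μ T n A (levelUnion T E j K) =
      ∑ c ∈ Q, dev μ T n A (levelUnion T E j (K.filter fun k => q k = c)) := by
  rw [ht.dev_levelUnion n hA hK, ← Finset.sum_fiberwise_of_maps_to hq]
  exact Finset.sum_congr rfl fun c _ =>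
    (ht.dev_levelUnion n hA ((Finset.filter_subset _ _).trans hK)).symm

include hT ht hr' hlim hAd in
/-- Mixing along exponents that are comparable with the height of a tower. -/
lemma eventually_abs_dev_le_of_le_mul (M : ℕ) {A B : Set X} (hA : MeasurableSet A)
    (hB : MeasurableSet B) {ε : ℝ} (hε : 0 < ε) :
    ∀ᶠ j in atTop, ∀ n : ℤ, (ℌ[h₁,r'] j : ℤ) ≤ n ∧ n ≤ M * ℌ[h₁,r'] j → |dev μ T n A B| ≤ ε := by
  refine eventually_abs_dev_le_of_levelUnion hT ht hA hB (fun δ hδ => ?_) hε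
  have h1 : ∀ᶠ j in atTop, ∀ c ∈ Finset.Icc (1 : ℤ) M, ∀ n : ℤ, ∀ L ⊆ Finset.range (ℌ[h₁,r'] j),
      (∀ k ∈ L, 0 ≤ (k : ℤ) + (n - c * ℌ[h₁,r'] j) ∧
        (k : ℤ) + (n - c * ℌ[h₁,r'] j) < ℌ[h₁,r'] j) →
      |dev μ T n A (levelUnion T E j L)| ≤ δ / (M + 1) := by
    refine (Filter.eventually_all_finset _).2 fun c hc => ?_
    refine eventually_abs_dev_levelUnion_le ℝ hT ht hr' hlim hAd c (fun f hf => ?_) hA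
      (by positivity)
    have := (Finset.mem_Icc.1 hc).1
    exact constProj_eq_of_koopmanPow_eq hT ht hr' hlim hAd (by omega) f hf
  filter_upwards [h1] with j hj n hn K hK
  have hH : (0 : ℤ) < ℌ[h₁,r'] j := by exact_mod_cast doubleStaircase_towerLevels_pos hr' j
  have hbd : ∀ k ∈ K, ((k : ℤ) + n) / ℌ[h₁,r'] j ∈ Finset.Icc (1 : ℤ) M := by
    intro k hk
    have hk' := Finset.mem_range.1 (hK hk)
    rw [Finset.mem_Icc]
    constructor
    · rw [Int.le_ediv_iff_mul_le hH]; omega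
    · rw [← Int.lt_add_one_iff, Int.ediv_lt_iff_lt_mul hH]
      have : ((M : ℤ) + 1) * ℌ[h₁,r'] j = M * ℌ[h₁,r'] j + ℌ[h₁,r'] j := by ring
      omega
  rw [ht.dev_levelUnion_eq_sum_fiber n hA hK _ _ hbd]
  calc _ ≤ ∑ c ∈ Finset.Icc (1 : ℤ) M, |dev μ T n A (levelUnion T E j (K.filter
        fun k : ℕ => ((k : ℤ) + n) / ℌ[h₁,r'] j = c))| := Finset.abs_sum_le_sum_abs _ _
    _ ≤ ∑ c ∈ Finset.Icc (1 : ℤ) M, δ / (M + 1) := by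
        refine Finset.sum_le_sum fun c hc => ?_
        refine hj c hc n _ ((Finset.filter_subset _ _).trans hK) fun k hk => ?_
        have h2 := (Finset.mem_filter.1 hk).2
        have h3 := Int.emod_nonneg ((k : ℤ) + n) hH.ne'
        have h4 := Int.emod_lt_of_pos ((k : ℤ) + n) hH
        have h5 := Int.emod_def ((k : ℤ) + n) (ℌ[h₁,r'] j)
        rw [h2, mul_comm] at h5
        omega
    _ = M * (δ / (M + 1)) := by simp
    _ ≤ δ := by
        rw [mul_div_assoc', div_le_iff₀ (by positivity)]
        nlinarith

include hr' in
lemma exists_towerLevels_le_lt {q s : ℕ} (hs : ℌ[h₁,r'] q ≤ s) :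
    ∃ p ≥ q, ℌ[h₁,r'] p ≤ s ∧ s < ℌ[h₁,r'] (p + 1) := by
  have hex : ∃ p, s < ℌ[h₁,r'] p := ((tendsto_towerLevels hr').eventually_gt_atTop s).exists
  classical
  have h1 := Nat.find_spec hex
  have h2 : q < Nat.find hex := by
    by_contra h
    have := (strictMono_towerLevels (h₁ := h₁) hr').monotone (not_lt.1 h)
    omega
  obtain ⟨p, hp⟩ := Nat.exists_eq_succ_of_ne_zero (by omega : Nat.find hex ≠ 0)
  refine ⟨p, by omega, not_lt.1 (Nat.find_min hex (by omega)), ?_⟩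
  rwa [hp] at h1

variable (𝕜) in
include ht hr' hlim hAd in
/-- The averages with `N ≤ r` terms along progressions of step at most `r` are small, uniformly in
the step. A multiple of the step is comparable with the height of a tower, so that the powers of
`T` along the sparser progression are almost uncorrelated; by Adams' condition the multiplier is
small in comparison with the step itself, hence with `r`. -/
lemma exists_forall_norm_sum_le {A : Set X} (hA : MeasurableSet A) {ε : ℝ} (hε : 0 < ε) :
    ∃ r₀ : ℕ, ∀ r ≥ r₀, ∀ N ≤ r, ∀ c : ℤ, c ≠ 0 → c.natAbs ≤ r →
      ‖∑ x ∈ Finset.range N, koopmanPow 𝕜 T hT (c * x) (centred 𝕜 μ hA)‖ ≤ ε * r := by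
  obtain ⟨M, hM⟩ := exists_nat_gt (8 / ε ^ 2)
  have hM0 : (0 : ℝ) < M := lt_trans (by positivity) hM
  have hMpos : 0 < M := by exact_mod_cast hM0
  have hM1 : 8 ≤ M * ε ^ 2 := by
    rw [div_lt_iff₀ (by positivity)] at hM
    exact hM.le
  have hev := (eventually_abs_dev_le_of_le_mul hT ht hr' hlim hAd (2 * M) hA hA
    (show 0 < ε ^ 2 / 8 by positivity)).and
      (hAd.eventually (gt_mem_nhds (show (0 : ℝ) < ε / (20 * M) by positivity)))
  obtain ⟨P, hP⟩ := eventually_atTop.1 hev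
  -- The finitely many steps below the height of the tower `P` are treated one by one.
  have hsmall : ∀ s : ℕ, ∃ r₀ : ℕ, 1 ≤ s → ∀ r ≥ r₀, ∀ N ≤ r,
      ‖∑ x ∈ Finset.range N, koopmanPow 𝕜 T hT (s * x) (centred 𝕜 μ hA)‖ ≤ ε * r := by
    intro s
    rcases Nat.eq_zero_or_pos s with rfl | hs
    · exact ⟨0, by simp⟩
    · obtain ⟨r₀, hr₀⟩ := exists_forall_norm_sum_le_of_ergodic hT s (fun f hf =>
        constProj_eq_of_koopmanPow_eq (𝕜 := 𝕜) hT ht hr' hlim hAd (by omega) f hf) hA hε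
      exact ⟨r₀, fun _ => hr₀⟩
  choose ρ hρ using hsmall
  suffices hnat : ∀ r ≥ (Finset.range (ℌ[h₁,r'] P)).sup ρ, ∀ N ≤ r, ∀ s : ℕ, 1 ≤ s → s ≤ r →
      ‖∑ x ∈ Finset.range N, koopmanPow 𝕜 T hT (s * x) (centred 𝕜 μ hA)‖ ≤ ε * r by
    refine ⟨(Finset.range (ℌ[h₁,r'] P)).sup ρ, fun r hr N hN c hc hcr => ?_⟩
    obtain ⟨s, rfl | rfl⟩ := c.eq_nat_or_neg
    · exact hnat r hr N hN s (by omega) (by omega)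
    · rw [norm_sum_koopmanPow_neg]
      exact hnat r hr N hN s (by omega) (by omega)
  intro r hr N hN s hs hsr
  rcases lt_or_ge s (ℌ[h₁,r'] P) with hsP | hsP
  · exact hρ s hs r ((Finset.le_sup (Finset.mem_range.2 hsP)).trans hr) N hN
  obtain ⟨p, hpP, hp1, hp2⟩ := exists_towerLevels_le_lt hr' hsP
  set H := ℌ[h₁,r'] p with hH
  set H' := ℌ[h₁,r'] (p + 1) with hH'
  have hHpos : 0 < H := doubleStaircase_towerLevels_pos hr' p
  set k := H' / s + 1 with hk
  have hks1 : H' ≤ s * k := by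
    have := Nat.div_add_mod H' s
    have := Nat.mod_lt H' (show 0 < s by omega)
    rw [hk, mul_add, mul_one]; omega
  have hks2 : s * k ≤ 2 * H' := by
    have := Nat.mul_div_le H' s
    rw [hk, mul_add, mul_one]; omega
  have hk5 : k ≤ 5 * r' p ^ 2 := by
    have e1 : H' ≤ H * (4 * r' p ^ 2) := by
      rw [hH', towerLevels_succ_eq, halfTime]
      have e2 := sum_range_le_sq (le_refl (r' p))
      have e3 : r' p ≤ r' p ^ 2 := Nat.le_self_pow two_ne_zero _
      have e4 := Nat.mul_le_mul_left H e3
      have e5 : r' p ^ 2 ≤ H * r' p ^ 2 := Nat.le_mul_of_pos_left _ hHpos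
      rw [← hH]
      nlinarith
    have e6 : H' / s ≤ 4 * r' p ^ 2 :=
      (Nat.div_le_div_left hp1 hHpos).trans (Nat.div_le_of_le_mul e1)
    have e7 : 1 ≤ r' p ^ 2 := Nat.one_le_pow _ _ (hr' p)
    omega
  have hkr : 2 * ((k : ℝ) * M) ≤ ε / 2 * r := by
    have e1 := (hP p hpP).2
    rw [div_lt_div_iff₀ (by exact_mod_cast hHpos) (by positivity)] at e1
    have e2 : (k : ℝ) ≤ 5 * r' p ^ 2 := by exact_mod_cast hk5
    have e3 : (H : ℝ) ≤ r := by exact_mod_cast hp1.trans hsr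
    nlinarith
  have hδ : ‖∑ d ∈ Finset.range M, koopmanPow 𝕜 T hT (s * k * d) (centred 𝕜 μ hA)‖ ≤
      M * (ε / 2) := by
    have e1 := sq_norm_sum_koopmanPow_le (𝕜 := 𝕜) hT (s * k : ℤ) M hA
      (show 0 ≤ ε ^ 2 / 8 by positivity) (fun d hd1 hdM => by
        refine (hP (p + 1) (by omega)).1 _ ⟨?_, ?_⟩
        · have : H' ≤ s * k * d := hks1.trans (Nat.le_mul_of_pos_right _ hd1)
          exact_mod_cast this
        · have : s * k * d ≤ 2 * M * H' := by
            calc s * k * d ≤ 2 * H' * M := Nat.mul_le_mul hks2 hdM.le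
              _ = _ := by ring
          exact_mod_cast this)
    refine le_of_sq_le_sq ?_ (by positivity)
    refine e1.trans ?_
    nlinarith
  refine (norm_sum_koopmanPow_le_of_block hT s k M N hMpos (norm_centred_le hA) hδ).trans ?_
  have hNr : (N : ℝ) ≤ r := by exact_mod_cast hN
  nlinarith

end UniformAverages

/-! ### Exponents between the heights of consecutive towers -/

section Mixing

variable {X : Type*} [MeasurableSpace X] {μ : Measure X} [IsProbabilityMeasure μ] {T : X ≃ᵐ X}
  {E : ℕ → Set X} {C : ℕ → ℕ → Set X} {h₁ : ℕ} {r' : ℕ → ℕ}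
  (hT : MeasurePreserving T μ μ)
  (ht : IsRankOneTowers μ T h₁ (doubleCuts r') (doubleStaircaseSpacers r') E C)
  (hr' : ∀ j, 1 ≤ r' j) (hlim : Tendsto r' atTop atTop)
  (hAd : Tendsto (fun j => (r' j : ℝ) ^ 2 / ℌ[h₁,r'] j) atTop (𝓝 0))

include hT ht hr' hlim hAd in
/-- The columns `x` of one half which `T ^ n` carries to the columns `x + c`, `c ≠ 0`, of the same or
of the other half become independent of a given set, uniformly in `c`. -/
lemma eventually_abs_sum_half_columns_le_of_ne_zero {A : Set X} (hA : MeasurableSet A) {ε : ℝ}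
    (hε : 0 < ε) :
    ∀ᶠ j in atTop, ∀ α : ℕ, α ≤ 1 → ∀ α' : ℕ, α' ≤ 1 → ∀ c n : ℤ, c ≠ 0 →
      ∀ L ⊆ Finset.range (ℌ[h₁,r'] j),
      (∀ k ∈ L, 0 ≤ (k : ℤ) + (n - (α' - α) * halfTime h₁ r' j - c * ℌ[h₁,r'] j) ∧
        (k : ℤ) + (n - (α' - α) * halfTime h₁ r' j - c * ℌ[h₁,r'] j) < ℌ[h₁,r'] j) →
      |∑ x ∈ (Finset.range (r' j)).filter (fun x : ℕ => 0 ≤ x + c ∧ x + c < r' j),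
        ∑ k ∈ L, dev μ T n A (shift T k (C j (α * r' j + x)))| ≤ ε := by
  obtain ⟨r₀, hr₀⟩ := exists_forall_norm_sum_le ℝ hT ht hr' hlim hAd hA
    (show 0 < ε / 2 by positivity)
  filter_upwards [eventually_abs_sum_half_columns_le (𝕜 := ℝ) hT ht hr' hAd hA
    (show 0 < ε / 2 by positivity), (tendsto_doubleCuts hlim).eventually_ge_atTop r₀]
    with j hj hrj α hα α' hα' c n hc L hL hLn
  have hr0 : (0 : ℝ) < doubleCuts r' j := by
    have := hr' j
    simp only [doubleCuts]; push_cast; positivity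
  refine (hj α hα α' hα' c n L hL hLn).trans ?_
  rcases le_or_gt c.natAbs (doubleCuts r' j) with h | h
  · have := hr₀ _ hrj (r' j - c.natAbs) (by simp only [doubleCuts]; omega) c hc h
    rw [← div_le_iff₀ hr0] at this
    linarith
  · have : r' j - c.natAbs = 0 := by simp only [doubleCuts] at h; omega
    rw [this]
    simp only [Finset.range_zero, Finset.sum_empty, norm_zero, zero_div]
    linarith

lemma colPos_add_le {r : ℕ → ℕ} {s : ℕ → ℕ → ℕ} {j i : ℕ} (hi : i < r j) :
    colPos h₁ r s j i + towerLevels h₁ r s j ≤ towerLevels h₁ r s (j + 1) := by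
  have h1 : ∑ t ∈ Finset.range i, s j t ≤ ∑ t ∈ Finset.range (r j), s j t :=
    Finset.sum_le_sum_of_subset (Finset.range_mono hi.le)
  have h2 : towerLevels h₁ r s j * (i + 1) ≤ towerLevels h₁ r s j * r j :=
    Nat.mul_le_mul_left _ hi
  rw [towerLevels_succ, colPos, colPos]
  rw [mul_add, mul_one] at h2
  omega

include hT ht hr' hlim hAd in
/-- The columns from which `T ^ n` leads over the top of the next tower become independent of a
given set, because of the spacers of the next stage. -/
lemma eventually_abs_sum_le_of_wrap {A : Set X} (hA : MeasurableSet A) {ε : ℝ} (hε : 0 < ε) :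
    ∀ᶠ j in atTop, ∀ α : ℕ, α ≤ 1 → ∀ n : ℤ, n ≤ ℌ[h₁,r'] (j + 1) →
      ∀ F ⊆ Finset.range (r' j), ∀ L ⊆ Finset.range (ℌ[h₁,r'] j),
      (∀ x ∈ F, ∀ k ∈ L, (ℌ[h₁,r'] (j + 1) : ℤ) ≤ pos[h₁,r'] j (α * r' j + x) + k + n) →
      |∑ x ∈ F, ∑ k ∈ L, dev μ T n A (shift T k (C j (α * r' j + x)))| ≤ ε := by
  have h1 := eventually_abs_dev_levelUnion_le ℝ hT ht hr' hlim hAd 1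
    (constProj_eq_of_koopmanPow_one_eq hT (ht.ergodic hT)) hA hε
  filter_upwards [(tendsto_add_atTop_nat 1).eventually h1] with j hj α hα n hn F hF L hL hwrap
  set I := F.image fun x => α * r' j + x with hI
  have hIr : I ⊆ Finset.range (doubleCuts r' j) := by
    intro i hi
    obtain ⟨x, hx, rfl⟩ := Finset.mem_image.1 hi
    have := Finset.mem_range.1 (hF hx)
    rw [Finset.mem_range, doubleCuts]
    interval_cases α <;> omega
  have hinj : Set.InjOn (fun x => α * r' j + x) F := fun a _ b _ h => by simpa using h
  have e1 : ∑ x ∈ F, ∑ k ∈ L, dev μ T n A (shift T k (C j (α * r' j + x))) =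
      ∑ i ∈ I, ∑ k ∈ L, dev μ T n A (shift T k (C j i)) := by
    rw [hI, Finset.sum_image hinj]
  set L' := (I ×ˢ L).image fun p => pos[h₁,r'] j p.1 + p.2 with hL'
  have e2 : ⋃ p ∈ I ×ˢ L, shift T (p.2 : ℕ) (C j p.1) = levelUnion T E (j + 1) L' := by
    rw [levelUnion, hL', Finset.set_biUnion_finset_image]
    refine Set.iUnion₂_congr fun p hp => ?_
    rw [ht.piece_eq_shift (Finset.mem_range.1 (hIr (Finset.mem_product.1 hp).1)), shift_shift]
    congr 1
    push_cast
    ring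
  rw [e1, ← ht.dev_columns hIr hL n hA, e2]
  have hL'r : L' ⊆ Finset.range (ℌ[h₁,r'] (j + 1)) := by
    intro l hl
    obtain ⟨p, hp, rfl⟩ := Finset.mem_image.1 hl
    have h2 := Finset.mem_range.1 (hL (Finset.mem_product.1 hp).2)
    have h3 := colPos_add_le (h₁ := h₁) (s := doubleStaircaseSpacers r')
      (Finset.mem_range.1 (hIr (Finset.mem_product.1 hp).1))
    rw [Finset.mem_range]
    omega
  refine hj n L' hL'r fun l hl => ?_
  have hlr := Finset.mem_range.1 (hL'r hl)
  obtain ⟨p, hp, rfl⟩ := Finset.mem_image.1 hl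
  obtain ⟨x, hx, hxp⟩ := Finset.mem_image.1 (Finset.mem_product.1 hp).1
  have h4 := hwrap x hx p.2 (Finset.mem_product.1 hp).2
  rw [hxp] at h4
  push_cast at hlr ⊢
  omega

include hlim in
lemma tendsto_one_div_doubleCuts :
    Tendsto (fun j => (1 : ℝ) / doubleCuts r' j) atTop (𝓝 0) :=
  tendsto_const_nhds.div_atTop (tendsto_natCast_atTop_atTop.comp (tendsto_doubleCuts hlim))

include hr' hAd in
lemma eventually_sum_range_lt_towerLevels :
    ∀ᶠ j in atTop, ∑ i ∈ Finset.range (r' j), i < ℌ[h₁,r'] j := by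
  filter_upwards [hAd.eventually (gt_mem_nhds (show (0 : ℝ) < 1 by norm_num))] with j hj
  have hH0 : (0 : ℝ) < ℌ[h₁,r'] j := by exact_mod_cast doubleStaircase_towerLevels_pos hr' j
  rw [div_lt_one hH0] at hj
  exact (sum_range_le_sq le_rfl).trans_lt (by exact_mod_cast hj)

lemma abs_sum_le_card_mul {F : Finset ℕ} {G : ℕ → ℝ} {δ : ℝ} {m : ℕ} (hδ : 0 ≤ δ)
    (hG : ∀ x ∈ F, |G x| ≤ δ) (hm : F.card ≤ m) : |∑ x ∈ F, G x| ≤ m * δ := by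
  refine (Finset.abs_sum_le_sum_abs _ _).trans ((Finset.sum_le_sum hG).trans ?_)
  rw [Finset.sum_const, nsmul_eq_mul]
  gcongr

include hT ht hr' hlim hAd in
/-- Levels which `T ^ n` moves by `c` columns, and by `c'` columns in excess of half a tower: each
column is carried to another column of the same half (displacement `c`), or to a column of the other
half (displacement `c'`), or over the top of the next tower; at most three columns are exceptional. -/
lemma eventually_abs_dev_levelUnion_le_of_ne_zero {A : Set X} (hA : MeasurableSet A) {ε : ℝ}
    (hε : 0 < ε) :
    ∀ᶠ j in atTop, ∀ n c c' : ℤ, n ≤ ℌ[h₁,r'] (j + 1) →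
      ∀ L ⊆ Finset.range (ℌ[h₁,r'] j),
      (∀ k ∈ L, ((k : ℤ) + n) / ℌ[h₁,r'] j = c ∧
        ((k : ℤ) + n - halfTime h₁ r' j) / ℌ[h₁,r'] j = c' ∧ 1 ≤ c ∧ c' ≠ 0) →
      |dev μ T n A (levelUnion T E j L)| ≤ ε := by
  have hε8 : 0 < ε / 8 := by positivity
  filter_upwards [eventually_abs_sum_half_columns_le_of_ne_zero hT ht hr' hlim hAd hA hε8,
    eventually_abs_sum_le_of_wrap hT ht hr' hlim hAd hA hε8,
    eventually_sum_range_lt_towerLevels hr' hAd,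
    (tendsto_one_div_doubleCuts hlim).eventually (gt_mem_nhds hε8)]
    with j hpiece hwrap hS hrj n c c' hn L hL hLc
  rcases L.eq_empty_or_nonempty with rfl | ⟨k₀, hk₀⟩
  · simp only [levelUnion, Finset.notMem_empty, Set.iUnion_of_empty, Set.iUnion_empty]
    refine (abs_dev_le hT _ _ _).trans ?_
    simpa using hε.le
  set R := r' j with hR
  set H := ℌ[h₁,r'] j with hH
  set m := halfTime h₁ r' j with hm
  have hm' : m = H * R + ∑ i ∈ Finset.range R, i := rfl
  have hH0 : (0 : ℤ) < H := by exact_mod_cast doubleStaircase_towerLevels_pos hr' j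
  have hc1 : 1 ≤ c := (hLc k₀ hk₀).2.2.1
  have hc0 : c' ≠ 0 := (hLc k₀ hk₀).2.2.2
  have hbd : ∀ k ∈ L, c * H ≤ k + n ∧ (k : ℤ) + n < c * H + H ∧
      c' * H ≤ (k : ℤ) + n - m ∧ (k : ℤ) + n - m < c' * H + H := by
    intro k hk
    obtain ⟨h1, h2, -, -⟩ := hLc k hk
    have e1 := Int.emod_nonneg ((k : ℤ) + n) hH0.ne'
    have e2 := Int.emod_lt_of_pos ((k : ℤ) + n) hH0
    have e3 := Int.emod_def ((k : ℤ) + n) H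
    have e4 := Int.emod_nonneg ((k : ℤ) + n - m) hH0.ne'
    have e5 := Int.emod_lt_of_pos ((k : ℤ) + n - m) hH0
    have e6 := Int.emod_def ((k : ℤ) + n - m) H
    rw [h1, mul_comm] at e3
    rw [h2, mul_comm] at e6
    omega
  have hmZ : (m : ℤ) = H * R + (∑ i ∈ Finset.range R, i : ℕ) := by rw [hm']; push_cast; ring
  set S : ℕ := ∑ i ∈ Finset.range R, i with hSdef
  have hSZ : (S : ℤ) < H := by exact_mod_cast hS
  -- The two displacements differ by the number `R` of columns of a half, up to one.
  have hcc1 : c' + R ≤ c := by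
    have := hbd k₀ hk₀
    have h2 : (c' + R) * (H : ℤ) < (c + 1) * H := by nlinarith
    have := lt_of_mul_lt_mul_right h2 hH0.le
    omega
  have hcc2 : c ≤ c' + R + 1 := by
    have := hbd k₀ hk₀
    have h2 : c * (H : ℤ) < (c' + R + 2) * H := by nlinarith
    have := lt_of_mul_lt_mul_right h2 hH0.le
    omega
  have hsucc : (ℌ[h₁,r'] (j + 1) : ℤ) = 2 * m := by rw [towerLevels_succ_eq]; push_cast; rfl
  set G : ℕ → ℕ → ℝ := fun α x => ∑ k ∈ L, dev μ T n A (shift T k (C j (α * R + x))) with hG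
  have hGle : ∀ α : ℕ, α ≤ 1 → ∀ x < R, |G α x| ≤ ε / 8 := fun α hα x hx =>
    (abs_sum_dev_half_column_le hT ht n hα hx A hL).trans hrj.le
  have hsame : ∀ α : ℕ, α ≤ 1 → |∑ x ∈ (Finset.range R).filter
      (fun x : ℕ => 0 ≤ (x : ℤ) + c ∧ (x : ℤ) + c < R), G α x| ≤ ε / 8 := by
    intro α hα
    refine hpiece α hα α hα c n (by omega) L hL fun k hk => ?_
    have := hbd k hk
    rw [sub_self, zero_mul, sub_zero]
    omega
  have hcross : |∑ x ∈ (Finset.range R).filter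
      (fun x : ℕ => 0 ≤ (x : ℤ) + c' ∧ (x : ℤ) + c' < R), G 0 x| ≤ ε / 8 := by
    refine hpiece 0 (by omega) 1 le_rfl c' n hc0 L hL fun k hk => ?_
    have := hbd k hk
    push_cast
    rw [one_mul]
    omega
  have hwrap0 : |∑ x ∈ (Finset.range R).filter
      (fun x : ℕ => (R : ℤ) + 1 ≤ x + c'), G 0 x| ≤ ε / 8 := by
    refine hwrap 0 (by omega) n hn _ (Finset.filter_subset _ _) L hL fun x hx k hk => ?_
    have h1 := (Finset.mem_filter.1 hx).2
    have h2 := Finset.mem_range.1 (Finset.mem_filter.1 hx).1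
    have h3 := hbd k hk
    rw [hsucc, colPos_half j (by omega) h2.le]
    have h4 : ((R : ℤ) + 1) * H ≤ (x + c') * H := mul_le_mul_of_nonneg_right h1 hH0.le
    push_cast
    have h5 : (0 : ℤ) ≤ ∑ i ∈ Finset.range x, (i : ℤ) := by positivity
    nlinarith
  have hwrap1 : |∑ x ∈ (Finset.range R).filter
      (fun x : ℕ => (R : ℤ) + 1 ≤ x + c), G 1 x| ≤ ε / 8 := by
    refine hwrap 1 le_rfl n hn _ (Finset.filter_subset _ _) L hL fun x hx k hk => ?_
    have h1 := (Finset.mem_filter.1 hx).2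
    have h2 := Finset.mem_range.1 (Finset.mem_filter.1 hx).1
    have h3 := hbd k hk
    rw [hsucc, colPos_half j le_rfl h2.le]
    have h4 : ((R : ℤ) + 1) * H ≤ (x + c) * H := mul_le_mul_of_nonneg_right h1 hH0.le
    push_cast
    have h5 : (0 : ℤ) ≤ ∑ i ∈ Finset.range x, (i : ℤ) := by positivity
    nlinarith
  have hgap : ∀ α : ℕ, α ≤ 1 → ∀ c : ℤ, |∑ x ∈ (Finset.range R).filter
      (fun x : ℕ => (x : ℤ) + c = R), G α x| ≤ ε / 8 := by
    intro α hα c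
    have h := abs_sum_le_card_mul (m := 1) hε8.le (fun x hx =>
      hGle α hα x (Finset.mem_range.1 (Finset.mem_filter.1 hx).1))
      (show ((Finset.range R).filter (fun x : ℕ => (x : ℤ) + c = R)).card ≤ 1 from
        Finset.card_le_one.2 fun a ha b hb => by
          have := (Finset.mem_filter.1 ha).2
          have := (Finset.mem_filter.1 hb).2
          omega)
    simpa using h
  have hgap' : |∑ x ∈ (Finset.range R).filter
      (fun x : ℕ => (x : ℤ) + c = R ∧ (x : ℤ) + c' ≠ 0), G 0 x| ≤ ε / 8 := by
    have h := abs_sum_le_card_mul (m := 1) hε8.le (fun x hx =>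
      hGle 0 (by omega) x (Finset.mem_range.1 (Finset.mem_filter.1 hx).1))
      (show ((Finset.range R).filter
        (fun x : ℕ => (x : ℤ) + c = R ∧ (x : ℤ) + c' ≠ 0)).card ≤ 1 from
        Finset.card_le_one.2 fun a ha b hb => by
          have := (Finset.mem_filter.1 ha).2
          have := (Finset.mem_filter.1 hb).2
          omega)
    simpa using h
  have hfst : ∑ x ∈ Finset.range R, G 0 x =
      ∑ x ∈ (Finset.range R).filter (fun x : ℕ => 0 ≤ (x : ℤ) + c ∧ (x : ℤ) + c < R), G 0 x +
      ∑ x ∈ (Finset.range R).filter (fun x : ℕ => 0 ≤ (x : ℤ) + c' ∧ (x : ℤ) + c' < R), G 0 x +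
      ∑ x ∈ (Finset.range R).filter (fun x : ℕ => (R : ℤ) + 1 ≤ x + c'), G 0 x +
      ∑ x ∈ (Finset.range R).filter (fun x : ℕ => (x : ℤ) + c = R ∧ (x : ℤ) + c' ≠ 0), G 0 x +
      ∑ x ∈ (Finset.range R).filter (fun x : ℕ => (x : ℤ) + c' = R), G 0 x := by
    simp only [Finset.sum_filter, ← Finset.sum_add_distrib]
    refine Finset.sum_congr rfl fun x hx => ?_
    have := Finset.mem_range.1 hx
    split_ifs <;> first | omega | simp
  have hsnd : ∑ x ∈ Finset.range R, G 1 x =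
      ∑ x ∈ (Finset.range R).filter (fun x : ℕ => 0 ≤ (x : ℤ) + c ∧ (x : ℤ) + c < R), G 1 x +
      ∑ x ∈ (Finset.range R).filter (fun x : ℕ => (R : ℤ) + 1 ≤ x + c), G 1 x +
      ∑ x ∈ (Finset.range R).filter (fun x : ℕ => (x : ℤ) + c = R), G 1 x := by
    simp only [Finset.sum_filter, ← Finset.sum_add_distrib]
    refine Finset.sum_congr rfl fun x hx => ?_
    split_ifs <;> first | omega | simp
  rw [dev_levelUnion_eq_halves ht hA n hL]
  change |∑ x ∈ Finset.range R, G 0 x + ∑ x ∈ Finset.range R, G 1 x| ≤ ε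
  rw [hfst, hsnd]
  have b1 := abs_le.1 (hsame 0 (by omega))
  have b2 := abs_le.1 (hsame 1 le_rfl)
  have b3 := abs_le.1 hcross
  have b4 := abs_le.1 hwrap0
  have b5 := abs_le.1 hwrap1
  have b6 := abs_le.1 (hgap 0 (by omega) c')
  have b7 := abs_le.1 (hgap 1 le_rfl c)
  have b8 := abs_le.1 hgap'
  rw [abs_le]
  constructor <;> linarith

end Mixing

/-! ### Exponents near and far from the half times -/

section Dichotomy

variable {X : Type*} [MeasurableSpace X] {μ : Measure X} [IsProbabilityMeasure μ] {T : X ≃ᵐ X}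
  {E : ℕ → Set X} {C : ℕ → ℕ → Set X} {h₁ : ℕ} {r' : ℕ → ℕ}
  (hT : MeasurePreserving T μ μ)
  (ht : IsRankOneTowers μ T h₁ (doubleCuts r') (doubleStaircaseSpacers r') E C)
  (hr' : ∀ j, 1 ≤ r' j) (hlim : Tendsto r' atTop atTop)
  (hAd : Tendsto (fun j => (r' j : ℝ) ^ 2 / ℌ[h₁,r'] j) atTop (𝓝 0))

lemma ediv_mem_Icc {H : ℤ} (n : ℤ) {k : ℤ} (hk0 : 0 ≤ k) (hk : k < H) :
    (k + n) / H ∈ Finset.Icc (n / H) (n / H + 1) := by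
  have hH : 0 < H := by omega
  rw [Finset.mem_Icc]
  constructor
  · exact Int.ediv_le_ediv hH (by omega)
  · rw [← Int.lt_add_one_iff, Int.ediv_lt_iff_lt_mul hH]
    linarith [Int.lt_ediv_add_one_mul_self n hH]

include hT ht hr' hlim hAd in
/-- The powers `T ^ n` with `H_j ≤ n ≤ H_{j+1}` are almost mixing, unless `n` is close to half the
height of the tower of stage `j + 1`. -/
lemma eventually_abs_dev_le_of_far {A B : Set X} (hA : MeasurableSet A)
    (hB : MeasurableSet B) {ε : ℝ} (hε : 0 < ε) :
    ∀ᶠ j in atTop, ∀ n : ℤ, (ℌ[h₁,r'] j : ℤ) ≤ n ∧ n ≤ ℌ[h₁,r'] (j + 1) ∧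
      (ℌ[h₁,r'] j : ℤ) ≤ |n - halfTime h₁ r' j| → |dev μ T n A B| ≤ ε := by
  refine eventually_abs_dev_le_of_levelUnion hT ht hA hB (fun δ hδ => ?_) hε
  filter_upwards [eventually_abs_dev_levelUnion_le_of_ne_zero hT ht hr' hlim hAd hA
    (show 0 < δ / 4 by positivity)] with j hj n ⟨hn1, hn2, hn3⟩ K hK
  set H : ℤ := ((ℌ[h₁,r'] j : ℕ) : ℤ) with hH
  set m := halfTime h₁ r' j
  have hH0 : 0 < H := by rw [hH]; exact_mod_cast doubleStaircase_towerLevels_pos hr' j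
  have hKr : ∀ k ∈ K, (k : ℤ) < H := fun k hk => by
    have := Finset.mem_range.1 (hK hk)
    omega
  set Q := Finset.Icc (n / H) (n / H + 1) ×ˢ Finset.Icc ((n - m) / H) ((n - m) / H + 1) with hQ
  have hq : ∀ k ∈ K, (((k : ℤ) + n) / H, ((k : ℤ) + n - m) / H) ∈ Q := fun k hk => by
    rw [hQ, Finset.mem_product, add_sub_assoc]
    exact ⟨ediv_mem_Icc n (by omega) (hKr k hk), ediv_mem_Icc (n - m) (by omega) (hKr k hk)⟩
  rw [ht.dev_levelUnion_eq_sum_fiber n hA hK _ Q hq]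
  refine (Finset.abs_sum_le_sum_abs _ _).trans ((Finset.sum_le_sum (g := fun _ => δ / 4)
    fun c _ => ?_).trans (le_of_eq ?_))
  · refine hj n c.1 c.2 hn2 _ ((Finset.filter_subset _ _).trans hK) fun k hk => ?_
    obtain ⟨hkK, rfl⟩ := Finset.mem_filter.1 hk
    have hk2 := hKr k hkK
    refine ⟨rfl, rfl, ?_, ?_⟩
    · rw [Int.le_ediv_iff_mul_le hH0]; omega
    · intro h0
      have h1 := Int.emod_nonneg ((k : ℤ) + n - m) hH0.ne'
      have h2 := Int.emod_lt_of_pos ((k : ℤ) + n - m) hH0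
      have h3 := Int.emod_def ((k : ℤ) + n - m) H
      simp only at h0
      rw [h0, mul_zero] at h3
      rcases abs_cases (n - (m : ℤ)) with h | h <;> omega
  · rw [Finset.sum_const, hQ, Finset.card_product, Int.card_Icc, Int.card_Icc]
    have e : ∀ a : ℤ, (a + 1 + 1 - a).toNat = 2 := fun a => by omega
    rw [e, e]
    norm_num
    ring

include hT ht hr' hlim hAd in
/-- Levels which `T ^ n'` keeps in the tower: the half time followed by `T ^ n'` acts on half of the
columns as `T ^ n'`, and the other columns lead over the top of the next tower. -/
lemma eventually_abs_dev_halfTime_add_levelUnion_sub_le {A : Set X} (hA : MeasurableSet A) {ε : ℝ}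
    (hε : 0 < ε) :
    ∀ᶠ j in atTop, ∀ n : ℤ, halfTime h₁ r' j + n ≤ ℌ[h₁,r'] (j + 1) →
      ∀ L ⊆ Finset.range (ℌ[h₁,r'] j),
      (∀ k ∈ L, 0 ≤ (k : ℤ) + n ∧ (k : ℤ) + n < ℌ[h₁,r'] j) →
      |dev μ T (halfTime h₁ r' j + n) A (levelUnion T E j L) -
        dev μ T n A (levelUnion T E j L) / 2| ≤ ε := by
  have hr : ∀ j, 0 < doubleCuts r' j := fun j => by have := hr' j; simp only [doubleCuts]; omega
  filter_upwards [ht.eventually_abs_sum_transfer_le hT hA (fun j => (r' j : ℝ) ^ 2)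
    (fun j => by positivity) hAd hr (show 0 < ε / 2 by positivity),
    eventually_abs_sum_le_of_wrap hT ht hr' hlim hAd hA (show 0 < ε / 2 by positivity)]
    with j hj hwrap n hn L hL hLn
  set R := r' j with hR
  set m := halfTime h₁ r' j with hm
  have hpos : ∀ x < R, (m : ℤ) + n + colPos h₁ (doubleCuts r') (doubleStaircaseSpacers r') j x -
      colPos h₁ (doubleCuts r') (doubleStaircaseSpacers r') j (R + x) = n := by
    intro x hx
    have h0 := colPos_half (h₁ := h₁) (r' := r') j (α := 0) (by omega) hx.le
    have h1 := colPos_half (h₁ := h₁) (r' := r') j (α := 1) le_rfl hx.le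
    rw [zero_mul, zero_add, zero_mul, zero_add] at h0
    rw [one_mul, one_mul] at h1
    rw [h0, h1]
    push_cast
    ring
  have h1 := hj (Finset.range R) (Finset.range_mono (by simp only [doubleCuts]; omega)) L hL
    (m + n) (fun x => R + x) (fun x hx => by
      have := Finset.mem_range.1 hx
      simp only [doubleCuts]
      omega) (fun x hx => by
      rw [hpos x (Finset.mem_range.1 hx), Finset.filter_false_of_mem fun k hk => not_not.2 (hLn k hk)]
      simp only [Finset.card_empty, Nat.cast_zero]
      positivity)
  have h2 : (∑ x ∈ Finset.range R, dev μ T (m + n +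
      colPos h₁ (doubleCuts r') (doubleStaircaseSpacers r') j x -
      colPos h₁ (doubleCuts r') (doubleStaircaseSpacers r') j (R + x)) A (levelUnion T E j L)) /
        doubleCuts r' j = dev μ T n A (levelUnion T E j L) / 2 := by
    rw [Finset.sum_congr rfl fun x hx => by rw [hpos x (Finset.mem_range.1 hx)]]
    have : (R : ℝ) ≠ 0 := by have := hr' j; positivity
    rw [Finset.sum_const, Finset.card_range, nsmul_eq_mul, doubleCuts, ← hR]
    push_cast
    field_simp
  rw [h2] at h1
  have h3 := hwrap 1 le_rfl (m + n) hn (Finset.range R) subset_rfl L hL fun x hx k hk => by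
    rw [towerLevels_succ_eq, colPos_half j le_rfl (Finset.mem_range.1 hx).le]
    have := (hLn k hk).1
    push_cast
    have h5 : (0 : ℤ) ≤ ∑ i ∈ Finset.range x, (i : ℤ) := by positivity
    have h6 : (0 : ℤ) ≤ ℌ[h₁,r'] j * x := by positivity
    linarith
  rw [dev_levelUnion_eq_halves ht hA _ hL]
  simp only [zero_mul, zero_add]
  rw [abs_le] at *
  constructor <;> linarith [h1.1, h1.2, h3.1, h3.2]

include hT ht hr' hlim hAd in
/-- Shortly before or after the half time, half of the space has returned to its place, and the other
half is mixed: up to a weakly small error, `T ^ (m_j + n)` is `(T ^ n + Θ) / 2` for `|n| ≤ H_j`. -/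
lemma eventually_abs_dev_halfTime_add_sub_le {A B : Set X} (hA : MeasurableSet A)
    (hB : MeasurableSet B) {ε : ℝ} (hε : 0 < ε) :
    ∀ᶠ j in atTop, ∀ n : ℤ, |n| ≤ ℌ[h₁,r'] j →
      |dev μ T (halfTime h₁ r' j + n) A B - dev μ T n A B / 2| ≤ ε := by
  have hδ : 0 < ε / 24 := by positivity
  have hlev : ∀ c ∈ ({-1, 1} : Finset ℤ), ∀ᶠ j in atTop, ∀ n : ℤ, ∀ L ⊆ Finset.range (ℌ[h₁,r'] j),
      (∀ k ∈ L, 0 ≤ (k : ℤ) + (n - c * ℌ[h₁,r'] j) ∧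
        (k : ℤ) + (n - c * ℌ[h₁,r'] j) < ℌ[h₁,r'] j) →
      |dev μ T n A (levelUnion T E j L)| ≤ ε / 24 := by
    intro c hc
    refine eventually_abs_dev_levelUnion_le ℝ hT ht hr' hlim hAd c (fun f hf => ?_) hA hδ
    refine constProj_eq_of_koopmanPow_eq hT ht hr' hlim hAd ?_ f hf
    rintro rfl
    simp at hc
  filter_upwards [eventually_abs_dev_levelUnion_le_of_ne_zero hT ht hr' hlim hAd hA hδ,
    (Filter.eventually_all_finset _).2 hlev,
    eventually_abs_dev_halfTime_add_levelUnion_sub_le hT ht hr' hlim hAd hA hδ,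
    ht.eventually_measureReal_symmDiff_le hB (show 0 < ε / 6 by positivity),
    hlim.eventually_ge_atTop 2] with j hne hlevj hdir ⟨K, hK, hKB⟩ hR n hn
  set H : ℤ := ((ℌ[h₁,r'] j : ℕ) : ℤ) with hH
  set m := halfTime h₁ r' j with hm
  have hH0 : 0 < H := by rw [hH]; exact_mod_cast doubleStaircase_towerLevels_pos hr' j
  have hn' := abs_le.1 hn
  have hmH : 2 * H ≤ m := by
    have h1 := Nat.mul_le_mul_left (ℌ[h₁,r'] j) hR
    have h2 : ℌ[h₁,r'] j * r' j ≤ m := by rw [hm, halfTime]; omega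
    omega
  have hsucc : (ℌ[h₁,r'] (j + 1) : ℤ) = 2 * m := by rw [towerLevels_succ_eq]; push_cast; rfl
  have hKr : ∀ k ∈ K, (k : ℤ) < H := fun k hk => by
    have := Finset.mem_range.1 (hK hk)
    omega
  set Q := Finset.Icc ((m + n) / H) ((m + n) / H + 1) ×ˢ Finset.Icc (-1 : ℤ) 1 with hQ
  have hq : ∀ k ∈ K, (((k : ℤ) + (m + n)) / H, ((k : ℤ) + n) / H) ∈ Q := fun k hk => by
    rw [hQ, Finset.mem_product]
    refine ⟨ediv_mem_Icc _ (by omega) (hKr k hk), ?_⟩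
    have := hKr k hk
    rw [Finset.mem_Icc]
    constructor
    · rw [Int.le_ediv_iff_mul_le hH0]; omega
    · refine Int.lt_add_one_iff.1 ?_
      rw [Int.ediv_lt_iff_lt_mul hH0]; omega
  have hfib : |dev μ T (m + n) A (levelUnion T E j K) - dev μ T n A (levelUnion T E j K) / 2|
      ≤ ε / 2 := by
    rw [ht.dev_levelUnion_eq_sum_fiber (m + n) hA hK _ Q hq,
      ht.dev_levelUnion_eq_sum_fiber n hA hK _ Q hq, Finset.sum_div, ← Finset.sum_sub_distrib]
    refine (Finset.abs_sum_le_sum_abs _ _).trans ((Finset.sum_le_sum (g := fun _ => ε / 12)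
      fun c hc => ?_).trans (le_of_eq ?_))
    · set L := K.filter fun k : ℕ => (((k : ℤ) + (m + n)) / H, ((k : ℤ) + n) / H) = c with hL
      have hLr : L ⊆ Finset.range (ℌ[h₁,r'] j) := (Finset.filter_subset _ _).trans hK
      have hLc : ∀ k ∈ L, 0 ≤ (k : ℤ) + (n - c.2 * H) ∧ (k : ℤ) + (n - c.2 * H) < H := by
        intro k hk
        obtain ⟨hkK, rfl⟩ := Finset.mem_filter.1 hk
        have h1 := Int.emod_nonneg ((k : ℤ) + n) hH0.ne'
        have h2 := Int.emod_lt_of_pos ((k : ℤ) + n) hH0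
        have h3 := Int.emod_def ((k : ℤ) + n) H
        rw [mul_comm] at h3
        simp only
        omega
      by_cases hc0 : c.2 = 0
      · rw [hc0, zero_mul, sub_zero] at hLc
        exact (hdir n (by omega) L hLr hLc).trans (by linarith)
      · have h1 := hne (m + n) c.1 c.2 (by omega) L hLr fun k hk => by
          obtain ⟨hkK, hkc⟩ := Finset.mem_filter.1 hk
          refine ⟨congrArg Prod.fst hkc, ?_, ?_, hc0⟩
          · rw [← congrArg Prod.snd hkc]
            simp only
            congr 1
            ring
          · rw [← congrArg Prod.fst hkc]
            simp only
            rw [Int.le_ediv_iff_mul_le hH0]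
            omega
        have hc2 := Finset.mem_Icc.1 (Finset.mem_product.1 hc).2
        have h2 := hlevj c.2 (by
          rw [Finset.mem_insert, Finset.mem_singleton]
          omega) n L hLr hLc
        rw [abs_le] at *
        constructor <;> linarith [h1.1, h1.2, h2.1, h2.2]
    · rw [Finset.sum_const, hQ, Finset.card_product, Int.card_Icc, Int.card_Icc]
      have e : ∀ a : ℤ, (a + 1 + 1 - a).toNat = 2 := fun a => by omega
      rw [e, show ((1 : ℤ) + 1 - -1).toNat = 3 from rfl]
      push_cast
      ring
  have h1 := abs_dev_sub_right_le hT (m + n) hA hB (ht.measurableSet_levelUnion j K)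
  have h2 := abs_dev_sub_right_le hT n hA hB (ht.measurableSet_levelUnion j K)
  rw [abs_le] at *
  constructor <;> linarith [h1.1, h1.2, h2.1, h2.2, hfib.1, hfib.2]

end Dichotomy

/-! ### Weak limits of powers -/

section WeakLimits

open scoped InnerProductSpace

variable {𝕜 : Type*} [RCLike 𝕜] {X : Type*} [MeasurableSpace X] {μ : Measure X}
  {T : X ≃ᵐ X} (hT : MeasurePreserving T μ μ)

/-- The powers `T ^ (n i)` tend to `Q` in the weak operator topology. -/
def WeakTendsto (hT : MeasurePreserving T μ μ) (n : ℕ → ℤ) (Q : Lp 𝕜 2 μ →L[𝕜] Lp 𝕜 2 μ) : Prop :=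
  ∀ f g : Lp 𝕜 2 μ, Tendsto (fun i => ⟪g, koopmanPow 𝕜 T hT (n i) f⟫_𝕜) atTop (𝓝 ⟪g, Q f⟫_𝕜)

lemma mem_weakLimitsOfPowers_iff {l : Filter ℤ} {Q : Lp 𝕜 2 μ →L[𝕜] Lp 𝕜 2 μ} :
    Q ∈ weakLimitsOfPowers 𝕜 T hT l ↔
      ∃ n : ℕ → ℤ, Tendsto n atTop l ∧ WeakTendsto hT n Q := by
  simp only [weakLimitsOfPowers, Set.mem_ofPred_eq,
    ContinuousLinearMapWOT.tendsto_iff_forall_inner_apply_tendsto]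
  rfl

variable {hT}

lemma WeakTendsto.comp {n : ℕ → ℤ} {Q : Lp 𝕜 2 μ →L[𝕜] Lp 𝕜 2 μ} (h : WeakTendsto hT n Q)
    {φ : ℕ → ℕ} (hφ : Tendsto φ atTop atTop) : WeakTendsto hT (n ∘ φ) Q :=
  fun f g => (h f g).comp hφ

lemma WeakTendsto.unique {n : ℕ → ℤ} {Q Q' : Lp 𝕜 2 μ →L[𝕜] Lp 𝕜 2 μ} (h : WeakTendsto hT n Q)
    (h' : WeakTendsto hT n Q') : Q = Q' := by
  ext1 f
  exact ext_inner_left 𝕜 fun g => tendsto_nhds_unique (h f g) (h' f g)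

lemma weakTendsto_const (a : ℤ) : WeakTendsto hT (fun _ => a) (koopmanPow 𝕜 T hT a) :=
  fun _ _ => tendsto_const_nhds

lemma WeakTendsto.norm_le {n : ℕ → ℤ} {Q : Lp 𝕜 2 μ →L[𝕜] Lp 𝕜 2 μ} (h : WeakTendsto hT n Q) :
    ‖Q‖ ≤ 1 := by
  refine ContinuousLinearMap.opNorm_le_bound _ zero_le_one fun f => ?_
  have h1 : ‖⟪Q f, Q f⟫_𝕜‖ ≤ ‖Q f‖ * ‖f‖ := by
    refine le_of_tendsto (h f (Q f)).norm (Eventually.of_forall fun i => ?_)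
    exact (norm_inner_le_norm _ _).trans_eq (by rw [norm_koopmanPow_apply])
  rw [inner_self_eq_norm_sq_to_K, norm_pow, RCLike.norm_ofReal, abs_norm, sq] at h1
  rw [one_mul]
  rcases (norm_nonneg (Q f)).eq_or_lt with h0 | h0
  · rw [← h0]; exact norm_nonneg f
  · exact le_of_mul_le_mul_left h1 h0

lemma WeakTendsto.adjoint {n : ℕ → ℤ} {Q : Lp 𝕜 2 μ →L[𝕜] Lp 𝕜 2 μ} (h : WeakTendsto hT n Q) :
    WeakTendsto hT (fun i => -n i) (ContinuousLinearMap.adjoint Q) := by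
  intro f g
  have h1 := (RCLike.continuous_conj (K := 𝕜)).tendsto _ |>.comp (h g f)
  rw [inner_conj_symm, ← ContinuousLinearMap.adjoint_inner_right] at h1
  refine h1.congr fun i => ?_
  rw [Function.comp_apply, inner_conj_symm, inner_koopmanPow_left]

lemma adjoint_koopmanPow (n : ℤ) :
    ContinuousLinearMap.adjoint (koopmanPow 𝕜 T hT n) = koopmanPow 𝕜 T hT (-n) :=
  (weakTendsto_const n).adjoint.unique (weakTendsto_const (-n))

/-- The exponents of a weakly convergent sequence of powers take some value infinitely often, or
have a subsequence that tends to `+∞` or to `-∞`. -/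
lemma WeakTendsto.trichotomy {n : ℕ → ℤ} {Q : Lp 𝕜 2 μ →L[𝕜] Lp 𝕜 2 μ} (h : WeakTendsto hT n Q) :
    (¬ Tendsto n atTop cofinite ∧ ∃ a, Q = koopmanPow 𝕜 T hT a) ∨
      Q ∈ weakLimitsOfPowers 𝕜 T hT atTop ∨
      ContinuousLinearMap.adjoint Q ∈ weakLimitsOfPowers 𝕜 T hT atTop := by
  by_cases hcof : Tendsto n atTop cofinite
  · right
    have hpos : ∀ {n : ℕ → ℤ}, Tendsto n atTop cofinite → (∀ i, 0 ≤ n i) →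
        Tendsto n atTop atTop := by
      intro n hn hn0
      refine tendsto_atTop.2 fun b => ?_
      have h1 := hn.eventually (Set.finite_Ico 0 b).eventually_cofinite_notMem
      filter_upwards [h1] with i hi
      by_contra hlt
      exact hi ⟨hn0 i, not_le.1 hlt⟩
    by_cases hfreq : ∃ᶠ i in atTop, 0 ≤ n i
    · left
      obtain ⟨φ, hφ, hφ0⟩ := extraction_of_frequently_atTop hfreq
      exact (mem_weakLimitsOfPowers_iff hT).2
        ⟨n ∘ φ, hpos (hcof.comp hφ.tendsto_atTop) hφ0, h.comp hφ.tendsto_atTop⟩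
    · right
      obtain ⟨φ, hφ, hφ0⟩ := extraction_of_frequently_atTop (not_frequently.1 hfreq).frequently
      refine (mem_weakLimitsOfPowers_iff hT).2
        ⟨fun i => -n (φ i), hpos ?_ fun i => ?_, (h.comp hφ.tendsto_atTop).adjoint⟩
      · exact (neg_injective.tendsto_cofinite).comp (hcof.comp hφ.tendsto_atTop)
      · have := hφ0 i
        omega
  · left
    refine ⟨hcof, ?_⟩
    have hex : ∃ a, ∃ᶠ i in atTop, n i = a := by
      by_contra! hne
      refine hcof fun s hs => ?_
      have h1 : ∀ᶠ i in atTop, ∀ a ∈ sᶜ, n i ≠ a :=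
        (Filter.eventually_all_finite (mem_cofinite.1 hs)).2 fun a _ => hne a
      rw [mem_map]
      filter_upwards [h1] with i hi
      by_contra hs'
      exact hi _ hs' rfl
    obtain ⟨a, ha⟩ := hex
    obtain ⟨φ, hφ, hφa⟩ := extraction_of_frequently_atTop ha
    refine ⟨a, (h.comp hφ.tendsto_atTop).unique ?_⟩
    have : n ∘ φ = fun _ => a := funext hφa
    rw [this]
    exact weakTendsto_const a

variable [IsProbabilityMeasure μ]

lemma adjoint_constProj : ContinuousLinearMap.adjoint (constProj 𝕜 μ) = constProj 𝕜 μ := by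
  refine (ContinuousLinearMap.eq_adjoint_iff _ _).2 (fun f g => ?_) |>.symm
  exact inner_constProj_left f g

variable {E : ℕ → Set X} {C : ℕ → ℕ → Set X} {h₁ : ℕ} {r' : ℕ → ℕ}
  (ht : IsRankOneTowers μ T h₁ (doubleCuts r') (doubleStaircaseSpacers r') E C)
  (hr' : ∀ j, 1 ≤ r' j) (hlim : Tendsto r' atTop atTop)
  (hAd : Tendsto (fun j => (r' j : ℝ) ^ 2 / ℌ[h₁,r'] j) atTop (𝓝 0))

include ht hr' hlim hAd in
/-- Along exponents away from the half times, the powers tend to the projection onto the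
constants. -/
lemma weakTendsto_constProj_of_far {n : ℕ → ℤ} {j : ℕ → ℕ} (hj : Tendsto j atTop atTop)
    (hn : ∀ᶠ i in atTop, (ℌ[h₁,r'] (j i) : ℤ) ≤ n i ∧ n i ≤ ℌ[h₁,r'] (j i + 1) ∧
      (ℌ[h₁,r'] (j i) : ℤ) ≤ |n i - halfTime h₁ r' (j i)|) :
    WeakTendsto hT n (constProj 𝕜 μ) := by
  have hdev : ∀ A B, MeasurableSet A → MeasurableSet B →
      Tendsto (fun i => dev μ T (n i) A B) atTop (𝓝 0) := by
    intro A B hA hB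
    rw [tendsto_zero_iff_abs_tendsto_zero, Metric.tendsto_nhds]
    intro ε hε
    filter_upwards [hn, hj.eventually (eventually_abs_dev_le_of_far hT ht hr' hlim hAd hA hB
      (show 0 < ε / 2 by positivity))] with i hi hji
    have := hji _ hi
    simp only [Function.comp_apply, Real.dist_eq, sub_zero, abs_abs]
    linarith
  intro f g
  have h1 := (tendsto_inner_koopmanPow_sub (𝕜 := 𝕜) hT n hdev f g).add_const
    ⟪g, constProj 𝕜 μ f⟫_𝕜
  rw [zero_add] at h1
  refine h1.congr fun i => ?_
  rw [sub_apply, inner_sub_right, sub_add_cancel]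

include ht hr' hlim hAd in
/-- Near the half times, the powers behave as the mean of a shorter power and of the projection
onto the constants. -/
lemma tendsto_inner_koopmanPow_halfTime_sub {n : ℕ → ℤ} {j : ℕ → ℕ} (hj : Tendsto j atTop atTop)
    (hn : ∀ᶠ i in atTop, |n i| ≤ ℌ[h₁,r'] (j i)) (f g : Lp 𝕜 2 μ) :
    Tendsto (fun i => ⟪g, (koopmanPow 𝕜 T hT (halfTime h₁ r' (j i) + n i) -
      (2 : 𝕜)⁻¹ • (koopmanPow 𝕜 T hT (n i) + constProj 𝕜 μ)) f⟫_𝕜) atTop (𝓝 0) := by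
  refine tendsto_inner_of_ind _ 2 (fun i => ?_) (fun {A B} hA hB => ?_) f g
  · have h1 := norm_koopmanPow_le (𝕜 := 𝕜) hT (halfTime h₁ r' (j i) + n i)
    have h2 := norm_koopmanPow_le (𝕜 := 𝕜) hT (n i)
    have h3 := norm_constProj_le (𝕜 := 𝕜) (μ := μ)
    have h4 : ‖(2 : 𝕜)⁻¹ • (koopmanPow 𝕜 T hT (n i) + constProj 𝕜 μ)‖ ≤ 2⁻¹ * (1 + 1) := by
      rw [norm_smul, norm_inv, RCLike.norm_ofNat]
      gcongr
      exact (norm_add_le _ _).trans (add_le_add h2 h3)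
    exact (norm_sub_le _ _).trans (by linarith)
  · have hdev : Tendsto (fun i => dev μ T (halfTime h₁ r' (j i) + n i) A B -
        dev μ T (n i) A B / 2) atTop (𝓝 0) := by
      rw [tendsto_zero_iff_abs_tendsto_zero, Metric.tendsto_nhds]
      intro ε hε
      filter_upwards [hn, hj.eventually (eventually_abs_dev_halfTime_add_sub_le hT ht hr' hlim hAd
        hA hB (show 0 < ε / 2 by positivity))] with i hi hji
      have := hji _ hi
      simp only [Function.comp_apply, Real.dist_eq, sub_zero, abs_abs]
      linarith
    have := (RCLike.continuous_ofReal (K := 𝕜)).tendsto 0 |>.comp hdev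
    rw [RCLike.ofReal_zero] at this
    refine this.congr fun i => ?_
    rw [sub_apply, smul_apply,
      add_apply, inner_sub_right, inner_smul_right, inner_add_right,
      inner_ind_koopmanPow_ind, inner_ind_koopmanPow_ind, inner_ind_constProj_ind,
      Function.comp_apply, dev, dev]
    push_cast
    ring

include ht hr' hlim hAd in
/-- If powers tend to `Q`, then the powers delayed by suitable half times tend to `(Q + Θ) / 2`. -/
lemma WeakTendsto.half_mem {n : ℕ → ℤ} {Q : Lp 𝕜 2 μ →L[𝕜] Lp 𝕜 2 μ} (h : WeakTendsto hT n Q) :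
    (2 : 𝕜)⁻¹ • (Q + constProj 𝕜 μ) ∈ weakLimitsOfPowers 𝕜 T hT atTop := by
  have hex : ∀ i, ∃ j, i ≤ j ∧ |n i| ≤ ℌ[h₁,r'] j := fun i => by
    obtain ⟨j, hj1, hj2⟩ := ((eventually_ge_atTop i).and
      ((tendsto_towerLevels (h₁ := h₁) hr').eventually_ge_atTop (n i).natAbs)).exists
    exact ⟨j, hj1, by rw [Int.abs_eq_natAbs]; exact_mod_cast hj2⟩
  choose j hji hjn using hex
  have hj : Tendsto j atTop atTop := tendsto_atTop_mono hji tendsto_id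
  refine (mem_weakLimitsOfPowers_iff hT).2 ⟨fun i => halfTime h₁ r' (j i) + n i, ?_, fun f g => ?_⟩
  · have h1 : Tendsto (fun i => ((ℌ[h₁,r'] (j i) : ℕ) : ℤ)) atTop atTop :=
      tendsto_natCast_atTop_atTop.comp ((tendsto_towerLevels hr').comp hj)
    refine tendsto_atTop_mono' _ ?_ h1
    filter_upwards [(hlim.comp hj).eventually_ge_atTop 2] with i hi
    have h2 := Nat.mul_le_mul_left (ℌ[h₁,r'] (j i)) hi
    have h3 : ℌ[h₁,r'] (j i) * r' (j i) ≤ halfTime h₁ r' (j i) := by rw [halfTime]; omega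
    simp only [Function.comp_apply] at h2
    have := abs_le.1 (hjn i)
    omega
  · have h1 := (tendsto_inner_koopmanPow_halfTime_sub (𝕜 := 𝕜) (hT := hT) ht hr' hlim hAd hj
      (Eventually.of_forall hjn) f g).add (((h f g).add_const ⟪g, constProj 𝕜 μ f⟫_𝕜).const_mul
        (2 : 𝕜)⁻¹)
    rw [zero_add, ← inner_add_right, ← inner_smul_right] at h1
    refine h1.congr fun i => ?_
    rw [sub_apply, inner_sub_right, smul_apply,
      add_apply, inner_smul_right, inner_add_right]
    ring

include ht hr' hlim hAd in
/-- The projection onto the constants is a limit, along the heights of the towers. -/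
lemma constProj_mem_weakLimitsOfPowers :
    constProj 𝕜 μ ∈ weakLimitsOfPowers 𝕜 T hT atTop := by
  refine (mem_weakLimitsOfPowers_iff hT).2 ⟨fun i => (ℌ[h₁,r'] i : ℕ),
    tendsto_natCast_atTop_atTop.comp (tendsto_towerLevels hr'), ?_⟩
  refine weakTendsto_constProj_of_far ht hr' hlim hAd tendsto_id ?_
  filter_upwards [hlim.eventually_ge_atTop 2] with i hi
  have h2 := Nat.mul_le_mul_left (ℌ[h₁,r'] i) hi
  have h3 : ℌ[h₁,r'] i * r' i ≤ halfTime h₁ r' i := by rw [halfTime]; omega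
  have h4 := two_mul_towerLevels_le (h₁ := h₁) hr' i
  simp only [id]
  refine ⟨le_rfl, by omega, ?_⟩
  rw [abs_sub_comm]
  exact le_trans (by omega) (le_abs_self _)

include ht hr' hlim hAd in
/-- The dichotomy: a limit along `n i → +∞` is the projection `Θ` onto the constants, or it is
`(Q' + Θ) / 2` for a limit `Q'` of powers with shorter exponents. -/
lemma eq_constProj_or_exists_weakTendsto {Q : Lp 𝕜 2 μ →L[𝕜] Lp 𝕜 2 μ}
    (hQ : Q ∈ weakLimitsOfPowers 𝕜 T hT atTop) :
    Q = constProj 𝕜 μ ∨ ∃ n : ℕ → ℤ, WeakTendsto hT n ((2 : 𝕜) • Q - constProj 𝕜 μ) := by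
  obtain ⟨n, hn, h⟩ := (mem_weakLimitsOfPowers_iff hT).1 hQ
  have hex : ∀ i, ∃ j, (ℌ[h₁,r'] 0 : ℤ) ≤ n i →
      (ℌ[h₁,r'] j : ℤ) ≤ n i ∧ n i < ℌ[h₁,r'] (j + 1) := by
    intro i
    by_cases h0 : (ℌ[h₁,r'] 0 : ℤ) ≤ n i
    · obtain ⟨s, hs⟩ := Int.eq_ofNat_of_zero_le (le_trans (by positivity) h0)
      rw [hs] at h0 ⊢
      obtain ⟨p, -, hp⟩ := exists_towerLevels_le_lt (h₁ := h₁) hr' (q := 0) (s := s)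
        (by exact_mod_cast h0)
      exact ⟨p, fun _ => by exact_mod_cast hp⟩
    · exact ⟨0, fun h => absurd h h0⟩
  choose j hjn using hex
  have hjn' : ∀ᶠ i in atTop, (ℌ[h₁,r'] (j i) : ℤ) ≤ n i ∧ n i < ℌ[h₁,r'] (j i + 1) :=
    (hn.eventually_ge_atTop _).mono fun i hi => hjn i hi
  have hj : Tendsto j atTop atTop := by
    refine tendsto_atTop.2 fun J => ?_
    filter_upwards [hjn', hn.eventually_ge_atTop (ℌ[h₁,r'] J : ℤ)] with i hi hiJ
    have h1 : ℌ[h₁,r'] J < ℌ[h₁,r'] (j i + 1) := by exact_mod_cast hiJ.trans_lt hi.2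
    have := (strictMono_towerLevels hr').lt_iff_lt.1 h1
    omega
  by_cases hfreq : ∃ᶠ i in atTop, (ℌ[h₁,r'] (j i) : ℤ) ≤ |n i - halfTime h₁ r' (j i)|
  · left
    obtain ⟨φ, hφ, hφ'⟩ := extraction_of_frequently_atTop hfreq
    refine (h.comp hφ.tendsto_atTop).unique ?_
    refine weakTendsto_constProj_of_far ht hr' hlim hAd (hj.comp hφ.tendsto_atTop) ?_
    filter_upwards [hφ.tendsto_atTop.eventually hjn'] with i hi
    exact ⟨hi.1, hi.2.le, hφ' i⟩
  · right
    refine ⟨fun i => n i - halfTime h₁ r' (j i), fun f g => ?_⟩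
    have h1 := tendsto_inner_koopmanPow_halfTime_sub (𝕜 := 𝕜) (hT := hT) ht hr' hlim hAd hj
      (n := fun i => n i - halfTime h₁ r' (j i))
      ((not_frequently.1 hfreq).mono fun i hi => (not_le.1 hi).le) f g
    have h2 := (((h f g).sub h1).const_mul (2 : 𝕜)).sub_const ⟪g, constProj 𝕜 μ f⟫_𝕜
    rw [sub_zero, ← inner_smul_right, ← inner_sub_right] at h2
    refine h2.congr fun i => ?_
    rw [add_sub_cancel, sub_apply, inner_sub_right,
      smul_apply, add_apply, inner_smul_right,
      inner_add_right]
    have : (2 : 𝕜) ≠ 0 := two_ne_zero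
    field_simp
    ring

/-! ### The set of limits -/

lemma mem_dyadicLimits_iff {m₀ : ℕ} {Q : Lp 𝕜 2 μ →L[𝕜] Lp 𝕜 2 μ} :
    Q ∈ dyadicLimits 𝕜 T hT m₀ ↔ Q = constProj 𝕜 μ ∨ ∃ (m : ℕ) (n : ℤ), m₀ ≤ m ∧
      Q - constProj 𝕜 μ = ((2 : 𝕜) ^ m)⁻¹ • (koopmanPow 𝕜 T hT n - constProj 𝕜 μ) := by
  rw [dyadicLimits, Set.mem_union, Set.mem_singleton_iff]
  refine or_congr Iff.rfl (exists_congr fun m => exists_congr fun n => and_congr Iff.rfl ?_)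
  rw [sub_eq_iff_eq_add, smul_sub, sub_smul, one_smul]
  constructor <;> rintro rfl <;> abel

include ht hr' hlim hAd in
/-- If `Q` or its adjoint is a limit along `n i → +∞`, then `Q` is a dyadic limit. Otherwise the
dichotomy could be applied indefinitely, and `Q - Θ` would be arbitrarily small. -/
lemma mem_dyadicLimits_of_mem {Q : Lp 𝕜 2 μ →L[𝕜] Lp 𝕜 2 μ}
    (hQ : Q ∈ weakLimitsOfPowers 𝕜 T hT atTop ∨
      ContinuousLinearMap.adjoint Q ∈ weakLimitsOfPowers 𝕜 T hT atTop) :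
    Q ∈ dyadicLimits 𝕜 T hT 1 := by
  set Z : Set (Lp 𝕜 2 μ →L[𝕜] Lp 𝕜 2 μ) := {Q | Q ∈ weakLimitsOfPowers 𝕜 T hT atTop ∨
      ContinuousLinearMap.adjoint Q ∈ weakLimitsOfPowers 𝕜 T hT atTop} with hZ
  have hstep' : ∀ Q ∈ weakLimitsOfPowers 𝕜 T hT atTop, Q = constProj 𝕜 μ ∨
      (∃ a, (2 : 𝕜) • Q - constProj 𝕜 μ = koopmanPow 𝕜 T hT a) ∨
      (2 : 𝕜) • Q - constProj 𝕜 μ ∈ Z := by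
    intro Q hQ
    rcases eq_constProj_or_exists_weakTendsto ht hr' hlim hAd hQ with h | ⟨n, hn⟩
    · exact Or.inl h
    · rcases hn.trichotomy with ⟨-, h⟩ | h
      · exact Or.inr (Or.inl h)
      · exact Or.inr (Or.inr h)
  have hstep : ∀ Q ∈ Z, Q = constProj 𝕜 μ ∨
      (∃ a, (2 : 𝕜) • Q - constProj 𝕜 μ = koopmanPow 𝕜 T hT a) ∨
      (2 : 𝕜) • Q - constProj 𝕜 μ ∈ Z := by
    rintro Q (hQ | hQ)
    · exact hstep' Q hQ
    · have hadj : ContinuousLinearMap.adjoint ((2 : 𝕜) • Q - constProj 𝕜 μ) =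
          (2 : 𝕜) • ContinuousLinearMap.adjoint Q - constProj 𝕜 μ := by
        rw [map_sub, adjoint_constProj, map_smulₛₗ, map_ofNat]
      rcases hstep' _ hQ with h | ⟨a, h⟩ | h
      · left
        rw [← ContinuousLinearMap.adjoint_adjoint Q, h, adjoint_constProj]
      · right; left
        rw [← hadj] at h
        refine ⟨-a, ?_⟩
        rw [← adjoint_koopmanPow, ← h, ContinuousLinearMap.adjoint_adjoint]
      · right; right
        rw [← hadj, hZ, Set.mem_ofPred_eq, ContinuousLinearMap.adjoint_adjoint] at h
        exact h.symm
  have hnorm : ∀ Q ∈ Z, ‖Q - constProj 𝕜 μ‖ ≤ 2 := by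
    have hlim1 : ∀ Q ∈ weakLimitsOfPowers 𝕜 T hT atTop, ‖Q‖ ≤ 1 := fun Q hQ => by
      obtain ⟨n, -, h⟩ := (mem_weakLimitsOfPowers_iff hT).1 hQ
      exact h.norm_le
    intro Q hQ
    have h1 : ‖Q‖ ≤ 1 := by
      rcases hQ with h | h
      · exact hlim1 Q h
      · rw [← LinearIsometryEquiv.norm_map ContinuousLinearMap.adjoint Q]
        exact hlim1 _ h
    have h2 := norm_constProj_le (𝕜 := 𝕜) (μ := μ)
    exact (norm_sub_le _ _).trans (by linarith)
  by_contra hnot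
  have hiter : ∀ l : ℕ, ∃ Q' ∈ Z,
      Q - constProj 𝕜 μ = ((2 : 𝕜) ^ l)⁻¹ • (Q' - constProj 𝕜 μ) := by
    intro l
    induction l with
    | zero => exact ⟨Q, hQ, by simp⟩
    | succ l ih =>
      obtain ⟨Q', hQ', hQQ'⟩ := ih
      have key : Q - constProj 𝕜 μ = ((2 : 𝕜) ^ (l + 1))⁻¹ •
          (((2 : 𝕜) • Q' - constProj 𝕜 μ) - constProj 𝕜 μ) := by
        have e : ((2 : 𝕜) • Q' - constProj 𝕜 μ) - constProj 𝕜 μ =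
            (2 : 𝕜) • (Q' - constProj 𝕜 μ) := by
          rw [smul_sub, two_smul 𝕜 (constProj 𝕜 μ), sub_sub]
        rw [e, smul_smul, hQQ']
        congr 1
        have : (2 : 𝕜) ≠ 0 := two_ne_zero
        field_simp
        ring
      rcases hstep Q' hQ' with h | ⟨a, h⟩ | h
      · exfalso
        refine hnot (mem_dyadicLimits_iff.2 (Or.inl ?_))
        rw [h, sub_self, smul_zero] at hQQ'
        exact sub_eq_zero.1 hQQ'
      · exfalso
        rw [h] at key
        exact hnot (mem_dyadicLimits_iff.2 (Or.inr ⟨l + 1, a, by omega, key⟩))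
      · exact ⟨_, h, key⟩
  have hzero : ‖Q - constProj 𝕜 μ‖ ≤ 0 := by
    have hl : Tendsto (fun l : ℕ => (1 / 2 : ℝ) ^ l * 2) atTop (𝓝 (0 * 2)) :=
      (tendsto_pow_atTop_nhds_zero_of_lt_one (by norm_num) (by norm_num)).mul_const 2
    rw [zero_mul] at hl
    refine ge_of_tendsto hl (Eventually.of_forall fun l => ?_)
    obtain ⟨Q', hQ', h⟩ := hiter l
    rw [h, norm_smul, norm_inv, norm_pow, RCLike.norm_ofNat, one_div, inv_pow]
    gcongr
    exact hnorm Q' hQ'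
  exact hnot (mem_dyadicLimits_iff.2 (Or.inl (sub_eq_zero.1 (norm_le_zero_iff.1 hzero))))

include ht hr' hlim hAd in
lemma dyadicLimits_one_subset :
    dyadicLimits 𝕜 T hT 1 ⊆ weakLimitsOfPowers 𝕜 T hT atTop := by
  intro Q hQ
  rcases mem_dyadicLimits_iff.1 hQ with rfl | ⟨m, a, hm, h⟩
  · exact constProj_mem_weakLimitsOfPowers ht hr' hlim hAd
  · obtain ⟨m, rfl⟩ := Nat.exists_eq_add_of_le' hm
    clear hm hQ
    induction m generalizing Q with
    | zero =>
      have h1 := (weakTendsto_const (𝕜 := 𝕜) (hT := hT) a).half_mem ht hr' hlim hAd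
      convert h1 using 1
      rw [sub_eq_iff_eq_add] at h
      rw [h]
      have : constProj 𝕜 μ = (2 : 𝕜)⁻¹ • constProj 𝕜 μ + (2 : 𝕜)⁻¹ • constProj 𝕜 μ := by
        rw [← add_smul, ← two_mul, mul_inv_cancel₀ two_ne_zero, one_smul]
      rw [zero_add, pow_one, smul_sub, smul_add]
      nth_rw 2 [this]
      abel
    | succ m ih =>
      have h1 : (2 : 𝕜) • Q - constProj 𝕜 μ ∈ weakLimitsOfPowers 𝕜 T hT atTop := by
        refine ih ?_
        have e : ((2 : 𝕜) • Q - constProj 𝕜 μ) - constProj 𝕜 μ =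
            (2 : 𝕜) • (Q - constProj 𝕜 μ) := by
          rw [smul_sub, two_smul 𝕜 (constProj 𝕜 μ), sub_sub]
        rw [e, h, smul_smul]
        congr 1
        have : (2 : 𝕜) ≠ 0 := two_ne_zero
        field_simp
        ring
      obtain ⟨n, -, hn⟩ := (mem_weakLimitsOfPowers_iff hT).1 h1
      have h2 := hn.half_mem ht hr' hlim hAd
      rwa [sub_add_cancel, smul_smul, inv_mul_cancel₀ two_ne_zero, one_smul] at h2

lemma dyadicLimits_mul_mem {m₀ : ℕ} {P Q : Lp 𝕜 2 μ →L[𝕜] Lp 𝕜 2 μ}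
    (hP : P ∈ dyadicLimits 𝕜 T hT m₀) (hQ : Q ∈ dyadicLimits 𝕜 T hT m₀) :
    P * Q ∈ dyadicLimits 𝕜 T hT m₀ := by
  rcases hP with rfl | ⟨m, n, hm, rfl⟩ <;> rcases hQ with rfl | ⟨m', n', hm', rfl⟩
  · left; rw [constProj_mul_constProj]; rfl
  · left
    rw [mul_add, mul_smul_comm, mul_smul_comm, constProj_mul_koopmanPow, constProj_mul_constProj,
      ← add_smul, add_sub_cancel, one_smul]
    rfl
  · left
    rw [add_mul, smul_mul_assoc, smul_mul_assoc, koopmanPow_mul_constProj, constProj_mul_constProj,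
      ← add_smul, add_sub_cancel, one_smul]
    rfl
  · right
    refine ⟨m + m', n + n', by omega, ?_⟩
    simp only [mul_add, add_mul, mul_smul_comm, smul_mul_assoc, koopmanPow_mul_constProj,
      constProj_mul_koopmanPow, constProj_mul_constProj, koopmanPow_add, pow_add, mul_inv]
    module

lemma countable_dyadicLimits (m₀ : ℕ) : (dyadicLimits 𝕜 T hT m₀).Countable := by
  refine (Set.countable_singleton _).union ?_
  refine (Set.countable_range fun p : ℕ × ℤ => ((2 : 𝕜) ^ p.1)⁻¹ • koopmanPow 𝕜 T hT p.2 +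
    (1 - ((2 : 𝕜) ^ p.1)⁻¹) • constProj 𝕜 μ).mono ?_
  rintro _ ⟨m, n, -, rfl⟩
  exact ⟨(m, n), rfl⟩

include ht in
/-- Some tower of a double staircase has a base of measure strictly between `0` and `1`: the measure
is positive as the levels almost fill the space, and at most `1 / 2` if there are two levels. -/
lemma exists_measureReal_base_mem_Ioo (hT : MeasurePreserving T μ μ) (hr' : ∀ j, 1 ≤ r' j) :
    ∃ j, 0 < μ.real (E j) ∧ μ.real (E j) < 1 := by
  obtain ⟨j, ⟨K, hK, hKA⟩, hj⟩ := ((ht.eventually_measureReal_symmDiff_le MeasurableSet.univ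
    (show (0 : ℝ) < 1 / 2 by norm_num)).and
      ((tendsto_towerLevels hr').eventually_ge_atTop 2)).exists
  have h1 := abs_measureReal_inter_sub_le (μ := μ) MeasurableSet.univ
    (ht.measurableSet_levelUnion j K) MeasurableSet.univ
  rw [Set.inter_univ, Set.inter_univ, probReal_univ, ht.measureReal_levelUnion hT hK] at h1
  have h2 := le_abs_self (1 - K.card * μ.real (E j))
  have hw : 0 < μ.real (E j) := by
    refine lt_of_le_of_ne measureReal_nonneg fun h => ?_
    rw [← h, mul_zero] at h2 h1
    linarith
  refine ⟨j, hw, ?_⟩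
  have h3 := ht.towerLevels_mul_le hT j
  have h4 : (2 : ℝ) ≤ ℌ[h₁,r'] j := by exact_mod_cast hj
  nlinarith

/-- For a mixing transformation, the limits along `n i → +∞` do not differ from the projection onto
the constants on the correlation of a set with itself. -/
lemma measureReal_eq_of_isMixing (hmix : IsMixing μ T) {Q : Lp 𝕜 2 μ →L[𝕜] Lp 𝕜 2 μ}
    (hQ : Q ∈ weakLimitsOfPowers 𝕜 T hT atTop) {A : Set X} (hA : MeasurableSet A) :
    ⟪ind 𝕜 μ hA, Q (ind 𝕜 μ hA)⟫_𝕜 = (μ.real A * μ.real A : ℝ) := by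
  obtain ⟨n, hn, h⟩ := (mem_weakLimitsOfPowers_iff hT).1 hQ
  have h1 : Tendsto (fun k : ℕ => μ.real (A ∩ shift T k A)) atTop (𝓝 (μ.real A * μ.real A)) := by
    have h2 := (ENNReal.tendsto_toReal (by finiteness)).comp (hmix A A hA hA)
    rw [ENNReal.toReal_mul] at h2
    refine h2.congr fun k => ?_
    have h3 : shift T k (T^[k] ⁻¹' A) = A := by
      rw [shift_natCast]
      exact Set.image_preimage_eq _ (T.surjective.iterate k)
    rw [Function.comp_apply, ← measure_shift hT k, shift_inter, h3]
    rfl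
  have h2 : Tendsto (fun i => μ.real (A ∩ shift T (n i) A)) atTop (𝓝 (μ.real A * μ.real A)) := by
    have h3 : Tendsto (fun i => (n i).toNat) atTop atTop :=
      tendsto_atTop.2 fun b => (hn.eventually_ge_atTop (b : ℤ)).mono fun i hi => by omega
    refine (h1.comp h3).congr' ?_
    filter_upwards [hn.eventually_ge_atTop 0] with i hi
    rw [Function.comp_apply, Int.toNat_of_nonneg hi]
  have h3 := (RCLike.continuous_ofReal (K := 𝕜)).tendsto _ |>.comp h2
  refine tendsto_nhds_unique (h _ _) (h3.congr fun i => ?_)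
  rw [inner_ind_koopmanPow_ind]
  rfl

end WeakLimits

theorem theorem1 {𝕜 : Type*} [RCLike 𝕜] {X : Type*} [MeasurableSpace X] (μ : Measure X)
    [IsProbabilityMeasure μ] (T : X ≃ᵐ X) (hT : MeasurePreserving T μ μ)
    (h₁ : ℕ) (r' : ℕ → ℕ) (hr'_pos : ∀ j, 1 ≤ r' j) (hr'_lim : Tendsto r' atTop atTop)
    (hAdams : Tendsto (fun j => (doubleCuts r' j : ℝ) ^ 2 /
      towerHeight h₁ (doubleCuts r') (doubleStaircaseSpacers r') j) atTop (𝓝 0))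
    (hds : IsDoubleStaircase μ T h₁ r') :
    -- the limits of powers along `n i → +∞`, and along `|n i| → ∞`
    weakLimitsOfPowers 𝕜 T hT atTop = dyadicLimits 𝕜 T hT 1 ∧
    weakLimitsOfPowers 𝕜 T hT cofinite = dyadicLimits 𝕜 T hT 1 ∧
    -- the limits along arbitrary sequences of exponents, which include the powers themselves
    weakLimitsOfPowers 𝕜 T hT ⊤ = dyadicLimits 𝕜 T hT 0 ∧
    -- these sets are semigroups under composition
    (∀ P ∈ weakLimitsOfPowers 𝕜 T hT atTop, ∀ Q ∈ weakLimitsOfPowers 𝕜 T hT atTop,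
      P * Q ∈ weakLimitsOfPowers 𝕜 T hT atTop) ∧
    (∀ P ∈ weakLimitsOfPowers 𝕜 T hT ⊤, ∀ Q ∈ weakLimitsOfPowers 𝕜 T hT ⊤,
      P * Q ∈ weakLimitsOfPowers 𝕜 T hT ⊤) ∧
    -- they are countable, and `T` is not mixing
    (weakLimitsOfPowers 𝕜 T hT atTop).Countable ∧
    (weakLimitsOfPowers 𝕜 T hT ⊤).Countable ∧
    ¬ IsMixing μ T := by
  obtain ⟨E, C, ht⟩ := hds
  have hH2 : ∀ᶠ j in atTop, 2 ≤ towerLevels h₁ (doubleCuts r') (doubleStaircaseSpacers r') j :=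
    (tendsto_towerLevels hr'_pos).eventually_ge_atTop 2
  have hAd : Tendsto (fun j => (r' j : ℝ) ^ 2 /
      towerLevels h₁ (doubleCuts r') (doubleStaircaseSpacers r') j) atTop (𝓝 0) := by
    refine tendsto_of_tendsto_of_tendsto_of_le_of_le' tendsto_const_nhds hAdams
      (Eventually.of_forall fun j => by positivity) ?_
    filter_upwards [hH2] with j hj
    have h2 : (2 : ℝ) ≤ towerLevels h₁ (doubleCuts r') (doubleStaircaseSpacers r') j := by
      exact_mod_cast hj
    rw [towerHeight, doubleCuts]
    refine div_le_div₀ (by positivity) ?_ (by linarith) (by linarith)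
    push_cast
    nlinarith [sq_nonneg (r' j : ℝ)]
  have hsub := dyadicLimits_one_subset (𝕜 := 𝕜) (hT := hT) ht hr'_pos hr'_lim hAd
  have htop : weakLimitsOfPowers 𝕜 T hT atTop = dyadicLimits 𝕜 T hT 1 :=
    Set.Subset.antisymm
      (fun Q hQ => mem_dyadicLimits_of_mem ht hr'_pos hr'_lim hAd (Or.inl hQ)) hsub
  have hcof : weakLimitsOfPowers 𝕜 T hT cofinite = dyadicLimits 𝕜 T hT 1 := by
    refine Set.Subset.antisymm (fun Q hQ => ?_) (fun Q hQ => ?_)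
    · obtain ⟨n, hn, h⟩ := (mem_weakLimitsOfPowers_iff hT).1 hQ
      rcases h.trichotomy with ⟨hn', -⟩ | h
      · exact absurd hn hn'
      · exact mem_dyadicLimits_of_mem ht hr'_pos hr'_lim hAd h
    · obtain ⟨n, hn, h⟩ := (mem_weakLimitsOfPowers_iff hT).1 (hsub hQ)
      exact (mem_weakLimitsOfPowers_iff hT).2 ⟨n, hn.mono_right atTop_le_cofinite, h⟩
  have hall : weakLimitsOfPowers 𝕜 T hT ⊤ = dyadicLimits 𝕜 T hT 0 := by
    refine Set.Subset.antisymm (fun Q hQ => ?_) (fun Q hQ => ?_)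
    · obtain ⟨n, -, h⟩ := (mem_weakLimitsOfPowers_iff hT).1 hQ
      rcases h.trichotomy with ⟨-, a, rfl⟩ | h
      · exact mem_dyadicLimits_iff.2 (Or.inr ⟨0, a, le_rfl, by simp⟩)
      · rcases mem_dyadicLimits_of_mem ht hr'_pos hr'_lim hAd h with h | ⟨m, n, -, h⟩
        · exact Or.inl h
        · exact Or.inr ⟨m, n, Nat.zero_le m, h⟩
    · rcases hQ with h | ⟨m, a, -, rfl⟩
      · obtain ⟨n, -, h⟩ := (mem_weakLimitsOfPowers_iff hT).1 (hsub (Or.inl h))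
        exact (mem_weakLimitsOfPowers_iff hT).2 ⟨n, tendsto_top, h⟩
      · rcases Nat.eq_zero_or_pos m with rfl | hm
        · refine (mem_weakLimitsOfPowers_iff hT).2 ⟨fun _ => a, tendsto_top, ?_⟩
          simpa using weakTendsto_const (𝕜 := 𝕜) (hT := hT) a
        · obtain ⟨n, -, h⟩ := (mem_weakLimitsOfPowers_iff hT).1 (hsub (Or.inr ⟨m, a, hm, rfl⟩))
          exact (mem_weakLimitsOfPowers_iff hT).2 ⟨n, tendsto_top, h⟩
  refine ⟨htop, hcof, hall, ?_, ?_, ?_, ?_, fun hmix => ?_⟩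
  · rw [htop]; exact fun P hP Q hQ => dyadicLimits_mul_mem hP hQ
  · rw [hall]; exact fun P hP Q hQ => dyadicLimits_mul_mem hP hQ
  · rw [htop]; exact countable_dyadicLimits 1
  · rw [hall]; exact countable_dyadicLimits 0
  · obtain ⟨j, hj0, hj1⟩ := exists_measureReal_base_mem_Ioo ht hT hr'_pos
    have hE := ht.measurableSet_base j
    have h1 := measureReal_eq_of_isMixing hmix ((weakTendsto_const (𝕜 := 𝕜) (hT := hT) 0).half_mem
      ht hr'_pos hr'_lim hAd) hE
    rw [koopmanPow_zero, smul_apply, add_apply,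
      inner_smul_right, inner_add_right, inner_ind_constProj_ind, one_apply_eq_self, inner_ind,
      Set.inter_self] at h1
    have h2 : (2 : ℝ)⁻¹ * (μ.real (E j) + μ.real (E j) * μ.real (E j)) =
        μ.real (E j) * μ.real (E j) := by
      apply RCLike.ofReal_injective (K := 𝕜)
      push_cast at h1 ⊢
      exact h1
    nlinarith
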